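/- Let $k$ be a perfect field, let $K$ be a finite extension of the field of rational functions $k(q)$, and let $\mathcal O_K$ be the integral closure of $k[q]$ in $K$. Let $\sigma_q$ be the operator $f(x)\mapsto f(qx)$ on $K(x)$, let $P(x)\in\mathcal O_K[x]$ be nonzero, and put $$\mathcal A=\mathcal O_K\Big[x,\frac1{P(x)},\frac1{P(qx)},\frac1{P(q^2x)},\dots\Big]\subset K(x).$$ Let $\mathcal M=(M,\Sigma_q)$ be a $q$-difference module over $\mathcal A$: a free $\mathcal A$-module $M$ of finite rank with an additive operator $\Sigma_q:M\to M$ such that $\Sigma_q(fm)=\sigma_q(f)\Sigma_q(m)$ for $f\in\mathcal A$, $m\in M$, and which is invertible, i.e. its matrix in a basis of $M$ is invertible over $\mathcal A$. Extend $\Sigma_q$ to $M_{K(x)}=M\otimes_{\mathcal A}K(x)$ as $\Sigma_q\otimes\sigma_q$ and put $$\Delta_q=\frac{\Sigma_q-1}{(q-1)x},\qquad [n]_q=\frac{q^n-1}{q-1},\qquad [n]_q^!=[n]_q[n-1]_q\cdots[1]_q .$$ Let $\mathcal C$ be the set of cyclotomic places of $K$, i.e. of the places $v$ of $K$, trivial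 on $k$, at which $q$ is integral and its image $q_v$ in the residue field $k_v$ is a root of unity of order $>1$. "Almost all" means all but finitely many. Let $W_v\subset K(x)$ be the ring of rational functions of $v$-adic Gauss norm $\le1$, with its reduction map $W_v\to k_v(x)$. For almost all $v\in\mathcal C$ one has $\mathcal A\subset W_v$, and then $M_{k_v(x)}=M\otimes_{\mathcal A}k_v(x)$ is defined. On $k_v(x)$ let $\delta^{(n)}=d_{q_v}^n/[n]_{q_v}^!$ be the divided powers of the $q_v$-derivation: the $k_v$-linear maps with $\delta^{(n)}(x^r)=\binom rn_{q_v}x^{r-n}$, extended to $k_v(x)$ by the rule $\delta^{(n)}(fg)=\sum_{i+j=n}\sigma_{q_v}^i(\delta^{(j)}f)\,\delta^{(i)}g$. An iterative $q_v$-difference structure on a $k_v(x)$-vector space $N$ is a family of additive maps $\delta_N^{(n)}:N\to N$, $n\ge0$, with $\delta_N^{(0)}=\mathrm{id}$, with $$\delta_N^{(n)}(fm)=\sum_{i+j=n}\sigma_{q_v}^i(\delta^{(j)}f)\,\delta_N^{(i)}(m),\qquad \delta_N^{(i)}\circ\delta_N^{(j)}=\binom{i+j}{i}_{q_v}\delta_N^{(i+j)},$$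 and with $1+(q_v-1)x\,\delta_N^{(1)}$ bijective. It is trivial if $N$ has a finite basis annihilated by all $\delta_N^{(n)}$, $n\ge1$. The module $\mathcal M$ is said to induce such a structure on $M_{k_v(x)}$ if $\mathcal A\subset W_v$ and, for every $n\ge0$, the operator $\Delta_q^n/[n]_q^!$ on $M_{K(x)}$ maps $M\otimes_{\mathcal A}W_v$ into itself and its reduction is the operator $\delta^{(n)}_{M_{k_v(x)}}$ of the structure. Then the following statements are equivalent: 1. $\mathcal M$ becomes trivial over $K(x)$, i.e. $M_{K(x)}$ has a $K(x)$-basis of vectors fixed by $\Sigma_q$; 2. $\mathcal M$ induces an iterative $q_v$-difference structure on $M_{k_v(x)}$ for almost all $v\in\mathcal C$; 3. $\mathcal M$ induces a trivial iterative $q_v$-difference structure on $M_{k_v(x)}$ for almost all $v\in\mathcal C$. -/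

import Mathlib

open Polynomial
open scoped TensorProduct nonZeroDivisors

noncomputable section

namespace QDiff

/-! ### `q`-calculus on a field of rational functions -/

section QCalculus

variable {F : Type*} [Field F]

/-- The substitution `p(x) ↦ p(qx)` on polynomials. -/
def polySigma (q : Fˣ) : F[X] →+* F[X] := compRingHom (C (q : F) * X)

theorem polySigma_nonZeroDivisors (q : Fˣ) : F[X]⁰ ≤ F[X]⁰.comap (polySigma q) := by
  intro p hp
  rw [Submonoid.mem_comap, mem_nonZeroDivisors_iff_ne_zero]
  intro h
  exact nonZeroDivisors.ne_zero hp
    ((comp_C_mul_X_eq_zero_iff (mem_nonZeroDivisors_of_ne_zero q.ne_zero)).1 h)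

/-- The `q`-difference operator `f(x) ↦ f(qx)` on `F(x)`. -/
def sigma (q : Fˣ) : RatFunc F →+* RatFunc F :=
  RatFunc.mapRingHom (polySigma q) (polySigma_nonZeroDivisors q)

theorem sigma_algebraMap (q : Fˣ) (p : F[X]) :
    sigma q (algebraMap F[X] (RatFunc F) p) = algebraMap F[X] (RatFunc F) (polySigma q p) := by
  have h := RatFunc.map_apply_div (polySigma q) (polySigma_nonZeroDivisors q) p 1
  simpa [sigma, RatFunc.coe_mapRingHom_eq_coe_map] using h

/-- `[n]_q = (q ^ n - 1) / (q - 1)`; used only for `q ≠ 1`. -/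
def qInt (q : F) (n : ℕ) : F := (q ^ n - 1) / (q - 1)

/-- `[n]_q! = [n]_q [n-1]_q ⋯ [1]_q`, with `[0]_q! = 1`. -/
def qFactorial (q : F) (n : ℕ) : F := ∏ i ∈ Finset.range n, qInt q (i + 1)

/-- The `q`-binomial coefficient, as the value at `q` of the Gaussian polynomial (given by the
`q`-Pascal recursion), so that it makes sense at roots of unity as well. -/
def qBinom (q : F) : ℕ → ℕ → F
  | _, 0 => 1
  | 0, _ + 1 => 0
  | n + 1, k + 1 => qBinom q n k + q ^ (k + 1) * qBinom q n (k + 1)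

/-- The divided power `d_q^n / [n]_q!` of the `q`-derivation on polynomials: the `F`-linear map with
`x ^ r ↦ (r choose n)_q x ^ (r - n)` (which is `0` for `r < n`). It makes sense for all `q`. -/
def polyDivDeriv (q : F) (n : ℕ) (p : F[X]) : F[X] :=
  p.sum fun r a => C (a * qBinom q r n) * X ^ (r - n)

/-- The divided power `d_q^n / [n]_q!` of the `q`-derivation `d_q f = (f(qx) - f(x)) / ((q-1)x)`
on `F(x)`, for arbitrary `q`, a root of unity allowed. It extends `polyDivDeriv` to quotients
`f = a / b` by solving the `q`-Leibniz rule
`δ⁽ⁿ⁾(f b) = ∑_{i+j=n} σ_q^i (δ⁽ʲ⁾ f) δ⁽ⁱ⁾ b` for its term `δ⁽ⁿ⁾(f) b`, recursively in `n`. -/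
def divDeriv (q : Fˣ) (n : ℕ) (f : RatFunc F) : RatFunc F :=
  (algebraMap F[X] (RatFunc F) (polyDivDeriv (q : F) n f.num)
    - ∑ i : Fin n, (sigma q)^[(i : ℕ) + 1] (divDeriv q (n - ((i : ℕ) + 1)) f)
        * algebraMap F[X] (RatFunc F) (polyDivDeriv (q : F) ((i : ℕ) + 1) f.denom))
    / algebraMap F[X] (RatFunc F) f.denom
termination_by n
decreasing_by omega

variable {N : Type*} [AddCommGroup N] [Module (RatFunc F) N]

/-- The operator `Δ_q = (Σ_q - 1) / ((q - 1) x)` attached to an operator `Σ_q`. -/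
def Delta (q : Fˣ) (S : N → N) (m : N) : N :=
  (RatFunc.C ((q : F) - 1) * RatFunc.X)⁻¹ • (S m - m)

/-- The divided power `Δ_q^n / [n]_q!`; used only for `q` not a root of unity. -/
def divDelta (q : Fˣ) (S : N → N) (n : ℕ) (m : N) : N :=
  (RatFunc.C (qFactorial (q : F) n))⁻¹ • (Delta q S)^[n] m

variable (N) in
/-- An iterative `q`-difference structure on an `F(x)`-vector space `N`: a family of additive maps
`δ⁽ⁿ⁾` satisfying the Leibniz and composition rules of the operators `Δ_q^n / [n]_q!`, such that
`Σ_q = 1 + (q - 1) x δ⁽¹⁾` is bijective. Here `q` may be a root of unity. -/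
structure IterativeStructure (q : Fˣ) where
  δ : ℕ → N →+ N
  zero' : ∀ m, δ 0 m = m
  leibniz' : ∀ (n : ℕ) (f : RatFunc F) (m : N),
    δ n (f • m) = ∑ ij ∈ Finset.HasAntidiagonal.antidiagonal n, (sigma q)^[ij.1] (divDeriv q ij.2 f) • δ ij.1 m
  comp' : ∀ (i j : ℕ) (m : N), δ i (δ j m) = RatFunc.C (qBinom (q : F) (i + j) i) • δ (i + j) m
  bijective' : Function.Bijective
    fun m : N => m + (RatFunc.C ((q : F) - 1) * RatFunc.X) • δ 1 m

/-- An iterative `q`-difference structure is trivial if there is a basis annihilated by all `δ⁽ⁿ⁾`,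
`n ≥ 1`. -/
def IterativeStructure.IsTrivial {q : Fˣ} (D : IterativeStructure N q) : Prop :=
  ∃ (r : ℕ) (b : Module.Basis (Fin r) (RatFunc F) N), ∀ (n : ℕ), 1 ≤ n → ∀ i, D.δ n (b i) = 0

end QCalculus

/-! ### Extension of scalars along a ring homomorphism -/

section BaseChange

/-- `S ⊗_A M`, where `S` is an `A`-algebra through `f`. -/
def BaseChange {A S : Type*} [CommRing A] [CommRing S] (f : A →+* S)
    (M : Type*) [AddCommGroup M] [Module A M] : Type _ :=
  @TensorProduct A _ S M _ _ f.toAlgebra.toModule _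

variable {A S S' : Type*} [CommRing A] [CommRing S] [CommRing S']
  {M : Type*} [AddCommGroup M] [Module A M]

instance (f : A →+* S) : AddCommGroup (BaseChange f M) :=
  @TensorProduct.addCommGroup A _ S M _ _ f.toAlgebra.toModule _

instance (f : A →+* S) : Module S (BaseChange f M) :=
  letI := f.toAlgebra
  (TensorProduct.leftModule : Module S (S ⊗[A] M))

/-- The pure tensor `s ⊗ m`. -/
def BaseChange.tmul (f : A →+* S) (s : S) (m : M) : BaseChange f M :=
  @TensorProduct.tmul A _ S M _ _ f.toAlgebra.toModule _ s m

/-- The additive map `S ⊗_A M → S' ⊗_A M`, `s ⊗ m ↦ g s ⊗ φ m`, for `φ` semilinear along `τ`. -/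
def BaseChange.map (f : A →+* S) (f' : A →+* S') (g : S →+* S') {τ : A →+* A} (φ : M →ₛₗ[τ] M)
    (h : ∀ a, g (f a) = f' (τ a)) : BaseChange f M →+ BaseChange f' M :=
  letI := f.toAlgebra
  letI := f'.toAlgebra
  TensorProduct.liftAddHom (R := A) (M := S) (N := M) (P := S' ⊗[A] M)
    (AddMonoidHom.mk' (fun s => AddMonoidHom.mk' (fun m => g s ⊗ₜ[A] φ m)
      (fun m m' => by rw [map_add, TensorProduct.tmul_add]))
      (fun s s' => by ext m; simp [TensorProduct.add_tmul]))
    (fun a s m => by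
      simp only [AddMonoidHom.mk'_apply, LinearMap.map_smulₛₗ, TensorProduct.tmul_smul]
      rw [Algebra.smul_def, map_mul, TensorProduct.smul_tmul', Algebra.smul_def]
      exact congrArg (fun z => (z * g s) ⊗ₜ[A] φ m) (h a))

theorem BaseChange.map_tmul (f : A →+* S) (f' : A →+* S') (g : S →+* S') {τ : A →+* A}
    (φ : M →ₛₗ[τ] M) (h : ∀ a, g (f a) = f' (τ a)) (s : S) (m : M) :
    BaseChange.map f f' g φ h (BaseChange.tmul f s m) = BaseChange.tmul f' (g s) (φ m) := rfl

end BaseChange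

/-! ### Reduction of rational functions at a place -/

section Gauss

variable {K : Type*} [Field K] (V : ValuationSubring K)

/-- The embedding of `V[x]` into `K(x)`. -/
def polyToRatFunc : V[X] →+* RatFunc K :=
  (algebraMap K[X] (RatFunc K)).comp (mapRingHom V.subtype)

/-- The reduction map `V[x] → k_v(x)`, where `k_v` is the residue field of `V`. -/
def polyRed : V[X] →+* RatFunc (IsLocalRing.ResidueField V) :=
  (algebraMap _ (RatFunc (IsLocalRing.ResidueField V))).comp (mapRingHom (IsLocalRing.residue V))

theorem polyToRatFunc_injective : Function.Injective (polyToRatFunc V) :=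
  (IsFractionRing.injective K[X] (RatFunc K)).comp
    (map_injective _ Subtype.val_injective)

variable {V} in
theorem polyToRatFunc_ne_zero {b : V[X]} (hb : polyRed V b ≠ 0) : polyToRatFunc V b ≠ 0 := by
  intro h
  apply hb
  rw [(map_eq_zero_iff _ (polyToRatFunc_injective V)).1 h, map_zero]

/-- The ring of all rational functions of Gauss norm at most `1` with respect to `V`: the quotients
`a / b` with `a, b ∈ V[x]` and `b` of nonzero reduction. -/
def gaussRing : Subring (RatFunc K) where
  carrier := {f | ∃ a b : V[X], polyRed V b ≠ 0 ∧ f = polyToRatFunc V a / polyToRatFunc V b}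
  mul_mem' := by
    rintro _ _ ⟨a, b, hb, rfl⟩ ⟨a', b', hb', rfl⟩
    exact ⟨a * a', b * b', by rw [map_mul]; exact mul_ne_zero hb hb',
      by rw [map_mul, map_mul, div_mul_div_comm]⟩
  one_mem' := ⟨1, 1, by simp, by simp⟩
  add_mem' := by
    rintro _ _ ⟨a, b, hb, rfl⟩ ⟨a', b', hb', rfl⟩
    exact ⟨a * b' + b * a', b * b', by rw [map_mul]; exact mul_ne_zero hb hb',
      by rw [div_add_div _ _ (polyToRatFunc_ne_zero hb) (polyToRatFunc_ne_zero hb')]; simp⟩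
  zero_mem' := ⟨0, 1, by simp, by simp⟩
  neg_mem' := by
    rintro _ ⟨a, b, hb, rfl⟩
    exact ⟨-a, b, hb, by rw [map_neg, neg_div]⟩

/-- The reduction of an element of `gaussRing V`, computed from any presentation `a / b`. -/
def gaussRedFun (f : gaussRing V) : RatFunc (IsLocalRing.ResidueField V) :=
  polyRed V f.2.choose / polyRed V f.2.choose_spec.choose

variable {V} in
theorem gaussRedFun_eq (f : gaussRing V) {a b : V[X]} (hb : polyRed V b ≠ 0)
    (h : (f : RatFunc K) = polyToRatFunc V a / polyToRatFunc V b) :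
    gaussRedFun V f = polyRed V a / polyRed V b := by
  obtain ⟨hb', h'⟩ := f.2.choose_spec.choose_spec
  rw [h', div_eq_div_iff (polyToRatFunc_ne_zero hb') (polyToRatFunc_ne_zero hb),
    ← map_mul, ← map_mul] at h
  rw [gaussRedFun, div_eq_div_iff hb' hb, ← map_mul, ← map_mul, polyToRatFunc_injective V h]

/-- The reduction homomorphism from the ring of rational functions of Gauss norm at most `1`
to `k_v(x)`. -/
def gaussRed : gaussRing V →+* RatFunc (IsLocalRing.ResidueField V) where
  toFun := gaussRedFun V
  map_one' := by
    rw [gaussRedFun_eq (a := 1) (b := 1) 1 (by simp) (by simp)]; simp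
  map_zero' := by
    rw [gaussRedFun_eq (a := 0) (b := 1) 0 (by simp) (by simp)]; simp
  map_mul' := by
    rintro ⟨_, a, b, hb, rfl⟩ ⟨_, a', b', hb', rfl⟩
    rw [gaussRedFun_eq (a := a) (b := b) ⟨_, a, b, hb, rfl⟩ hb rfl,
      gaussRedFun_eq (a := a') (b := b') ⟨_, a', b', hb', rfl⟩ hb' rfl,
      gaussRedFun_eq (a := a * a') (b := b * b') _ (by rw [map_mul]; exact mul_ne_zero hb hb')
        (by simp [div_mul_div_comm]), div_mul_div_comm, map_mul, map_mul]
  map_add' := by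
    rintro ⟨_, a, b, hb, rfl⟩ ⟨_, a', b', hb', rfl⟩
    rw [gaussRedFun_eq (a := a) (b := b) ⟨_, a, b, hb, rfl⟩ hb rfl,
      gaussRedFun_eq (a := a') (b := b') ⟨_, a', b', hb', rfl⟩ hb' rfl,
      gaussRedFun_eq (a := a * b' + b * a') (b := b * b') _
        (by rw [map_mul]; exact mul_ne_zero hb hb')
        (by
          change _ / _ + _ / _ = _
          rw [div_add_div _ _ (polyToRatFunc_ne_zero hb) (polyToRatFunc_ne_zero hb')]; simp),
      div_add_div _ _ hb hb']
    simp

end Gauss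

/-! ### The arithmetic situation -/

section Arithmetic

variable (k K : Type*) [Field k] [Field K] [Algebra k[X] K]

/-- A cyclotomic place of `K`, a finite extension of `k(q)`: a place `v` of `K`, given by its
valuation ring, which is trivial on `k` and at which `q` is integral and reduces to a root of unity
of order strictly greater than `1` (`orderOf` is `0` for elements of infinite order). -/
structure CyclotomicPlace where
  ring : ValuationSubring K
  const_mem : ∀ c : k, algebraMap k[X] K (C c) ∈ ring
  q_mem : algebraMap k[X] K X ∈ ring
  one_lt_orderOf : 1 < orderOf (IsLocalRing.residue ring ⟨_, q_mem⟩)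

/-- The residue field `k_v`. -/
abbrev CyclotomicPlace.resField {k K : Type*} [Field k] [Field K] [Algebra k[X] K]
    (v : CyclotomicPlace k K) : Type _ := IsLocalRing.ResidueField v.ring

/-- The image `q_v` of `q` in `k_v`, a root of unity. -/
def CyclotomicPlace.qv {k K : Type*} [Field k] [Field K] [Algebra k[X] K]
    (v : CyclotomicPlace k K) : v.resFieldˣ :=
  Units.mk0 (IsLocalRing.residue v.ring ⟨_, v.q_mem⟩) (fun h => by
    have := v.one_lt_orderOf
    rw [h, orderOf_zero] at this
    omega)

variable [Algebra (RatFunc k) K] [IsScalarTower k[X] (RatFunc k) K]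

/-- The element `q` of `K`. -/
def qUnit : Kˣ :=
  Units.mk0 (algebraMap k[X] K X) (fun h =>
    X_ne_zero ((map_eq_zero_iff _ (FunctionField.algebraMap_injective k K)).1 h))

variable {k K}

/-- The `q`-difference algebra `𝒜 = 𝒪_K[x, 1/P(x), 1/P(qx), 1/P(q²x), …]` inside `K(x)`, where `𝒪_K`
is the integral closure of `k[q]` in `K`. -/
def qRing (P : (FunctionField.ringOfIntegers k K)[X]) : Subring (RatFunc K) :=
  (Algebra.adjoin (FunctionField.ringOfIntegers k K)
    (insert RatFunc.X (Set.range fun i : ℕ => ((sigma (qUnit k K))^[i]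
      (algebraMap K[X] (RatFunc K) (P.map (algebraMap _ K))))⁻¹))).toSubring

theorem sigma_mem_qRing (P : (FunctionField.ringOfIntegers k K)[X]) :
    ∀ f ∈ qRing P, sigma (qUnit k K) f ∈ qRing P := by
  intro f hf
  have hC : ∀ c : FunctionField.ringOfIntegers k K,
      algebraMap (FunctionField.ringOfIntegers k K) (RatFunc K) c
        = algebraMap K[X] (RatFunc K) (C (c : K)) := fun c => rfl
  change f ∈ Algebra.adjoin _ _ at hf
  change _ ∈ Algebra.adjoin _ _
  induction hf using Algebra.adjoin_induction with
  | mem g hg =>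
    rcases hg with rfl | ⟨i, rfl⟩
    · have hq : IsIntegral k[X] (algebraMap k[X] K X) := isIntegral_algebraMap
      have : sigma (qUnit k K) RatFunc.X
          = algebraMap (FunctionField.ringOfIntegers k K) (RatFunc K)
              ⟨algebraMap k[X] K X, hq⟩ * RatFunc.X := by
        rw [hC, ← RatFunc.algebraMap_X, sigma_algebraMap, ← map_mul]
        simp [polySigma, qUnit]
      rw [this]
      exact mul_mem (Subalgebra.algebraMap_mem _ _)
        (Algebra.subset_adjoin (Set.mem_insert _ _))
    · refine Algebra.subset_adjoin (Set.mem_insert_of_mem _ ⟨i + 1, ?_⟩)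
      simp only [Function.iterate_succ_apply', map_inv₀]
  | algebraMap c =>
    rw [hC, sigma_algebraMap]
    simp only [polySigma, coe_compRingHom_apply, C_comp]
    rw [← hC]
    exact Subalgebra.algebraMap_mem _ _
  | add f g _ _ hf hg => rw [map_add]; exact add_mem hf hg
  | mul f g _ _ hf hg => rw [map_mul]; exact mul_mem hf hg

/-- The `q`-difference operator `f(x) ↦ f(qx)` on `𝒜`. -/
def qRingSigma (P : (FunctionField.ringOfIntegers k K)[X]) : qRing P →+* qRing P :=
  (sigma (qUnit k K)).restrict (qRing P) (qRing P) (sigma_mem_qRing P)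

/-- The structure of a `q`-difference module on an `𝒜`-module `M`: a `σ_q`-semilinear operator
`Σ_q` which is invertible, i.e. `Σ_q(M)` generates `M` over `𝒜`. When `M` is free of finite rank,
this says that the matrix of `Σ_q` in a basis is invertible over `𝒜`. -/
structure QDifferenceModule (P : (FunctionField.ringOfIntegers k K)[X])
    (M : Type*) [AddCommGroup M] [Module (qRing P) M] where
  op : M →ₛₗ[qRingSigma P] M
  invertible : Submodule.span (qRing P) (Set.range op) = ⊤

namespace QDifferenceModule

variable {P : (FunctionField.ringOfIntegers k K)[X]} {M : Type*} [AddCommGroup M]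
  [Module (qRing P) M] (𝓜 : QDifferenceModule P M)

variable (P M) in
/-- `M_{K(x)} = K(x) ⊗_𝒜 M`. -/
abbrev Generic : Type _ := BaseChange (qRing P).subtype M

/-- The operator `σ_q ⊗ Σ_q` on `M_{K(x)}`. -/
def genericOp : Generic P M →+ Generic P M :=
  BaseChange.map (qRing P).subtype (qRing P).subtype (sigma (qUnit k K)) 𝓜.op (fun _ => rfl)

/-- The `q`-difference module `𝓜` becomes trivial over `K(x)`: there is a basis of `M_{K(x)}` fixed
by `Σ_q`. -/
def BecomesTrivial : Prop :=
  ∃ (r : ℕ) (b : Module.Basis (Fin r) (RatFunc K) (Generic P M)), ∀ i, 𝓜.genericOp (b i) = b i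

section Place

variable (v : CyclotomicPlace k K)

variable (P) in
/-- `𝒜` is `v`-integral, so that it can be reduced at `v`. This is the case for almost all `v`. -/
def IsGood : Prop := qRing P ≤ gaussRing v.ring

variable {v} in
/-- The inclusion of `𝒜` into the ring of rational functions of Gauss norm at most `1` at `v`. -/
def toGauss (hv : IsGood P v) : qRing P →+* gaussRing v.ring := Subring.inclusion hv

variable {v} in
/-- The reduction `𝒜 → k_v(x)`. -/
def toResidue (hv : IsGood P v) : qRing P →+* RatFunc v.resField :=
  (gaussRed v.ring).comp (toGauss hv)

variable {v}

variable (M) in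
/-- The extension of scalars of `M` to the ring of rational functions of Gauss norm at most `1`. -/
abbrev Lattice (hv : IsGood P v) : Type _ := BaseChange (toGauss hv) M

variable (M) in
/-- `M_{k_v(x)} = k_v(x) ⊗_𝒜 M`. -/
abbrev Reduction (hv : IsGood P v) : Type _ := BaseChange (toResidue hv) M

variable (M) in
/-- The natural map from the lattice to `M_{K(x)}`. -/
def latticeToGeneric (hv : IsGood P v) : Lattice M hv →+ Generic P M :=
  BaseChange.map (toGauss hv) (qRing P).subtype (gaussRing v.ring).subtype
    (LinearMap.id : M →ₗ[qRing P] M) (fun _ => rfl)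

variable (M) in
/-- The natural (surjective) map from the lattice to `M_{k_v(x)}`. -/
def latticeToReduction (hv : IsGood P v) : Lattice M hv →+ Reduction M hv :=
  BaseChange.map (toGauss hv) (toResidue hv) (gaussRed v.ring)
    (LinearMap.id : M →ₗ[qRing P] M) (fun _ => rfl)

/-- The iterative `q_v`-difference structure `D` on `M_{k_v(x)}` is induced by `𝓜`: each operator
`Δ_q^n / [n]_q!` of `M_{K(x)}` preserves the `v`-integral elements and reduces to the operator
`δ⁽ⁿ⁾` of `D`. -/
def IsInduced (hv : IsGood P v) (D : IterativeStructure (Reduction M hv) v.qv) : Prop :=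
  ∀ (n : ℕ) (w : Lattice M hv), ∃ w' : Lattice M hv,
    latticeToGeneric M hv w' = divDelta (qUnit k K) 𝓜.genericOp n (latticeToGeneric M hv w) ∧
    latticeToReduction M hv w' = D.δ n (latticeToReduction M hv w)

variable (v)

/-- `𝓜` induces an iterative `q_v`-difference structure on `M_{k_v(x)}`. -/
def InducesIterative : Prop :=
  ∃ (hv : IsGood P v) (D : IterativeStructure (Reduction M hv) v.qv), 𝓜.IsInduced hv D

/-- `𝓜` induces a trivial iterative `q_v`-difference structure on `M_{k_v(x)}`. -/
def InducesTrivialIterative : Prop :=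
  ∃ (hv : IsGood P v) (D : IterativeStructure (Reduction M hv) v.qv),
    𝓜.IsInduced hv D ∧ D.IsTrivial

end Place

end QDifferenceModule

end Arithmetic

end QDiff

end

set_option linter.unusedSectionVars false

open Polynomial
open scoped TensorProduct nonZeroDivisors

noncomputable section

namespace QDiff

/-! The implication from 1 to 3 is formal. On multiples of a vector fixed by Σ_q the operators
Δ_q^n/[n]_q^! act as the divided powers of the q-derivation on the coefficient
(`divDelta_smul_of_fixed`), and these reduce well at every cyclotomic place (`ReducesTo.divDelta`).
Only the finitely many places where 𝒜, a fixed basis or its inverse matrix fail to be integral are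
lost.

The substance is the implication from 2 to 1, an analogue of the Grothendieck-Katz conjecture on
p-curvatures in which cyclotomic places play the role of primes. Statement 2 is used only through
integrality: for the matrix A of Σ_q, the divided powers of Δ preserve the matrices of Gauss norm at
most 1 at almost all cyclotomic places (`NearlyIntegral`). This property is invariant under rational
changes of basis.

The arithmetic engine is the rationality criterion `exists_rational`. Let p(x)U(qx) = U(x)B(x) with
U(0) = 1, and let the coefficients of the power series U be integral at almost all cyclotomic
places. The recursion for the coefficients divides only by the numbers q^n - 1, so over the affine
line their poles up to index n have total size O(n log n). Iterating the equation T times shows that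
p(x/q)⋯p(x/q^T)U(x) has coefficients decaying like q^(-Tm) at the places over infinity. A Hankel
determinant of size N proportional to T, once its denominators are cleared, therefore has no pole on
the affine line and a zero at every place over infinity, so it vanishes. Vanishing Hankel minors
give Padé approximants, and these force U to be rational.

Regularity at the origin comes from a single good place v. If κ is the order of q_v, the integral
operator (S-1)⋯(S-q^(κ-1))/((q-1)⋯(q^κ-1)) has a denominator reducing to 0, so the reduced numerator
annihilates the identity matrix. The iterates of the reduced operator then span a finitely generated
stable lattice over the local ring at x = 0, and Nakayama's lemma makes their minimal relation
regular (`regular_of_relation`). Poles at the origin survive reduction at almost all places, so the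
relation over K(x) is regular too, and A can be gauged to a matrix regular at 0
(`exists_regular_gauge`).

The criterion is used twice. Applied to the series ∑ ∏_{i<n}(A(0)-q^i)/(q^(i+1)-1) x^n, it shows
that A(0) is annihilated by a product of distinct factors X - q^i, that is, the exponents are
integers and there are no logarithms (`exists_aeval_zpowProd_eq_zero`). Shearing transformations
then bring A(0) to 1 (`exists_gauge_evalZero_eq_one`). Now the power series solution of U(qx) =
U(x)A(x) with U(0) = 1 has as coefficients the values at 0 of Δ^n(1)/[n]_q^!, which are integral at
almost all places. By the criterion U is rational, and U⁻¹ is a basis of fixed vectors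
(`exists_fixed_of_evalZero_eq_one`). -/

section Places

/-! ### Valuation rings of a finite extension of k(q) and the product formula. -/

/-- Elements integral over a subring of a valuation ring lie in the valuation ring. -/
theorem mem_valuationSubring_of_isIntegral {R K : Type*} [CommRing R] [Field K] [Algebra R K]
    (V : ValuationSubring K) (hV : ∀ a : R, algebraMap R K a ∈ V) {x : K} (hx : IsIntegral R x) :
    x ∈ V := by
  let : Algebra R V := ((algebraMap R K).codRestrict V.toSubring hV).toAlgebra
  have : IsScalarTower R V K := IsScalarTower.of_algebraMap_eq fun _ => rfl
  have h : IsIntegral V x := hx.tower_top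
  obtain ⟨y, hy⟩ := IsIntegrallyClosed.isIntegral_iff.1 h
  rw [← hy]
  exact y.2

open IsDedekindDomain in
/-- A nontrivial valuation ring containing a Dedekind domain is the valuation ring of a prime. -/
theorem exists_heightOneSpectrum {O L : Type*} [CommRing O] [IsDedekindDomain O] [Field L]
    [Algebra O L] [IsFractionRing O L] (V : ValuationSubring L)
    (hV : ∀ a : O, algebraMap O L a ∈ V) (hne : V ≠ ⊤) :
    ∃ P : HeightOneSpectrum O, (P.valuation L).valuationSubring = V := by
  set f : O →+* V := (algebraMap O L).codRestrict V.toSubring hV with hf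
  set I : Ideal O := (IsLocalRing.maximalIdeal V).comap f with hI
  have hunit : ∀ a ∉ I, (algebraMap O L a)⁻¹ ∈ V := by
    intro a ha
    rw [hI, Ideal.mem_comap, IsLocalRing.mem_maximalIdeal, mem_nonunits_iff, not_not] at ha
    obtain ⟨u, hu⟩ := ha
    have h1 : (algebraMap O L a) = ((u : V) : L) := by rw [hu]; rfl
    have h2 : ((u : V) : L) * ((u⁻¹ : Vˣ) : V) = 1 := by
      exact_mod_cast congrArg Subtype.val u.mul_inv
    rw [h1, inv_eq_of_mul_eq_one_right h2]
    exact Subtype.mem _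
  -- If the centre I of V on O were zero, every nonzero element of O would be a unit of V, so V
  -- would be all of L.
  have hIne : I ≠ ⊥ := by
    intro h
    apply hne
    rw [eq_top_iff]
    intro y _
    obtain ⟨a, b, hb, rfl⟩ := IsFractionRing.div_surjective (A := O) y
    rw [div_eq_mul_inv]
    refine mul_mem (hV a) (hunit b ?_)
    rw [h, Ideal.mem_bot]
    exact nonZeroDivisors.ne_zero hb
  let P : HeightOneSpectrum O := ⟨I, inferInstance, hIne⟩
  have hle : ∀ y, P.valuation L y ≤ 1 → y ∈ V := by
    intro y hy
    obtain ⟨n, d, hd⟩ := P.exists_primeCompl_mul_eq_of_integer y hy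
    have hd0 : algebraMap O L d ≠ 0 := by
      intro h0
      rw [map_eq_zero_iff _ (IsFractionRing.injective O L)] at h0
      exact d.2 (by rw [h0]; exact zero_mem _)
    rw [← eq_div_iff hd0, div_eq_mul_inv] at hd
    rw [hd]
    exact mul_mem (hV n) (hunit d d.2)
  refine ⟨P, le_antisymm (fun y hy => hle y hy) fun y hy => ?_⟩
  rw [Valuation.mem_valuationSubring_iff]
  -- For the other inclusion, y with a pole at P has y⁻¹ = n/d with n in I. Then d = y n lies in the
  -- maximal ideal of V, although d is outside I.
  by_contra hlt
  rw [not_le] at hlt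
  have hy0 : y ≠ 0 := by rintro rfl; simp at hlt
  have hlt' : P.valuation L y⁻¹ < 1 := by
    rw [map_inv₀]; exact inv_lt_one_of_one_lt₀ hlt
  obtain ⟨n, d, hd⟩ := P.exists_primeCompl_mul_eq_of_integer _ hlt'.le
  have hn : n ∈ I := by
    refine (P.valuation_lt_one_iff_mem (K := L) n).1 ?_
    change P.valuation L (algebraMap O L n) < 1
    rw [← hd, map_mul]
    exact mul_lt_one_of_lt_of_le hlt' (P.valuation_le_one _)
  have hdn : f d = ⟨y, hy⟩ * f n := by
    apply Subtype.ext
    change algebraMap O L d = y * algebraMap O L n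
    rw [← hd, mul_inv_cancel_left₀ hy0]
  refine d.2 (?_ : f d ∈ IsLocalRing.maximalIdeal V)
  rw [hdn]
  exact Ideal.mul_mem_left _ _ hn

theorem CyclotomicPlace.algebraMap_mem {k K : Type*} [Field k] [Field K] [Algebra k[X] K]
    (v : CyclotomicPlace k K) (f : k[X]) : algebraMap k[X] K f ∈ v.ring := by
  induction f using Polynomial.induction_on' with
  | add f g hf hg => rw [map_add]; exact add_mem hf hg
  | monomial n c =>
    rw [← C_mul_X_pow_eq_monomial, map_mul, map_pow]
    exact mul_mem (v.const_mem c) (pow_mem v.q_mem n)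

section FunctionField

variable {k K : Type*} [Field k] [Field K] [Algebra k[X] K] [Algebra (RatFunc k) K]
  [IsScalarTower k[X] (RatFunc k) K]

open IsDedekindDomain in
/-- An element of a finite extension of `k(q)` has only finitely many poles over the affine line. -/
theorem finite_valuationSubring_notMem [FiniteDimensional (RatFunc k) K] (c : K) :
    {V : ValuationSubring K | (∀ f : k[X], algebraMap k[X] K f ∈ V) ∧ c ∉ V}.Finite := by
  -- The integral closure of k[q] in the separable part L is a Dedekind domain. As K/L is purely
  -- inseparable, every x in K has a power x^(p^n) in L, and x^(p^n) lies in a valuation ring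
  -- exactly when x does. Hence a valuation ring of K is determined by its trace on L, and c may be
  -- replaced by such a power.
  let L := separableClosure (RatFunc k) K
  let O := integralClosure k[X] L
  have : IsDedekindDomain O := integralClosure.isDedekindDomain k[X] (RatFunc k) L
  have : IsFractionRing O L := integralClosure.isFractionRing_of_finite_extension (RatFunc k) L
  let p := ringExpChar (RatFunc k)
  have : ExpChar L p := expChar_of_injective_algebraMap (algebraMap (RatFunc k) L).injective p
  have : ExpChar K p := expChar_of_injective_algebraMap (algebraMap (RatFunc k) K).injective p
  have hpow : ∀ x : K, ∃ n : ℕ, ∃ y : L, algebraMap L K y = x ^ p ^ n := fun x =>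
    IsPurelyInseparable.pow_mem L p x
  have hiff : ∀ (V : ValuationSubring K) (x : K) (n : ℕ), x ^ p ^ n ∈ V ↔ x ∈ V := by
    intro V x n
    rw [← V.valuation_le_one_iff, ← V.valuation_le_one_iff, map_pow]
    exact pow_le_one_iff (pow_ne_zero _ (expChar_pos K p).ne')
  obtain ⟨n, y, hy⟩ := hpow c
  have hex : ∀ V : {V : ValuationSubring K | (∀ f : k[X], algebraMap k[X] K f ∈ V) ∧ c ∉ V},
      ∃ P : HeightOneSpectrum O,
        (P.valuation L).valuationSubring = V.1.comap (algebraMap L K) := by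
    rintro ⟨V, hV, hc⟩
    refine exists_heightOneSpectrum _ ?_ ?_
    · intro a
      rw [ValuationSubring.mem_comap]
      refine mem_valuationSubring_of_isIntegral V hV ?_
      have h : IsIntegral k[X] (a : L) := a.2
      exact h.map (L.val.restrictScalars k[X])
    · intro h
      apply hc
      rw [← hiff V c n, ← hy, ← ValuationSubring.mem_comap, h]
      exact ValuationSubring.mem_top _
  choose P hP using hex
  have hinj : Function.Injective P := by
    intro V V' h
    have h' := hP V
    rw [h, hP V'] at h'
    apply Subtype.ext
    ext x
    obtain ⟨m, z, hz⟩ := hpow x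
    rw [← hiff _ x m, ← hiff _ x m, ← hz, ← ValuationSubring.mem_comap,
      ← ValuationSubring.mem_comap, h']
  have hfin := HeightOneSpectrum.Support.finite O (K := L) y
  have hmem : ∀ V, P V ∈ HeightOneSpectrum.Support O y := by
    intro V
    rw [HeightOneSpectrum.Support, Set.mem_ofPred_eq, ← not_le,
      ← Valuation.mem_valuationSubring_iff, hP V, ValuationSubring.mem_comap, hy, hiff]
    exact V.2.2
  have := hfin.to_subtype
  exact Set.finite_coe_iff.1 (Finite.of_injective
    (fun V => (⟨P V, hmem V⟩ : HeightOneSpectrum.Support O y))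
    fun V V' h => hinj (congrArg Subtype.val h))

variable (k) in
/-- A function on a finite extension of `k(q)` integral at all places over the affine line, and
with zeros at all places over infinity, is zero. -/
theorem eq_zero_of_forall_valuationSubring (z : K)
    (h : ∀ V : ValuationSubring K, (∀ f : k[X], algebraMap k[X] K f ∈ V) → z ∈ V)
    (h' : ∀ V : ValuationSubring K, (∀ c : k, algebraMap k[X] K (C c) ∈ V) →
      algebraMap k[X] K X ∉ V → algebraMap k[X] K X * z ∈ V) : z = 0 := by
  let : Algebra k K := ((algebraMap k[X] K).comp C).toAlgebra
  -- The intersection of the valuation rings containing k is the integral closure of k.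
  have hint : ∀ y : K, (∀ V : ValuationSubring K, (∀ c : k, algebraMap k[X] K (C c) ∈ V) → y ∈ V) →
      IsIntegral k y := by
    intro y hy
    have hmem : y ∈ ⨅ V : {V : ValuationSubring K // Set.range (algebraMap k K) ⊆ V.toSubring},
        V.1.toSubring := by
      rw [Subring.mem_iInf]
      rintro ⟨V, hV⟩
      exact hy V fun c => hV ⟨c, rfl⟩
    rw [iInf_valuationSubring_superset] at hmem
    have h1 : IsIntegral (Subring.closure (Set.range (algebraMap k K))) y := hmem
    have h2 : Subring.closure (Set.range (algebraMap k K)) = (algebraMap k K).range := by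
      rw [← RingHom.coe_range, Subring.closure_eq]
    rw [h2] at h1
    obtain ⟨p, hp, hpy⟩ := h1
    obtain ⟨p', hp', -, hp''⟩ := Polynomial.lifts_and_degree_eq_and_monic
      ((mem_lifts p).2 (Polynomial.map_surjective (algebraMap k K).rangeRestrict
        (algebraMap k K).rangeRestrict_surjective p)) hp
    refine ⟨p', hp'', ?_⟩
    rw [← hp', eval₂_map] at hpy
    exact hpy
  have hz : IsIntegral k z := by
    refine hint z fun V hV => ?_
    by_cases hq : algebraMap k[X] K X ∈ V
    · refine h V fun f => ?_
      induction f using Polynomial.induction_on' with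
      | add f g hf hg => rw [map_add]; exact add_mem hf hg
      | monomial n c =>
        rw [← C_mul_X_pow_eq_monomial, map_mul, map_pow]
        exact mul_mem (hV c) (pow_mem hq n)
    · have hq0 : algebraMap k[X] K X ≠ 0 := by
        intro h0; rw [h0] at hq; exact hq (zero_mem _)
      have h1 := mul_mem ((V.mem_or_inv_mem _).resolve_left hq) (h' V hV hq)
      rwa [inv_mul_cancel_left₀ hq0] at h1
  -- A nonzero z is now algebraic over k, hence so is z⁻¹. Since q is transcendental over k, some
  -- place is a pole of q; there q z and z⁻¹ are both integral, so q would be integral.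
  by_contra hz0
  obtain ⟨V, hV, hq⟩ : ∃ V : ValuationSubring K, (∀ c : k, algebraMap k[X] K (C c) ∈ V) ∧
      algebraMap k[X] K X ∉ V := by
    by_contra hcon
    push Not at hcon
    obtain ⟨p, hp, hpX⟩ := hint _ hcon
    apply hp.ne_zero
    apply FunctionField.algebraMap_injective k K
    rw [map_zero, ← hpX]
    conv_lhs => rw [← eval₂_C_X (p := p), hom_eval₂]
    rfl
  have hzinv : z⁻¹ ∈ V := mem_valuationSubring_of_isIntegral (R := k) V hV hz.inv
  apply hq
  have := mul_mem (h' V hV hq) hzinv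
  rwa [mul_inv_cancel_right₀ hz0] at this

namespace CyclotomicPlace

theorem finite_notMem [FiniteDimensional (RatFunc k) K] (c : K) : {v : CyclotomicPlace k K | c ∉ v.ring}.Finite := by
  refine Set.Finite.of_finite_image (f := CyclotomicPlace.ring) ?_ ?_
  · refine (finite_valuationSubring_notMem (k := k) c).subset ?_
    rintro _ ⟨v, hv, rfl⟩
    exact ⟨v.algebraMap_mem, hv⟩
  · rintro ⟨V, _, _, _⟩ _ ⟨V', _, _, _⟩ _ h
    cases h
    rfl

/-- Roots of unity of infinitely many orders occur as reductions of `q`. -/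
theorem exists_orderOf_notMem (s : Finset ℕ) :
    ∃ v : CyclotomicPlace k K, orderOf (v.qv : v.resField) ∉ s := by
  -- A prime m larger than all members of `s` is not in `s`, and larger than the characteristic it
  -- is nonzero in k, so that the roots of the m-th cyclotomic polynomial have exact order m.
  obtain ⟨m, hm, hmp⟩ := Nat.exists_infinite_primes (s.sup id + ringChar k + 1)
  have hmk : (m : k) ≠ 0 := by
    intro h
    rcases (Nat.dvd_prime hmp).1 ((ringChar.spec k m).1 h) with h1 | h1
    · exact CharP.ringChar_ne_one h1
    · omega
  let A : Subring K := (algebraMap k[X] K).range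
  let a : A := ⟨algebraMap k[X] K (cyclotomic m k), _, rfl⟩
  have hI : Ideal.span {a} ≠ ⊤ := by
    rw [Ne, Ideal.span_singleton_eq_top, isUnit_iff_exists_inv]
    rintro ⟨⟨_, g, rfl⟩, hg⟩
    have h1 : algebraMap k[X] K (cyclotomic m k * g) = algebraMap k[X] K 1 := by
      rw [map_mul, map_one]; exact congrArg Subtype.val hg
    have h2 := degree_eq_zero_of_isUnit
      (IsUnit.of_mul_eq_one _ (FunctionField.algebraMap_injective k K h1))
    exact (degree_cyclotomic_pos m k hmp.pos).ne' h2
  -- The value at q of the m-th cyclotomic polynomial is not a unit of k[q], so it lies in the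
  -- maximal ideal of some valuation ring containing k[q].
  obtain ⟨V, hAV, hV⟩ := Ideal.image_subset_nonunits_valuationSubring (A := A) _ hI
  have hmem : ∀ f : k[X], algebraMap k[X] K f ∈ V := fun f => hAV ⟨f, rfl⟩
  let φ : k[X] →+* V := (algebraMap k[X] K).codRestrict V.toSubring hmem
  let ρ : k[X] →+* IsLocalRing.ResidueField V := (IsLocalRing.residue V).comp φ
  have hroot : (cyclotomic m (IsLocalRing.ResidueField V)).IsRoot (ρ X) := by
    have h1 : ρ (cyclotomic m k) = 0 := by
      have : algebraMap k[X] K (cyclotomic m k) ∈ V.nonunits :=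
        hV ⟨a, Ideal.subset_span rfl, rfl⟩
      rw [← SetLike.mem_coe, ← V.image_maximalIdeal] at this
      obtain ⟨b, hb, hb'⟩ := this
      have h2 : φ (cyclotomic m k) = b := Subtype.ext hb'.symm
      change IsLocalRing.residue V (φ _) = 0
      rw [h2]
      exact (IsLocalRing.residue_eq_zero_iff b).2 hb
    rw [IsRoot, ← map_cyclotomic m (ρ.comp C), eval_map, ← h1]
    conv_rhs => rw [← eval₂_C_X (p := cyclotomic m k), hom_eval₂]
  have : NeZero ((m : ℕ) : IsLocalRing.ResidueField V) := by
    refine ⟨fun h => hmk ((ρ.comp C).injective ?_)⟩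
    rw [map_natCast, h, map_zero]
  have hprim := (isRoot_cyclotomic_iff.1 hroot).eq_orderOf
  refine ⟨⟨V, fun c => hmem _, hmem X, ?_⟩, ?_⟩
  · change 1 < orderOf (ρ X)
    rw [← hprim]; exact hmp.one_lt
  · change orderOf (ρ X) ∉ s
    rw [← hprim]
    intro hms
    have := Finset.le_sup (f := id) hms
    simp only [id] at this
    omega

end CyclotomicPlace

end FunctionField

end Places

/-! ### Hankel determinants and Padé approximants. -/

section Rationality

/-- A power series admitting good enough Padé approximants is rational. -/
theorem exists_mul_eq_of_pade {K : Type*} [Field K] (f : PowerSeries K) (D T₀ : ℕ) (hD : 0 < D)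
    (h : ∀ T, T₀ ≤ T → ∃ Q P : K[X], Q ≠ 0 ∧ Q.natDegree < D * T ∧ P.natDegree < D * T ∧
      (PowerSeries.X : PowerSeries K) ^ (4 * (D * T)) ∣ (Q : PowerSeries K) * f - P) :
    ∃ Q P : K[X], Q ≠ 0 ∧ (Q : PowerSeries K) * f = P := by
  have h' : ∀ n, ∃ Q P : K[X], Q ≠ 0 ∧ Q.natDegree < D * (T₀ + 1 + n) ∧
      P.natDegree < D * (T₀ + 1 + n) ∧ (PowerSeries.X : PowerSeries K) ^ (4 * (D * (T₀ + 1 + n))) ∣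
        (Q : PowerSeries K) * f - P := fun n => h _ (by omega)
  choose Q P hQ hdQ hdP hdvd using h'
  -- With T = T₀ + 1 + n ≥ 1 the difference of the two sides vanishes at 0 to order 4DT, while its
  -- degree is below DT + D(T+1) ≤ 3DT.
  have hstep : ∀ n, Q n * P (n + 1) = Q (n + 1) * P n := by
    intro n
    have h1 : (PowerSeries.X : PowerSeries K) ^ (4 * (D * (T₀ + 1 + n))) ∣
        ((Q n * P (n + 1) - Q (n + 1) * P n : K[X]) : PowerSeries K) := by
      have h2 := (hdvd n).mul_left (Q (n + 1) : PowerSeries K)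
      have h3 := ((pow_dvd_pow (PowerSeries.X : PowerSeries K)
        (show 4 * (D * (T₀ + 1 + n)) ≤ 4 * (D * (T₀ + 1 + (n + 1))) by gcongr; omega)).trans
        (hdvd (n + 1))).mul_left (Q n : PowerSeries K)
      have h4 := dvd_sub h2 h3
      convert h4 using 1
      push_cast
      ring
    rw [PowerSeries.X_pow_dvd_iff] at h1
    rw [← sub_eq_zero]
    ext m
    by_cases hm : m < 4 * (D * (T₀ + 1 + n))
    · have := h1 m hm
      rwa [coeff_coe] at this
    · rw [coeff_zero]
      apply coeff_eq_zero_of_natDegree_lt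
      have e1 : D * (T₀ + 1 + (n + 1)) ≤ 2 * (D * (T₀ + 1 + n)) := by nlinarith
      have e2 : (Q n * P (n + 1)).natDegree ≤ (Q n).natDegree + (P (n + 1)).natDegree :=
        natDegree_mul_le
      have e3 : (Q (n + 1) * P n).natDegree ≤ (Q (n + 1)).natDegree + (P n).natDegree :=
        natDegree_mul_le
      have e4 := natDegree_sub_le (Q n * P (n + 1)) (Q (n + 1) * P n)
      have := hdQ n
      have := hdP n
      have := hdQ (n + 1)
      have := hdP (n + 1)
      omega
  have hall : ∀ n, Q n * P 0 = Q 0 * P n := by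
    intro n
    induction n with
    | zero => rfl
    | succ n ih =>
      apply mul_left_cancel₀ (hQ n)
      linear_combination Q (n + 1) * ih - Q 0 * hstep n
  refine ⟨Q 0, P 0, hQ 0, ?_⟩
  by_contra hne
  rw [← sub_eq_zero] at hne
  set y := (Q 0 : PowerSeries K) * f - P 0 with hy
  -- Since Q_n y = Q_0 (Q_n f - P_n) vanishes to order 4DT and Q_n itself to order less than DT, the
  -- order of y exceeds DT for every T, which forces y = 0.
  have hord : ∀ n, ((D * (T₀ + 1 + n) : ℕ) : ℕ∞) ≤ y.order := by
    intro n
    have h1 : (PowerSeries.X : PowerSeries K) ^ (4 * (D * (T₀ + 1 + n))) ∣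
        (Q n : PowerSeries K) * y := by
      have h2 := (hdvd n).mul_left (Q 0 : PowerSeries K)
      have h3 : ((Q n * P 0 : K[X]) : PowerSeries K) = ((Q 0 * P n : K[X]) : PowerSeries K) := by
        rw [hall n]
      convert h2 using 1
      push_cast at h3
      rw [hy]
      linear_combination -h3
    have h5 : ((4 * (D * (T₀ + 1 + n)) : ℕ) : ℕ∞) ≤ ((Q n : PowerSeries K) * y).order :=
      PowerSeries.le_order _ _ fun i hi => PowerSeries.X_pow_dvd_iff.1 h1 i (by exact_mod_cast hi)
    rw [PowerSeries.order_mul] at h5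
    have h6 : (Q n : PowerSeries K).order ≤ ((Q n).natDegree : ℕ) := by
      apply PowerSeries.order_le
      rw [coeff_coe]
      exact leadingCoeff_ne_zero.2 (hQ n)
    have h7 : (Q n : PowerSeries K).order ≤ ((D * (T₀ + 1 + n) : ℕ) : ℕ∞) :=
      h6.trans (by exact_mod_cast (hdQ n).le)
    by_contra hlt
    rw [not_le] at hlt
    have h8 := h5.trans (add_le_add h7 hlt.le)
    have h9 : D * (T₀ + 1 + n) > 0 := by positivity
    have h10 : 4 * (D * (T₀ + 1 + n)) ≤ D * (T₀ + 1 + n) + D * (T₀ + 1 + n) := by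
      exact_mod_cast h8
    omega
  have hfin : y.order ≠ ⊤ := by rwa [Ne, PowerSeries.order_eq_top]
  obtain ⟨m, hm⟩ := ENat.ne_top_iff_exists.1 hfin
  have := hord m
  rw [← hm] at this
  have h11 : D * (T₀ + 1 + m) ≤ m := by exact_mod_cast this
  nlinarith

/-- If all maximal minors of a matrix with `N` columns vanish, its columns are dependent. -/
theorem exists_mulVec_eq_zero_of_minors {K : Type*} [Field K] {R N : ℕ}
    (H : Matrix (Fin R) (Fin N) K)
    (h : ∀ I : Fin N → Fin R, (H.submatrix I id).det = 0) :
    ∃ c : Fin N → K, c ≠ 0 ∧ H.mulVec c = 0 := by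
  by_contra hcon
  push Not at hcon
  have hinj : Function.Injective H.mulVecLin := by
    rw [← LinearMap.ker_eq_bot, LinearMap.ker_eq_bot']
    intro c hc
    by_contra hc0
    exact hcon c hc0 (by simpa using hc)
  have hrank : H.rank = N := by
    rw [Matrix.rank, LinearMap.finrank_range_of_inj hinj, Module.finrank_fin_fun]
  rw [Matrix.rank_eq_finrank_span_row] at hrank
  obtain ⟨g, hg, -, hli⟩ := Submodule.exists_fun_fin_finrank_span_eq K (Set.range H.row)
  choose I hI using hg
  let e : Fin N ≃ Fin (Module.finrank K (Submodule.span K (Set.range H.row))) :=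
    finCongr hrank.symm
  have hdet := h (I ∘ e)
  have hli' : LinearIndependent K (H.submatrix (I ∘ e) id).row := by
    have h1 : (H.submatrix (I ∘ e) id).row = g ∘ e := by
      funext i
      rw [Function.comp_apply, ← hI]
      rfl
    rw [h1]
    exact hli.comp _ e.injective
  rw [Matrix.linearIndependent_rows_iff_isUnit, Matrix.isUnit_iff_isUnit_det, hdet] at hli'
  exact not_isUnit_zero hli'

/-- Padé approximants from vanishing Hankel minors. -/
theorem exists_pade_of_minors {K : Type*} [Field K] (f : PowerSeries K) (R N : ℕ)
    (h : ∀ I : Fin N → Fin R,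
      (Matrix.of fun i j : Fin N => PowerSeries.coeff ((I i : ℕ) + j) f).det = 0) :
    ∃ Q P : K[X], Q ≠ 0 ∧ Q.natDegree < N ∧ P.natDegree < N ∧
      (PowerSeries.X : PowerSeries K) ^ R ∣ (Q : PowerSeries K) * f - P := by
  obtain ⟨c, hc, hHc⟩ := exists_mulVec_eq_zero_of_minors
    (Matrix.of fun (i : Fin R) (j : Fin N) => PowerSeries.coeff ((i : ℕ) + j) f) h
  have hN : 0 < N := by
    rcases Nat.eq_zero_or_pos N with rfl | h0
    · exact absurd (Subsingleton.elim c 0) hc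
    · exact h0
  -- The vector c is read in reverse order so that the coefficient of x^(N-1+m) in Q f is the m-th
  -- entry of H c. The numerator is then the truncation of Q f below degree N - 1.
  let Q : K[X] := ∑ j : Fin N, C (c j) * X ^ (N - 1 - j : ℕ)
  have hcoeff : ∀ m, PowerSeries.coeff (N - 1 + m) ((Q : PowerSeries K) * f) =
      ∑ j : Fin N, PowerSeries.coeff (m + j) f * c j := by
    intro m
    have h1 : (Q : PowerSeries K) = ∑ j : Fin N,
        PowerSeries.C (c j) * PowerSeries.X ^ (N - 1 - j : ℕ) := by
      rw [← coeToPowerSeries.ringHom_apply, map_sum]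
      simp [coeToPowerSeries.ringHom_apply]
    rw [h1, Finset.sum_mul, map_sum]
    refine Finset.sum_congr rfl fun j _ => ?_
    have h2 : N - 1 + m = (m + j) + (N - 1 - j) := by omega
    rw [mul_assoc, PowerSeries.coeff_C_mul, h2, PowerSeries.coeff_X_pow_mul, mul_comm]
  refine ⟨Q, (PowerSeries.trunc (N - 1) ((Q : PowerSeries K) * f)), ?_, ?_, ?_, ?_⟩
  · obtain ⟨j, hj⟩ := Function.ne_iff.1 hc
    intro hQ0
    apply hj
    have h1 : Q.coeff (N - 1 - j) = c j := by
      simp only [Q, finsetSum_coeff, coeff_C_mul, coeff_X_pow]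
      rw [Finset.sum_eq_single j]
      · simp
      · intro i _ hij
        rw [if_neg, mul_zero]
        intro h2
        apply hij
        ext
        omega
      · simp
    rw [← h1, hQ0, coeff_zero, Pi.zero_apply]
  · refine lt_of_le_of_lt (natDegree_sum_le_of_forall_le (n := N - 1) _ _ fun j _ => ?_) (by omega)
    exact (natDegree_C_mul_X_pow_le _ _).trans (by omega)
  · by_cases hP : PowerSeries.trunc (N - 1) ((Q : PowerSeries K) * f) = 0
    · rw [hP, natDegree_zero]; exact hN
    · have := (natDegree_lt_iff_degree_lt hP).2 (PowerSeries.degree_trunc_lt _ _)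
      omega
  · rw [PowerSeries.X_pow_dvd_iff]
    intro m hm
    rw [map_sub, coeff_coe, PowerSeries.coeff_trunc]
    split_ifs with h1
    · exact sub_self _
    · obtain ⟨i, rfl⟩ : ∃ i, m = N - 1 + i := ⟨m - (N - 1), by omega⟩
      rw [hcoeff, sub_zero]
      exact congrFun hHc ⟨i, by omega⟩

section Valuation

variable {K Γ : Type*} [Field K] [LinearOrderedCommGroupWithZero Γ] (v : Valuation K Γ)

/-- Upper bound for a determinant whose columns decay. -/
theorem valuation_det_mul_pow_le {N : ℕ} (M : Matrix (Fin N) (Fin N) K) (Q : Γ) (a : Fin N → ℕ)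
    (b : ℕ) (h : ∀ i j, v (M i j) * Q ^ a j ≤ Q ^ b) :
    v M.det * Q ^ (∑ j, a j) ≤ Q ^ (N * b) := by
  have hQ : (0 : Γ) ≤ Q ^ (∑ j, a j) := zero_le
  rw [Matrix.det_apply]
  by_cases h0 : Q ^ (∑ j, a j) = 0
  · rw [h0, mul_zero]; exact zero_le
  · rw [← le_div_iff₀ (zero_lt_iff.2 h0)]
    refine v.map_sum_le fun σ _ => ?_
    have hs : v (Equiv.Perm.sign σ • ∏ i, M (σ i) i) = ∏ i, v (M (σ i) i) := by
      rcases Int.units_eq_one_or (Equiv.Perm.sign σ) with hσ | hσ <;> simp [hσ, map_prod]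
    rw [hs, le_div_iff₀ (zero_lt_iff.2 h0), ← Finset.prod_pow_eq_pow_sum,
      ← Finset.prod_mul_distrib]
    calc ∏ i, v (M (σ i) i) * Q ^ a i ≤ ∏ _i : Fin N, Q ^ b :=
          Finset.prod_le_prod' fun i _ => h _ _
      _ = Q ^ (N * b) := by rw [Finset.prod_const, Finset.card_univ, Fintype.card_fin, ← pow_mul,
          mul_comm]

/-- The coefficients `f_m` of `f` satisfy `|f_m| ≤ |q| ^ (c m + b - T m)`. -/
def CoeffBound (q : K) (c T b : ℕ) (f : PowerSeries K) : Prop :=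
  ∀ m, v (PowerSeries.coeff m f) * v q ^ (T * m) ≤ v q ^ (c * m + b)

variable {v} {q : K} {c T b : ℕ}

theorem CoeffBound.sum {ι : Type*} {s : Finset ι} {f : ι → PowerSeries K}
    (hq : q ≠ 0) (h : ∀ i ∈ s, CoeffBound v q c T b (f i)) :
    CoeffBound v q c T b (∑ i ∈ s, f i) := by
  intro m
  have h0 : 0 < v q ^ (T * m) := pow_pos ((Valuation.pos_iff v).2 hq) _
  rw [← le_div_iff₀ h0, map_sum]
  refine v.map_sum_le fun i hi => ?_
  rw [le_div_iff₀ h0]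
  exact h i hi m

/-- Replacing x by x/q divides the m-th coefficient by q^m, which raises T by one. Multiplication by
g shifts indices by at most d, at a cost of q^(dT) in the previous bound; hence the new b. -/
theorem CoeffBound.rescale_mul {f : PowerSeries K} {g : K[X]} {d : ℕ} (hq : 1 < v q)
    (hf : CoeffBound v q c T b f) (hg : g.natDegree ≤ d) (hgc : ∀ j, v (g.coeff j) ≤ v q ^ (c * j)) :
    CoeffBound v q c (T + 1) (b + d * T) (PowerSeries.rescale q⁻¹ (f * g)) := by
  intro m
  have hq0 : 0 < v q := zero_lt_one.trans hq
  have hqm : (v q) ^ m ≠ 0 := (pow_pos hq0 m).ne'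
  have e : v (PowerSeries.coeff m (PowerSeries.rescale q⁻¹ (f * g))) * v q ^ ((T + 1) * m) =
      v (PowerSeries.coeff m (f * g)) * v q ^ (T * m) := by
    rw [PowerSeries.coeff_rescale, map_mul, map_pow, map_inv₀, add_mul, one_mul, pow_add, inv_pow]
    field_simp
  rw [e, ← le_div_iff₀ (pow_pos hq0 _), PowerSeries.coeff_mul]
  refine v.map_sum_le fun ij hij => ?_
  rw [Finset.HasAntidiagonal.mem_antidiagonal] at hij
  rw [le_div_iff₀ (pow_pos hq0 _), map_mul, coeff_coe]
  by_cases hj : ij.2 ≤ d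
  · calc v (PowerSeries.coeff ij.1 f) * v (g.coeff ij.2) * v q ^ (T * m)
        = (v (PowerSeries.coeff ij.1 f) * v q ^ (T * ij.1)) *
          (v (g.coeff ij.2) * v q ^ (T * ij.2)) := by
          rw [← hij, mul_add, pow_add]; ac_rfl
      _ ≤ v q ^ (c * ij.1 + b) * (v q ^ (c * ij.2) * v q ^ (d * T)) := by
          refine mul_le_mul' (hf _) (mul_le_mul' (hgc _) (pow_le_pow_right₀ hq.le ?_))
          rw [mul_comm]; gcongr
      _ = v q ^ (c * m + (b + d * T)) := by
          rw [← hij, ← pow_add, ← pow_add]; congr 1; ring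
  · rw [coeff_eq_zero_of_natDegree_lt (by omega), map_zero, mul_zero, zero_mul]
    exact zero_le

/-- Upper bound for Hankel minors of `f` from decay of the coefficients of `g` and `g f`. -/
theorem valuation_hankel_det_mul_pow_le {f g : PowerSeries K} (hq : 1 < v q)
    (hf : CoeffBound v q c 0 0 f) (hg : CoeffBound v q c T b g)
    (hfg : CoeffBound v q c T b (g * f)) (hg0 : PowerSeries.constantCoeff g = 1) {N R : ℕ}
    (I : Fin N → Fin R) :
    v (Matrix.of fun i j : Fin N => PowerSeries.coeff ((I i : ℕ) + j) f).det *
      v q ^ (∑ j : Fin N, T * (j : ℕ)) ≤ v q ^ (N * (c * (R + N) + b)) := by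
  set H := (Matrix.of fun i j : Fin N => PowerSeries.coeff ((I i : ℕ) + j) f)
  -- The unipotent Toeplitz matrix of g performs column operations that replace f by g f, up to
  -- boundary terms, without changing the determinant.
  let G : Matrix (Fin N) (Fin N) K :=
    Matrix.of fun l j => if l ≤ j then PowerSeries.coeff ((j : ℕ) - l) g else 0
  have hG : G.det = 1 := by
    rw [Matrix.det_of_isUpperTriangular]
    · refine Finset.prod_eq_one fun i _ => ?_
      simp [G, hg0]
    · intro i j hij
      simp only [G, Matrix.of_apply]
      exact if_neg (not_le.2 hij)
  have hdet : H.det = (H * G).det := by rw [Matrix.det_mul, hG, mul_one]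
  rw [hdet]
  refine valuation_det_mul_pow_le v _ _ _ _ fun i j => ?_
  -- The convolution computing g f is missing the terms with index of f below I i. In these the
  -- index of g exceeds j, so they also decay like q^(-Tj).
  have hentry : (H * G) i j = PowerSeries.coeff ((I i : ℕ) + j) (g * f) -
      ∑ l ∈ Finset.range (I i : ℕ), PowerSeries.coeff ((I i : ℕ) + j - l) g *
        PowerSeries.coeff l f := by
    rw [eq_sub_iff_add_eq, mul_comm g f, PowerSeries.coeff_mul,
      Finset.Nat.sum_antidiagonal_eq_sum_range_succ
        (fun a b => PowerSeries.coeff a f * PowerSeries.coeff b g),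
      Nat.succ_eq_add_one, add_assoc, Finset.sum_range_add, add_comm]
    congr 1
    · exact Finset.sum_congr rfl fun l _ => mul_comm _ _
    · rw [Matrix.mul_apply]
      simp only [H, G, Matrix.of_apply, Fin.le_def]
      rw [Fin.sum_univ_eq_sum_range (fun l => PowerSeries.coeff ((I i : ℕ) + l) f *
        if l ≤ (j : ℕ) then PowerSeries.coeff ((j : ℕ) - l) g else 0) N]
      symm
      refine Finset.sum_subset_zero_on_sdiff (fun x hx => ?_) (fun x hx => ?_) fun x hx => ?_
      · rw [Finset.mem_range] at hx ⊢
        have := j.2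
        omega
      · rw [Finset.mem_sdiff, Finset.mem_range, Finset.mem_range] at hx
        rw [if_neg (by omega), mul_zero]
      · rw [Finset.mem_range] at hx
        rw [if_pos (by omega), Nat.add_sub_add_left]
  have hq0 : 0 < v q := zero_lt_one.trans hq
  have hIj : (I i : ℕ) + j ≤ R + N := by have := (I i).2; have := j.2; omega
  rw [hentry, ← le_div_iff₀ (pow_pos hq0 _)]
  refine (v.map_sub _ _).trans (max_le ?_ (v.map_sum_le fun l hl => ?_))
  · rw [le_div_iff₀ (pow_pos hq0 _)]
    calc _ ≤ v (PowerSeries.coeff ((I i : ℕ) + j) (g * f)) * v q ^ (T * ((I i : ℕ) + j)) := by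
          refine mul_le_mul' le_rfl (pow_le_pow_right₀ hq.le ?_)
          gcongr; omega
      _ ≤ _ := hfg _
      _ ≤ _ := pow_le_pow_right₀ hq.le (by gcongr)
  · rw [le_div_iff₀ (pow_pos hq0 _), map_mul]
    rw [Finset.mem_range] at hl
    have hfl := hf l
    rw [zero_mul, pow_zero, mul_one, add_zero] at hfl
    calc _ ≤ v (PowerSeries.coeff ((I i : ℕ) + j - l) g) * v q ^ (T * ((I i : ℕ) + j - l)) *
          v (PowerSeries.coeff l f) := by
          rw [mul_right_comm]
          refine mul_le_mul' (mul_le_mul' le_rfl (pow_le_pow_right₀ hq.le ?_)) le_rfl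
          gcongr; omega
      _ ≤ v q ^ (c * ((I i : ℕ) + j - l) + b) * v q ^ (c * l) := mul_le_mul' (hg _) hfl
      _ = v q ^ (c * ((I i : ℕ) + j) + b) := by
          rw [← pow_add]; congr 1
          have : (I i : ℕ) + j = ((I i : ℕ) + j - l) + l := by omega
          conv_rhs => rw [this]
          ring
      _ ≤ _ := pow_le_pow_right₀ hq.le (by gcongr)

end Valuation

end Rationality

/-! ### Divisibility of q^i - 1 and growth of the denominators. -/

section Denominators

theorem isUnit_pow_sub_one_of_not_orderOf_dvd {A : Type*} [CommRing A] [IsLocalRing A] (x : A)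
    (i : ℕ) (h : ¬ orderOf (IsLocalRing.residue A x) ∣ i) : IsUnit (x ^ i - 1) := by
  by_contra hu
  rw [← mem_nonunits_iff, ← IsLocalRing.mem_maximalIdeal, ← IsLocalRing.residue_eq_zero_iff,
    map_sub, map_pow, map_one, sub_eq_zero] at hu
  exact h (orderOf_dvd_of_pow_eq_one hu)

/-- Over a field of characteristic exponent `p`, the number `x ^ i - 1` divides a small power of
`x ^ m - 1`, where `m` is the order of the reduction of `x`. -/
theorem pow_sub_one_dvd_pow {k A : Type*} [Field k] [CommRing A] [IsLocalRing A] [Algebra k A]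
    (p : ℕ) [ExpChar k p] (x : A) (i : ℕ) (hi : i ≠ 0) :
    x ^ i - 1 ∣ (x ^ orderOf (IsLocalRing.residue A x) - 1) ^ p ^ i.factorization p := by
  set m := orderOf (IsLocalRing.residue A x) with hm
  by_cases hmi : m ∣ i
  swap
  · exact (isUnit_pow_sub_one_of_not_orderOf_dvd x i hmi).dvd
  set a := i.factorization p with ha
  have : ExpChar A p := expChar_of_injective_algebraMap (algebraMap k A).injective p
  have : ExpChar (IsLocalRing.ResidueField A) p :=
    expChar_of_injective_algebraMap (algebraMap k (IsLocalRing.ResidueField A)).injective p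
  obtain ⟨i', hi'⟩ : p ^ a ∣ i := Nat.ordProj_dvd i p
  have hi'k : (i' : k) ≠ 0 := by
    intro h0
    have hi'0 : i' ≠ 0 := by rintro rfl; simp at hi'; exact hi hi'
    rcases ‹ExpChar k p› with _ | ⟨hp⟩
    · exact hi'0 (by exact_mod_cast h0)
    · have h1 : p ∣ i' := (CharP.cast_eq_zero_iff k p i').1 h0
      refine Nat.not_dvd_ordCompl hp hi ?_
      rw [← ha]
      have : i / p ^ a = i' := by
        rw [hi', Nat.mul_div_cancel_left _ (pow_pos hp.pos _)]
      rwa [this]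
  have hpow : ∀ y : A, (y - 1) ^ p ^ a = y ^ p ^ a - 1 := by
    intro y
    rw [sub_pow_expChar_pow, one_pow]
  -- Here i = p^a i' with i' prime to p, and the p^a-th power is additive.
  have hxi : x ^ i - 1 = (x ^ i' - 1) ^ p ^ a := by
    rw [hpow, ← pow_mul, mul_comm i', ← hi']
  have hmi' : m ∣ i' := by
    apply orderOf_dvd_of_pow_eq_one
    rw [← sub_eq_zero]
    apply pow_eq_zero_iff (n := p ^ a) (pow_ne_zero _ (expChar_pos k p).ne') |>.1
    rw [← map_pow, ← map_one (IsLocalRing.residue A), ← map_sub, ← map_pow, ← hxi, map_sub,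
      map_pow, map_one, sub_eq_zero]
    exact orderOf_dvd_iff_pow_eq_one.1 hmi
  obtain ⟨t, ht⟩ := hmi'
  rw [hxi]
  refine pow_dvd_pow_of_dvd ?_ _
  -- The cofactor of x^m - 1 in x^i' - 1 is a geometric sum with t = i'/m terms, each reducing to 1;
  -- it reduces to t, which is nonzero in k.
  have hunit : IsUnit (∑ l ∈ Finset.range t, (x ^ m) ^ l) := by
    by_contra hu
    rw [← mem_nonunits_iff, ← IsLocalRing.mem_maximalIdeal, ← IsLocalRing.residue_eq_zero_iff,
      map_sum] at hu
    have h1 : ∀ l ∈ Finset.range t, IsLocalRing.residue A ((x ^ m) ^ l) = 1 := by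
      intro l _
      rw [map_pow, map_pow, hm, pow_orderOf_eq_one, one_pow]
    rw [Finset.sum_congr rfl h1, Finset.sum_const, Finset.card_range, nsmul_eq_mul, mul_one,
      ← map_natCast (algebraMap k (IsLocalRing.ResidueField A)), map_eq_zero] at hu
    apply hi'k
    rw [ht, Nat.cast_mul, hu, mul_zero]
  have h2 : x ^ i' - 1 = (∑ l ∈ Finset.range t, (x ^ m) ^ l) * (x ^ m - 1) := by
    rw [geom_sum_mul, ← pow_mul, ← ht]
  rw [h2]
  exact (hunit.mul_left_dvd).2 dvd_rfl

/-- `∑_{i ≤ n} p ^ v_p(i)`. -/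
def sumOrdProj (p n : ℕ) : ℕ := ∑ i ∈ Finset.range n, p ^ (i + 1).factorization p

/-- p^(v_p(i)) is at most the sum of the p^a dividing i. After exchanging the sums each a
contributes p^a ⌊n/p^a⌋ ≤ n, and at most log₂ n + 1 values of a occur. For p not prime all terms are
1. This nearly linear growth is what the decay at infinity has to beat. -/
theorem sumOrdProj_le (p n : ℕ) : sumOrdProj p n ≤ n * (Nat.log 2 n + 1) := by
  rw [sumOrdProj]
  by_cases hp : p.Prime
  swap
  · have : ∀ i ∈ Finset.range n, p ^ (i + 1).factorization p = 1 := by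
      intro i _
      rw [Nat.factorization_eq_zero_of_not_prime _ hp, pow_zero]
    rw [Finset.sum_congr rfl this]
    simp
    nlinarith
  calc ∑ i ∈ Finset.range n, p ^ (i + 1).factorization p
      ≤ ∑ i ∈ Finset.range n, ∑ a ∈ Finset.range (Nat.log 2 n + 1),
          if p ^ a ∣ i + 1 then p ^ a else 0 := by
        refine Finset.sum_le_sum fun i hi => ?_
        rw [Finset.mem_range] at hi
        have hle : (i + 1).factorization p ≤ Nat.log 2 n := by
          apply Nat.le_log_of_pow_le one_lt_two
          calc 2 ^ (i + 1).factorization p ≤ p ^ (i + 1).factorization p :=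
                Nat.pow_le_pow_left hp.two_le _
            _ ≤ i + 1 := Nat.ordProj_le p (by omega)
            _ ≤ n := hi
        refine le_trans ?_ (Finset.single_le_sum
          (f := fun a => if p ^ a ∣ i + 1 then p ^ a else 0) (fun _ _ => Nat.zero_le _)
          (Finset.mem_range.2 (Nat.lt_succ_of_le hle)))
        rw [if_pos (Nat.ordProj_dvd _ _)]
    _ = ∑ a ∈ Finset.range (Nat.log 2 n + 1), ∑ i ∈ Finset.range n,
          if p ^ a ∣ i + 1 then p ^ a else 0 := Finset.sum_comm
    _ ≤ ∑ a ∈ Finset.range (Nat.log 2 n + 1), n := by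
        refine Finset.sum_le_sum fun a _ => ?_
        rw [← Finset.sum_filter, Finset.sum_const, smul_eq_mul]
        have : ((Finset.range n).filter fun i => p ^ a ∣ i + 1).card = n / p ^ a := by
          rw [← Nat.card_multiples]
        rw [this]
        exact Nat.div_mul_le_self _ _
    _ = n * (Nat.log 2 n + 1) := by rw [Finset.sum_const, Finset.card_range, smul_eq_mul, mul_comm]

theorem exists_mul_log_le (C : ℕ) : ∃ n₀, ∀ n, n₀ ≤ n → C * (Nat.log 2 n + 1) ≤ n := by
  have h1 : ∀ a, 2 * C + 4 ≤ a → C * (a + 1) ≤ 2 ^ a := by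
    intro a ha
    induction a, ha using Nat.le_induction with
    | base => 
      have h : ∀ c : ℕ, c * (2 * c + 4 + 1) ≤ 2 ^ (2 * c + 4) := by
        intro c
        induction c with
        | zero => simp
        | succ c ih => 
          have e : 2 ^ (2 * (c + 1) + 4) = 4 * 2 ^ (2 * c + 4) := by ring
          have : 2 ^ (2 * c + 4) ≥ 16 := by
            rw [pow_add]; have := Nat.one_le_two_pow (n := 2 * c); omega
          rw [e]
          nlinarith
      exact h C
    | succ a ha ih =>
      rw [pow_succ]
      nlinarith
  refine ⟨2 ^ (2 * C + 4), fun n hn => ?_⟩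
  have hn0 : n ≠ 0 := by rintro rfl; simp at hn
  have h2 : 2 * C + 4 ≤ Nat.log 2 n := Nat.le_log_of_pow_le one_lt_two hn
  exact (h1 _ h2).trans (Nat.pow_log_le_self 2 hn0)

end Denominators

/-! ### The recursion for the coefficients of a solution. -/

section Recursion

variable {ι K : Type*} [Fintype ι] [DecidableEq ι] [Field K] {q : K} {p : K[X]}
  {B : Matrix ι ι K[X]} {U : Matrix ι ι (PowerSeries K)}

/-- The recursion satisfied by the coefficients of a solution of `p(x) U(qx) = U(x) B(x)`. -/
theorem coeff_recursion (hp : p.coeff 0 = 1)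
    (hB : ∀ a b, (B a b).coeff 0 = (1 : Matrix ι ι K) a b)
    (hU : ∀ a b, (p : PowerSeries K) * PowerSeries.rescale q (U a b) =
      ∑ c, U a c * (B c b : PowerSeries K)) (a b : ι) (n : ℕ) :
    (q ^ n - 1) * PowerSeries.coeff n (U a b) =
      ∑ ij ∈ (Finset.HasAntidiagonal.antidiagonal n).filter (fun ij => ij.2 ≠ 0),
        (∑ c, PowerSeries.coeff ij.1 (U a c) * (B c b).coeff ij.2 -
          p.coeff ij.2 * q ^ ij.1 * PowerSeries.coeff ij.1 (U a b)) := by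
  have h := congrArg (PowerSeries.coeff n) (hU a b)
  rw [mul_comm, PowerSeries.coeff_mul, map_sum] at h
  simp only [PowerSeries.coeff_mul, PowerSeries.coeff_rescale, coeff_coe] at h
  rw [Finset.sum_comm] at h
  have hf : (Finset.HasAntidiagonal.antidiagonal n).filter (fun ij => ¬ ij.2 ≠ 0) = {(n, 0)} := by
    ext ⟨i, j⟩
    simp only [Finset.mem_filter, Finset.HasAntidiagonal.mem_antidiagonal, Finset.mem_singleton,
      Prod.mk.injEq]
    omega
  rw [← Finset.sum_filter_add_sum_filter_not _ (fun ij : ℕ × ℕ => ij.2 ≠ 0), hf,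
    Finset.sum_singleton, ← Finset.sum_filter_add_sum_filter_not
      (Finset.HasAntidiagonal.antidiagonal n) (fun ij : ℕ × ℕ => ij.2 ≠ 0) (fun ij => ∑ c, _), hf,
    Finset.sum_singleton] at h
  simp only [hp, hB, Matrix.one_apply, mul_ite, mul_one, mul_zero, Finset.sum_ite_eq',
    Finset.mem_univ, if_true] at h
  rw [Finset.sum_sub_distrib]
  have e : ∑ ij ∈ (Finset.HasAntidiagonal.antidiagonal n).filter (fun ij => ij.2 ≠ 0),
      p.coeff ij.2 * q ^ ij.1 * PowerSeries.coeff ij.1 (U a b) =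
      ∑ ij ∈ (Finset.HasAntidiagonal.antidiagonal n).filter (fun ij => ij.2 ≠ 0),
      q ^ ij.1 * PowerSeries.coeff ij.1 (U a b) * p.coeff ij.2 :=
    Finset.sum_congr rfl fun _ _ => by ring
  rw [e]
  linear_combination h

/-- An induction serving two estimates. Passing from the multiplier t i to t (i + j) has to pay both
for a coefficient of B or p and for the division by q^(i+j) - 1. It is used with t n = s^n ∏_{l ≤ n}
(q^l - 1) over the affine line and with t n = q^(-cn) over infinity. -/
theorem mul_coeff_mem (hp : p.coeff 0 = 1)
    (hB : ∀ a b, (B a b).coeff 0 = (1 : Matrix ι ι K) a b)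
    (hU0 : ∀ a b, PowerSeries.coeff 0 (U a b) = (1 : Matrix ι ι K) a b)
    (hU : ∀ a b, (p : PowerSeries K) * PowerSeries.rescale q (U a b) =
      ∑ c, U a c * (B c b : PowerSeries K)) (hq : ∀ n, n ≠ 0 → q ^ n ≠ 1)
    (V : Subring K) (t : ℕ → K) (ht0 : t 0 ∈ V)
    (htB : ∀ i j, j ≠ 0 → ∀ c b, ∃ w ∈ V, t (i + j) * (B c b).coeff j = (q ^ (i + j) - 1) * w * t i)
    (htp : ∀ i j, j ≠ 0 → ∃ w ∈ V, t (i + j) * (p.coeff j * q ^ i) = (q ^ (i + j) - 1) * w * t i)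
    (n : ℕ) (a b : ι) : t n * PowerSeries.coeff n (U a b) ∈ V := by
  induction n using Nat.strong_induction_on generalizing a b with
  | _ n ih =>
    rcases eq_or_ne n 0 with rfl | hn
    · rw [hU0, Matrix.one_apply]
      split_ifs
      · rwa [mul_one]
      · rw [mul_zero]; exact zero_mem _
    have hqn : q ^ n - 1 ≠ 0 := sub_ne_zero.2 (hq n hn)
    have h := coeff_recursion hp hB hU a b n
    have h2 : t n * PowerSeries.coeff n (U a b) = ∑ ij ∈
        (Finset.HasAntidiagonal.antidiagonal n).filter (fun ij => ij.2 ≠ 0), (q ^ n - 1)⁻¹ *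
        (∑ c, t n * (B c b).coeff ij.2 * PowerSeries.coeff ij.1 (U a c) -
          t n * (p.coeff ij.2 * q ^ ij.1) * PowerSeries.coeff ij.1 (U a b)) := by
      apply mul_left_cancel₀ hqn
      rw [mul_left_comm, h, Finset.mul_sum, Finset.mul_sum]
      refine Finset.sum_congr rfl fun ij _ => ?_
      rw [mul_inv_cancel_left₀ hqn, mul_sub, Finset.mul_sum]
      congr 1
      · exact Finset.sum_congr rfl fun c _ => by ring
      · ring
    rw [h2]
    refine sum_mem fun ij hij => ?_
    rw [Finset.mem_filter, Finset.HasAntidiagonal.mem_antidiagonal] at hij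
    obtain ⟨rfl, hj⟩ := hij
    have key : ∀ y z : K, (∃ w ∈ V, y = (q ^ (ij.1 + ij.2) - 1) * w * t ij.1) →
        t ij.1 * z ∈ V → (q ^ (ij.1 + ij.2) - 1)⁻¹ * (y * z) ∈ V := by
      rintro _ z ⟨w, hw, rfl⟩ hz
      have : (q ^ (ij.1 + ij.2) - 1)⁻¹ * ((q ^ (ij.1 + ij.2) - 1) * w * t ij.1 * z) =
          w * (t ij.1 * z) := by field_simp
      rw [this]
      exact mul_mem hw hz
    rw [mul_sub, Finset.mul_sum]
    exact sub_mem (sum_mem fun c _ => key _ _ (htB _ _ hj _ _) (ih _ (by omega) _ _))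
      (key _ _ (htp _ _ hj) (ih _ (by omega) _ _))

end Recursion

/-! ### Integral multiples and the places over infinity. -/

section FunctionField

variable {k K : Type*} [Field k] [Field K] [Algebra k[X] K] [Algebra (RatFunc k) K]
  [IsScalarTower k[X] (RatFunc k) K]

theorem algebraMap_X_pow_ne_one (n : ℕ) (hn : n ≠ 0) : (algebraMap k[X] K X) ^ n ≠ 1 := by
  intro h
  rw [← map_pow, ← map_one (algebraMap k[X] K)] at h
  have h1 := congrArg natDegree (FunctionField.algebraMap_injective k K h)
  rw [natDegree_X_pow, natDegree_one] at h1
  exact hn h1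

variable (k) in
theorem exists_isIntegral_mul [FiniteDimensional (RatFunc k) K] (S : Finset K) :
    ∃ s : k[X], s ≠ 0 ∧ ∀ y ∈ S, IsIntegral k[X] (algebraMap k[X] K s * y) := by
  classical
  induction S using Finset.induction_on with
  | empty => exact ⟨1, one_ne_zero, by simp⟩
  | insert y S _ ih =>
    obtain ⟨s, hs, hS⟩ := ih
    have hy : IsAlgebraic k[X] y :=
      (IsFractionRing.isAlgebraic_iff k[X] (RatFunc k) K).2 (Algebra.IsAlgebraic.isAlgebraic y)
    obtain ⟨s', hs', hy'⟩ := hy.exists_integral_multiple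
    refine ⟨s * s', mul_ne_zero hs hs', fun z hz => ?_⟩
    rw [map_mul]
    rcases Finset.mem_insert.1 hz with rfl | hz
    · rw [Algebra.smul_def] at hy'
      rw [mul_assoc]
      exact isIntegral_algebraMap.mul hy'
    · rw [mul_right_comm, mul_comm]
      exact isIntegral_algebraMap.mul (hS z hz)

section Infinity

theorem one_lt_valuation_X {k K : Type*} [Field k] [Field K] [Algebra k[X] K] {V : ValuationSubring K} 
    (hq : algebraMap k[X] K X ∉ V) : 1 < V.valuation (algebraMap k[X] K X) := by
  rwa [← not_le, V.valuation_le_one_iff]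

theorem valuation_algebraMap_le {k K : Type*} [Field k] [Field K] [Algebra k[X] K] {V : ValuationSubring K} 
    (hV : ∀ c : k, algebraMap k[X] K (C c) ∈ V) (hq : algebraMap k[X] K X ∉ V) (f : k[X]) (n : ℕ) (hf : f.natDegree ≤ n) :
    V.valuation (algebraMap k[X] K f) ≤ V.valuation (algebraMap k[X] K X) ^ n := by
  have hq1 := one_lt_valuation_X hq
  rw [f.as_sum_range_C_mul_X_pow, map_sum]
  refine Valuation.map_sum_le _ fun i hi => ?_
  rw [Finset.mem_range] at hi
  rw [map_mul, map_mul, map_pow, map_pow]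
  calc _ ≤ 1 * V.valuation (algebraMap k[X] K X) ^ n :=
        mul_le_mul' ((V.valuation_le_one_iff _).2 (hV _)) (pow_le_pow_right₀ hq1.le (by omega))
    _ = _ := one_mul _

theorem valuation_algebraMap_ge_one {k K : Type*} [Field k] [Field K] [Algebra k[X] K] {V : ValuationSubring K} 
    (hV : ∀ c : k, algebraMap k[X] K (C c) ∈ V) (hq : algebraMap k[X] K X ∉ V) (f : k[X]) (hf : f ≠ 0) :
    1 ≤ V.valuation (algebraMap k[X] K f) := by
  have hq1 := one_lt_valuation_X hq
  have hlead : V.valuation (algebraMap k[X] K (C f.leadingCoeff)) = 1 := by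
    have h0 : f.leadingCoeff ≠ 0 := leadingCoeff_ne_zero.2 hf
    refine le_antisymm ((V.valuation_le_one_iff _).2 (hV _)) ?_
    have h1 := (V.valuation_le_one_iff _).2 (hV f.leadingCoeff⁻¹)
    have h2 : V.valuation (algebraMap k[X] K (C f.leadingCoeff)) *
        V.valuation (algebraMap k[X] K (C f.leadingCoeff⁻¹)) = 1 := by
      rw [← map_mul, ← map_mul, ← C_mul, mul_inv_cancel₀ h0, map_one, map_one, map_one]
    rw [← h2]
    exact mul_le_of_le_one_right zero_le h1
  have htop : V.valuation (algebraMap k[X] K (C f.leadingCoeff * X ^ f.natDegree)) =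
      V.valuation (algebraMap k[X] K X) ^ f.natDegree := by
    rw [map_mul, map_mul, hlead, one_mul, map_pow, map_pow]
  rcases Nat.eq_zero_or_pos f.natDegree with h0 | hpos
  · rw [eq_C_of_natDegree_eq_zero h0, ← h0]
    exact hlead.ge
  rw [← eraseLead_add_C_mul_X_pow f, map_add, Valuation.map_add_eq_of_lt_right, htop]
  · exact one_le_pow₀ hq1.le
  · rw [htop]
    refine (valuation_algebraMap_le hV hq _ _ (eraseLead_natDegree_le f)).trans_lt ?_
    exact pow_lt_pow_right₀ hq1 (by omega)

variable (k) in
/-- Elements of `K` have poles of bounded order at the places over infinity. -/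
theorem exists_valuation_le [FiniteDimensional (RatFunc k) K] (S : Finset K) :
    ∃ c : ℕ, ∀ V : ValuationSubring K, (∀ c : k, algebraMap k[X] K (C c) ∈ V) →
      algebraMap k[X] K X ∉ V → ∀ y ∈ S,
      V.valuation y ≤ V.valuation (algebraMap k[X] K X) ^ c := by
  have h1 : ∀ y : K, ∃ c : ℕ, ∀ V : ValuationSubring K,
      (∀ c : k, algebraMap k[X] K (C c) ∈ V) → algebraMap k[X] K X ∉ V →
      V.valuation y ≤ V.valuation (algebraMap k[X] K X) ^ c := by
    intro y
    obtain ⟨s, hs, hint⟩ := exists_isIntegral_mul k {y}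
    obtain ⟨f, hf, hfy⟩ := hint y (Finset.mem_singleton_self y)
    refine ⟨(Finset.range f.natDegree).sup fun i => (f.coeff i).natDegree, fun V hV hq => ?_⟩
    set c := (Finset.range f.natDegree).sup fun i => (f.coeff i).natDegree
    have hq1 := one_lt_valuation_X hq
    set u := algebraMap k[X] K s * y with hu
    -- Nonzero polynomials in q have absolute value at least 1 over infinity, so multiplying y by s
    -- does not make it smaller.
    have hyu : V.valuation y ≤ V.valuation u := by
      rw [hu, map_mul]
      exact le_mul_of_one_le_left zero_le (valuation_algebraMap_ge_one hV hq s hs)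
    refine hyu.trans ?_
    -- If u exceeded q^c, where c bounds the degrees of the coefficients of a monic equation of u,
    -- the leading term of that equation would strictly dominate all the others.
    by_contra hlt
    rw [not_le] at hlt
    have hu1 : 1 < V.valuation u := (one_le_pow₀ hq1.le).trans_lt hlt
    have hu0 : u ≠ 0 := by intro h0; rw [h0, map_zero] at hu1; exact not_lt_zero hu1
    rw [eval₂_eq_sum_range, Finset.sum_range_succ, hf.coeff_natDegree, map_one, one_mul,
      add_eq_zero_iff_neg_eq] at hfy
    have h2 : V.valuation (∑ i ∈ Finset.range f.natDegree,
        algebraMap k[X] K (f.coeff i) * u ^ i) < V.valuation u ^ f.natDegree := by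
      refine Valuation.map_sum_lt _ (pow_pos (zero_lt_one.trans hu1) _).ne' fun i hi => ?_
      rw [map_mul, map_pow]
      have h3 := valuation_algebraMap_le hV hq (f.coeff i) c
        (Finset.le_sup (f := fun i => (f.coeff i).natDegree) hi)
      rw [Finset.mem_range] at hi
      calc _ ≤ V.valuation (algebraMap k[X] K X) ^ c * V.valuation u ^ (f.natDegree - 1) :=
            mul_le_mul' h3 (pow_le_pow_right₀ hu1.le (by omega))
        _ < V.valuation u * V.valuation u ^ (f.natDegree - 1) :=
            mul_lt_mul_of_pos_right hlt (pow_pos (zero_lt_one.trans hu1) _)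
        _ = _ := by rw [← pow_succ']; congr 1; omega
    rw [← Valuation.map_neg, hfy, map_pow] at h2
    exact lt_irrefl _ h2
  choose c hc using h1
  refine ⟨S.sup c, fun V hV hq y hy => (hc y V hV hq).trans ?_⟩
  exact pow_le_pow_right₀ (one_lt_valuation_X hq).le (Finset.le_sup hy)

end Infinity

end FunctionField

/-! ### The rationality criterion. -/

section FunctionField

theorem det_mem_subring {N : ℕ} {K : Type*} [CommRing K] (V : Subring K)
    (M : Matrix (Fin N) (Fin N) K) (h : ∀ i j, M i j ∈ V) : M.det ∈ V := by
  have : M = (Matrix.of fun i j => (⟨M i j, h i j⟩ : V)).map V.subtype := rfl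
  rw [this, ← RingHom.mapMatrix_apply, ← RingHom.map_det]
  exact Subtype.mem _

variable {k K : Type*} [Field k] [Field K] [Algebra k[X] K] [Algebra (RatFunc k) K]
  [IsScalarTower k[X] (RatFunc k) K] [FiniteDimensional (RatFunc k) K]
  {ι : Type*} [Fintype ι] [DecidableEq ι] {p : K[X]}
  {B : Matrix ι ι K[X]} {U : Matrix ι ι (PowerSeries K)}

variable (k) in
theorem exists_coeff_finset (p : K[X]) (B : Matrix ι ι K[X]) :
    ∃ S : Finset K, (∀ j, p.coeff j ∈ S) ∧ ∀ a b j, (B a b).coeff j ∈ S := by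
  classical
  have h : ∀ f : K[X], ∃ S : Finset K, ∀ j, f.coeff j ∈ S := by
    intro f
    refine ⟨insert 0 (f.support.image f.coeff), fun j => ?_⟩
    by_cases hj : j ∈ f.support
    · exact Finset.mem_insert_of_mem (Finset.mem_image_of_mem _ hj)
    · rw [notMem_support_iff.1 hj]
      exact Finset.mem_insert_self _ _
  choose S hS using h
  refine ⟨S p ∪ Finset.univ.biUnion fun a => Finset.univ.biUnion fun b => S (B a b),
    fun j => Finset.mem_union_left _ (hS p j), fun a b j => Finset.mem_union_right _ ?_⟩
  simp only [Finset.mem_biUnion, Finset.mem_univ, true_and]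
  exact ⟨a, b, hS _ j⟩

/-- Denominators of the coefficients of a solution which is integral at almost all cyclotomic
places. -/
theorem exists_denominator (hp : p.coeff 0 = 1)
    (hB : ∀ a b, (B a b).coeff 0 = (1 : Matrix ι ι K) a b)
    (hU0 : ∀ a b, PowerSeries.coeff 0 (U a b) = (1 : Matrix ι ι K) a b)
    (hU : ∀ a b, (p : PowerSeries K) * PowerSeries.rescale (algebraMap k[X] K X) (U a b) =
      ∑ c, U a c * (B c b : PowerSeries K)) (bad : Finset ℕ)
    (hint : ∀ v : CyclotomicPlace k K, orderOf (v.qv : v.resField) ∉ bad → ∀ a b n,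
      PowerSeries.coeff n (U a b) ∈ v.ring) :
    ∃ s Ψ : k[X], s ≠ 0 ∧ Ψ ≠ 0 ∧ ∀ V : ValuationSubring K, (∀ f : k[X], algebraMap k[X] K f ∈ V) →
      ∀ i n, i ≤ n → ∀ a b,
        algebraMap k[X] K (s ^ n * Ψ ^ sumOrdProj (ringExpChar k) n) *
          PowerSeries.coeff i (U a b) ∈ V := by
  set q := algebraMap k[X] K X with hq
  obtain ⟨S, hSp, hSB⟩ := exists_coeff_finset p B
  obtain ⟨s, hs, hsS⟩ := exists_isIntegral_mul k S
  -- Order 1 is added to the exceptional orders because places where q reduces to 1 are not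
  -- cyclotomic. Order 0 is removed: it encodes that no power of q reduces to 1, and would make the
  -- product vanish.
  refine ⟨s, ∏ m ∈ (insert 1 bad).erase 0, (X ^ m - 1), hs, ?_, ?_⟩
  · refine Finset.prod_ne_zero_iff.2 fun m hm => ?_
    rw [← C_1]
    exact X_pow_sub_C_ne_zero (Nat.pos_of_ne_zero (Finset.ne_of_mem_erase hm)) 1
  intro V hV
  set Ψ : k[X] := ∏ m ∈ (insert 1 bad).erase 0, (X ^ m - 1) with hΨ
  set t : ℕ → K := fun n => algebraMap k[X] K s ^ n * ∏ l ∈ Finset.range n, (q ^ (l + 1) - 1)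
    with ht
  have hqV : q ∈ V := hV X
  have hsplit : ∀ i j (z : K), j ≠ 0 → algebraMap k[X] K s * z ∈ V →
      ∃ w ∈ V.toSubring, t (i + j) * z = (q ^ (i + j) - 1) * w * t i := by
    intro i j z hj hz
    obtain ⟨j, rfl⟩ := Nat.exists_eq_succ_of_ne_zero hj
    refine ⟨algebraMap k[X] K s ^ j * (algebraMap k[X] K s * z) *
      ∏ l ∈ Finset.Ico i (i + j), (q ^ (l + 1) - 1), ?_, ?_⟩
    · refine mul_mem (mul_mem (pow_mem (hV s) _) hz) (prod_mem fun l _ => ?_)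
      exact sub_mem (pow_mem hqV _) (one_mem _)
    · simp only [ht]
      rw [show i + (j + 1) = (i + j) + 1 from rfl, Finset.prod_range_succ,
        ← Finset.prod_range_mul_prod_Ico _ (Nat.le_add_right i j)]
      ring
  have hmem : ∀ n a b, t n * PowerSeries.coeff n (U a b) ∈ V := by
    refine mul_coeff_mem hp hB hU0 hU (fun n hn => algebraMap_X_pow_ne_one n hn) V.toSubring t ?_
      ?_ ?_
    · simp only [ht, pow_zero, Finset.range_zero, Finset.prod_empty, mul_one]
      exact one_mem _
    · intro i j hj c b
      exact hsplit i j _ hj (mem_valuationSubring_of_isIntegral V hV (hsS _ (hSB _ _ _)))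
    · intro i j hj
      refine hsplit i j _ hj ?_
      rw [← mul_assoc]
      exact mul_mem (mem_valuationSubring_of_isIntegral V hV (hsS _ (hSp _))) (pow_mem hqV _)
  have hmono : ∀ i n, i ≤ n → sumOrdProj (ringExpChar k) i ≤ sumOrdProj (ringExpChar k) n :=
    fun i n hin => Finset.sum_le_sum_of_subset (Finset.range_mono hin)
  suffices h : ∀ n a b, algebraMap k[X] K (s ^ n * Ψ ^ sumOrdProj (ringExpChar k) n) *
      PowerSeries.coeff n (U a b) ∈ V by
    intro i n hin a b
    have : algebraMap k[X] K (s ^ n * Ψ ^ sumOrdProj (ringExpChar k) n) *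
        PowerSeries.coeff i (U a b) = algebraMap k[X] K (s ^ (n - i) *
          Ψ ^ (sumOrdProj (ringExpChar k) n - sumOrdProj (ringExpChar k) i)) *
        (algebraMap k[X] K (s ^ i * Ψ ^ sumOrdProj (ringExpChar k) i) *
          PowerSeries.coeff i (U a b)) := by
      rw [← mul_assoc, ← map_mul]
      congr 2
      rw [mul_mul_mul_comm, ← pow_add, ← pow_add, Nat.sub_add_cancel hin,
        Nat.sub_add_cancel (hmono i n hin)]
    rw [this]
    exact mul_mem (hV _) (h i a b)
  intro n a b
  let φ : k[X] →+* V := (algebraMap k[X] K).codRestrict V.toSubring hV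
  let : Algebra k V := (φ.comp C).toAlgebra
  let x : V := φ X
  set m := orderOf (IsLocalRing.residue V x) with hm
  have hD : (∏ l ∈ Finset.range n, (x ^ (l + 1) - 1) ∣
      φ (Ψ ^ sumOrdProj (ringExpChar k) n)) →
      algebraMap k[X] K (s ^ n * Ψ ^ sumOrdProj (ringExpChar k) n) *
      PowerSeries.coeff n (U a b) ∈ V := by
    rintro ⟨y, hy⟩
    have h1 : algebraMap k[X] K (Ψ ^ sumOrdProj (ringExpChar k) n) =
        (∏ l ∈ Finset.range n, (q ^ (l + 1) - 1)) * (y : K) := by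
      have := congrArg V.subtype hy
      rw [map_mul, map_prod] at this
      exact this
    rw [map_mul, h1, map_pow]
    have := mul_mem (hmem n a b) y.2
    simp only [ht] at this
    convert this using 1
    ring
  -- Three kinds of places over the affine line, according to the order m of the reduction of q. If
  -- m = 0 no factor q^l - 1 vanishes; if m is exceptional the factors divide powers of Ψ; otherwise
  -- V is a cyclotomic place at which the coefficients are integral by hypothesis.
  by_cases hm0 : m = 0
  · apply hD
    refine (IsUnit.dvd ?_)
    refine Finset.prod_induction _ IsUnit (fun _ _ => IsUnit.mul) isUnit_one fun l _ => ?_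
    apply isUnit_pow_sub_one_of_not_orderOf_dvd
    rw [← hm, hm0, zero_dvd_iff]
    omega
  by_cases hmb : m ∈ insert 1 bad
  · apply hD
    rw [sumOrdProj, ← Finset.prod_pow_eq_pow_sum, map_prod]
    refine Finset.prod_dvd_prod_of_dvd _ _ fun l _ => ?_
    refine (pow_sub_one_dvd_pow (k := k) (ringExpChar k) x (l + 1) (by omega)).trans ?_
    rw [map_pow, ← hm]
    refine pow_dvd_pow_of_dvd ?_ _
    have : x ^ m - 1 = φ (X ^ m - 1) := by rw [map_sub, map_pow, map_one]
    rw [this, hΨ]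
    exact map_dvd φ (Finset.dvd_prod_of_mem (fun m => (X ^ m - 1 : k[X]))
      (Finset.mem_erase.2 ⟨hm0, hmb⟩))
  · rw [Finset.mem_insert, not_or] at hmb
    have h1 : 1 < orderOf (IsLocalRing.residue V ⟨q, hqV⟩) := by
      change 1 < m
      omega
    exact mul_mem (hV _) (hint ⟨V, fun c => hV _, hqV, h1⟩ hmb.2 a b n)

/-- At a pole of q the number q^n - 1 has the size of q^n, so the division in the recursion absorbs
the factor q^i coming from U(qx). Only the coefficients of p and B contribute to the growth. -/
theorem coeffBound_zero {V : ValuationSubring K} (hqV : algebraMap k[X] K X ∉ V) (hp : p.coeff 0 = 1)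
    (hB : ∀ a b, (B a b).coeff 0 = (1 : Matrix ι ι K) a b)
    (hU0 : ∀ a b, PowerSeries.coeff 0 (U a b) = (1 : Matrix ι ι K) a b)
    (hU : ∀ a b, (p : PowerSeries K) * PowerSeries.rescale (algebraMap k[X] K X) (U a b) =
      ∑ c, U a c * (B c b : PowerSeries K)) {c : ℕ}
    (hpc : ∀ j, V.valuation (p.coeff j) ≤ V.valuation (algebraMap k[X] K X) ^ (c * j))
    (hBc : ∀ a b j, V.valuation ((B a b).coeff j) ≤ V.valuation (algebraMap k[X] K X) ^ (c * j))
    (a b : ι) : CoeffBound V.valuation (algebraMap k[X] K X) c 0 0 (U a b) := by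
  set q := algebraMap k[X] K X with hq
  have hq1 : 1 < V.valuation q := one_lt_valuation_X hqV
  have hq0 : q ≠ 0 := by intro h; rw [h, map_zero] at hq1; exact not_lt_zero hq1
  have hqn : ∀ n, n ≠ 0 → V.valuation (q ^ n - 1) = V.valuation q ^ n := by
    intro n hn
    rw [Valuation.map_sub_eq_of_lt_left, map_pow]
    rw [map_one, map_pow]
    exact one_lt_pow₀ hq1 hn
  have hsplit : ∀ i j (z : K), j ≠ 0 → V.valuation z ≤ V.valuation q ^ (c * j) *
      V.valuation q ^ (i + j) → ∃ w ∈ V.toSubring,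
      (q ^ (c * (i + j)))⁻¹ * z = (q ^ (i + j) - 1) * w * (q ^ (c * i))⁻¹ := by
    intro i j z hj hz
    have h1 : q ^ (i + j) - 1 ≠ 0 := by
      intro h0
      have := hqn (i + j) (by omega)
      rw [h0, map_zero] at this
      exact (pow_pos (zero_lt_one.trans hq1) _).ne this
    refine ⟨(q ^ (c * j))⁻¹ * (q ^ (i + j) - 1)⁻¹ * z, ?_, ?_⟩
    · change _ ∈ V
      rw [← V.valuation_le_one_iff, map_mul, map_mul, map_inv₀, map_inv₀, map_pow,
        hqn _ (by omega), ← mul_inv]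
      have h2 := mul_pos (pow_pos (zero_lt_one.trans hq1) (c * j))
        (pow_pos (zero_lt_one.trans hq1) (i + j))
      rw [inv_mul_le_iff₀ h2, mul_one]
      exact hz
    · rw [mul_add, pow_add]
      field_simp
  intro n
  have h := mul_coeff_mem hp hB hU0 hU (fun n hn => algebraMap_X_pow_ne_one n hn) V.toSubring
    (fun n => (q ^ (c * n))⁻¹) (by simp [one_mem]) ?_ ?_ n a b
  · have h' := (V.valuation_le_one_iff _).2 h
    rw [map_mul, map_inv₀, map_pow, inv_mul_le_iff₀ (pow_pos (zero_lt_one.trans hq1) _),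
      mul_one] at h'
    rw [zero_mul, pow_zero, mul_one, add_zero]
    exact h'
  · intro i j hj c' b'
    refine hsplit i j _ hj ((hBc _ _ _).trans ?_)
    exact le_mul_of_one_le_right zero_le (one_le_pow₀ hq1.le)
  · intro i j hj
    refine hsplit i j _ hj ?_
    rw [map_mul, map_pow]
    exact mul_le_mul' (hpc j) (pow_le_pow_right₀ hq1.le (by omega))

/-- The power series `p(x/q) p(x/q²) ⋯ p(x/q^T)`. -/
def descProd (q : K) (p : K[X]) : ℕ → PowerSeries K
  | 0 => 1
  | T + 1 => PowerSeries.rescale q⁻¹ (descProd q p T * p)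

theorem constantCoeff_descProd (q : K) (p : K[X]) (hp : p.coeff 0 = 1) (T : ℕ) :
    PowerSeries.constantCoeff (descProd q p T) = 1 := by
  induction T with
  | zero => simp [descProd]
  | succ T ih =>
    rw [descProd, ← PowerSeries.coeff_zero_eq_constantCoeff_apply, PowerSeries.coeff_rescale,
      pow_zero, one_mul, PowerSeries.coeff_zero_eq_constantCoeff_apply, map_mul, ih, one_mul,
      ← PowerSeries.coeff_zero_eq_constantCoeff_apply, coeff_coe, hp]

theorem coeffBound_descProd {Γ : Type*} [LinearOrderedCommGroupWithZero Γ] {v : Valuation K Γ}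
    {q : K} (hq : 1 < v q) {c d : ℕ} (hd : p.natDegree ≤ d)
    (hpc : ∀ j, v (p.coeff j) ≤ v q ^ (c * j)) (T : ℕ) :
    CoeffBound v q c T (∑ t ∈ Finset.range T, d * t) (descProd q p T) := by
  induction T with
  | zero =>
    intro m
    rw [descProd, PowerSeries.coeff_one]
    split_ifs with h
    · simp [h]
    · simp
  | succ T ih =>
    rw [Finset.sum_range_succ]
    exact ih.rescale_mul hq hd hpc

/-- Iterating the equation gives p(x/q)⋯p(x/q^T) U(x) = U(x/q^T) B(x/q^T)⋯B(x/q), and every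
substitution of x/q for x improves the decay of the coefficients. -/
theorem coeffBound_descProd_mul {Γ : Type*} [LinearOrderedCommGroupWithZero Γ] {v : Valuation K Γ}
    {q : K} (hq : 1 < v q) {c d : ℕ} (hd : ∀ a b, (B a b).natDegree ≤ d)
    (hBc : ∀ a b j, v ((B a b).coeff j) ≤ v q ^ (c * j))
    (hU : ∀ a b, (p : PowerSeries K) * PowerSeries.rescale q (U a b) =
      ∑ c, U a c * (B c b : PowerSeries K)) (hU0 : ∀ a b, CoeffBound v q c 0 0 (U a b))
    (T : ℕ) (a b : ι) :
    CoeffBound v q c T (∑ t ∈ Finset.range T, d * t) (descProd q p T * U a b) := by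
  have hq0 : q ≠ 0 := by rintro rfl; rw [map_zero] at hq; exact not_lt_zero hq
  induction T generalizing a b with
  | zero => simpa [descProd] using hU0 a b
  | succ T ih =>
    rw [Finset.sum_range_succ]
    have h1 : PowerSeries.rescale q⁻¹ (PowerSeries.rescale q (U a b)) = U a b := by
      rw [PowerSeries.rescale_rescale, mul_inv_cancel₀ hq0, PowerSeries.rescale_one,
        RingHom.id_apply]
    have h2 : descProd q p (T + 1) * U a b =
        ∑ c, PowerSeries.rescale q⁻¹ ((descProd q p T * U a c) * (B c b : PowerSeries K)) := by
      conv_lhs => rw [← h1]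
      rw [descProd, ← map_mul, mul_assoc, hU a b, Finset.mul_sum, map_sum]
      exact Finset.sum_congr rfl fun c _ => by rw [mul_assoc]
    rw [h2]
    exact CoeffBound.sum hq0 fun c _ => (ih a c).rescale_mul hq (hd _ _) (hBc _ _)

/-- The numerical inequality behind the vanishing of Hankel minors. -/
theorem exists_forall_numeric (d s Ψ c : ℕ) (hd : 0 < d) : ∃ T₀, ∀ T, T₀ ≤ T →
    ∀ w, w ≤ 10 * d * T * (Nat.log 2 (10 * d * T) + 1) →
    1 + 2 * d * T * (s * (10 * d * T) + Ψ * w) +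
      2 * d * T * (c * (10 * d * T) + ∑ t ∈ Finset.range T, d * t) ≤
      ∑ j : Fin (2 * d * T), T * (j : ℕ) := by
  -- For determinants of size 2dT the right-hand side is about 2d²T³, the contribution of ∑ dt about
  -- d²T³, and all other terms are O(T² log T). The size 2dT is chosen to leave this margin.
  obtain ⟨n₀, hn₀⟩ := exists_mul_log_le (100 * d * (2 * (s + Ψ + c) + 1))
  refine ⟨max n₀ 2, fun T hT w hw => ?_⟩
  have hT2 : 2 ≤ T := (le_max_right _ _).trans hT
  have hTn : n₀ ≤ 10 * d * T := by
    have : n₀ ≤ T := (le_max_left _ _).trans hT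
    nlinarith
  have hlog := hn₀ _ hTn
  set l := Nat.log 2 (10 * d * T) + 1 with hl
  have h1 : ∑ j : Fin (2 * d * T), T * (j : ℕ) = T * ∑ j ∈ Finset.range (2 * d * T), j := by
    rw [← Finset.mul_sum, Fin.sum_univ_eq_sum_range (fun j => j)]
  have h2 := Finset.sum_range_id_mul_two (2 * d * T)
  have h3 := Finset.sum_range_id_mul_two T
  rw [h1, ← Finset.mul_sum]
  set A := ∑ j ∈ Finset.range (2 * d * T), j
  set E := ∑ j ∈ Finset.range T, j
  have hlT : 10 * (2 * (s + Ψ + c) + 1) * l ≤ T := by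
    have : 10 * d * (10 * (2 * (s + Ψ + c) + 1) * l) ≤ 10 * d * T := by
      calc _ = 100 * d * (2 * (s + Ψ + c) + 1) * l := by ring
        _ ≤ _ := hlog
    exact Nat.le_of_mul_le_mul_left this (by positivity)
  have hpos : 0 < 2 * d * T := by positivity
  obtain ⟨N, hN⟩ : ∃ N, 2 * d * T = N + 1 := ⟨2 * d * T - 1, (Nat.sub_add_cancel hpos).symm⟩
  obtain ⟨T', rfl⟩ : ∃ T', T = T' + 1 := ⟨T - 1, by omega⟩
  rw [hN, Nat.add_sub_cancel] at h2
  rw [Nat.add_sub_cancel] at h3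
  have hl1 : 1 ≤ l := by omega
  have h5 : (s + Ψ + c) * (10 * d * (T' + 1)) * l * 2 + 10 * d * (T' + 1) * l ≤
      d * (T' + 1) * (T' + 1) := by
    calc _ = d * (T' + 1) * (10 * (2 * (s + Ψ + c) + 1) * l) := by ring
      _ ≤ _ := by gcongr
  set L := 10 * d * (T' + 1)
  have h6 : s * L + Ψ * w + c * L ≤ (s + Ψ + c) * L * l := by
    calc s * L + Ψ * w + c * L ≤ s * (L * l) + Ψ * (L * l) + c * (L * l) :=
          add_le_add (add_le_add (Nat.mul_le_mul_left _ (Nat.le_mul_of_pos_right _ hl1))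
            (Nat.mul_le_mul_left _ hw)) (Nat.mul_le_mul_left _ (Nat.le_mul_of_pos_right _ hl1))
      _ = _ := by ring
  have h7 : T' + 2 ≤ L * l := by
    calc T' + 2 ≤ 10 * 1 * (T' + 1) * 1 := by omega
      _ ≤ L * l := Nat.mul_le_mul (Nat.mul_le_mul_right _ (Nat.mul_le_mul_left _ hd)) hl1
  have h8 : 2 * (d * E) ≤ d * (T' + 1) * (T' + 1) := by
    calc 2 * (d * E) = d * ((T' + 1) * T') := by rw [← h3]; ring
      _ ≤ d * ((T' + 1) * (T' + 1)) :=
        Nat.mul_le_mul_left _ (Nat.mul_le_mul_left _ (Nat.le_succ _))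
      _ = _ := by ring
  have hND : (T' + 1) * (N + 1) = 2 * (d * (T' + 1) * (T' + 1)) := by rw [← hN]; ring
  rw [hN]
  set D := d * (T' + 1) * (T' + 1)
  have h9 : 2 * ((T' + 1) * A) = (T' + 1) * ((N + 1) * N) := by rw [← h2]; ring
  set Y := (s + Ψ + c) * L * l
  have key : (N + 1) * (2 * (s * L + Ψ * w + c * L) + (T' + 2) + D) ≤
      (N + 1) * ((T' + 1) * (N + 1)) := Nat.mul_le_mul_left _ (by omega)
  have h10 : (N + 1) * (2 * (d * E)) ≤ (N + 1) * D := Nat.mul_le_mul_left _ h8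
  have h11 : 1 ≤ N := by
    have : 2 * 1 * 1 ≤ 2 * d * (T' + 1) := Nat.mul_le_mul (Nat.mul_le_mul_left _ hd) (by omega)
    omega
  have h12 : 2 * (1 + (N + 1) * (s * L + Ψ * w) + (N + 1) * (c * L + d * E)) ≤
      2 * ((T' + 1) * A) := by
    rw [h9]
    linarith
  omega

/-- Rationality criterion: a solution of `p(x) U(qx) = U(x) B(x)` normalised at the origin whose
coefficients are integral at almost all cyclotomic places is rational. -/
theorem exists_rational (hp : p.coeff 0 = 1)
    (hB : ∀ a b, (B a b).coeff 0 = (1 : Matrix ι ι K) a b)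
    (hU0 : ∀ a b, PowerSeries.coeff 0 (U a b) = (1 : Matrix ι ι K) a b)
    (hU : ∀ a b, (p : PowerSeries K) * PowerSeries.rescale (algebraMap k[X] K X) (U a b) =
      ∑ c, U a c * (B c b : PowerSeries K)) (bad : Finset ℕ)
    (hint : ∀ v : CyclotomicPlace k K, orderOf (v.qv : v.resField) ∉ bad → ∀ a b n,
      PowerSeries.coeff n (U a b) ∈ v.ring) :
    ∃ (Q : K[X]) (P : Matrix ι ι K[X]), Q ≠ 0 ∧
      ∀ a b, (Q : PowerSeries K) * U a b = (P a b : PowerSeries K) := by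
  obtain ⟨s, Ψ, hs, hΨ, hden⟩ := exists_denominator hp hB hU0 hU bad hint
  obtain ⟨S, hSp, hSB⟩ := exists_coeff_finset p B
  obtain ⟨c, hc⟩ := exists_valuation_le k S
  obtain ⟨d, hd, hdp, hdB⟩ : ∃ d, 0 < d ∧ p.natDegree ≤ d ∧ ∀ a b, (B a b).natDegree ≤ d := by
    refine ⟨max (p.natDegree + 1) (Finset.univ.sup fun a => Finset.univ.sup fun b =>
      (B a b).natDegree), by positivity, (Nat.le_succ _).trans (le_max_left _ _), fun a b => ?_⟩
    refine le_trans ?_ (le_max_right _ _)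
    exact (Finset.le_sup (f := fun b => (B a b).natDegree) (Finset.mem_univ b)).trans
      (Finset.le_sup (f := fun a => Finset.univ.sup fun b => (B a b).natDegree)
        (Finset.mem_univ a))
  obtain ⟨T₀, hT₀⟩ := exists_forall_numeric d s.natDegree Ψ.natDegree c hd
  have hentry : ∀ a b, ∃ Q P : K[X], Q ≠ 0 ∧ (Q : PowerSeries K) * U a b = P := by
    intro a b
    -- With N = 2dT columns and 4N rows, the coefficients involved have index at most 5N = 10dT.
    refine exists_mul_eq_of_pade _ (2 * d) T₀ (by omega) fun T hT => ?_
    refine exists_pade_of_minors _ _ _ fun I => ?_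
    set H := (Matrix.of fun i j : Fin (2 * d * T) =>
      PowerSeries.coeff ((I i : ℕ) + j) (U a b)) with hH
    set w := sumOrdProj (ringExpChar k) (10 * d * T) with hw
    set e := s ^ (10 * d * T) * Ψ ^ w with he
    have he0 : e ≠ 0 := mul_ne_zero (pow_ne_zero _ hs) (pow_ne_zero _ hΨ)
    have hIj : ∀ i j : Fin (2 * d * T), (I i : ℕ) + j ≤ 10 * d * T := by
      intro i j
      have h1 := (I i).2
      have h2 := j.2
      have h3 : 10 * d * T = 4 * (2 * d * T) + 2 * d * T := by ring
      omega
    -- The product formula: after multiplication by e^N the determinant is integral over the affine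
    -- line. Over infinity its decay outweighs the degree of e^N by at least one further power of q.
    have hz : algebraMap k[X] K e ^ (2 * d * T) * H.det = 0 := by
      refine eq_zero_of_forall_valuationSubring k _ (fun V hV => ?_) fun V hV hqV => ?_
      · have h1 := det_mem_subring V.toSubring (algebraMap k[X] K e • H) fun i j =>
          hden V hV _ _ (hIj i j) a b
        rwa [Matrix.det_smul, Fintype.card_fin] at h1
      · have hq1 := one_lt_valuation_X hqV
        set q := algebraMap k[X] K X with hq
        have hpc : ∀ j, V.valuation (p.coeff j) ≤ V.valuation q ^ (c * j) := by
          intro j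
          rcases Nat.eq_zero_or_pos j with rfl | hj
          · rw [hp, map_one, mul_zero, pow_zero]
          · exact (hc V hV hqV _ (hSp j)).trans
              (pow_le_pow_right₀ hq1.le (Nat.le_mul_of_pos_right _ hj))
        have hBc : ∀ a b j, V.valuation ((B a b).coeff j) ≤ V.valuation q ^ (c * j) := by
          intro a b j
          rcases Nat.eq_zero_or_pos j with rfl | hj
          · rw [hB, Matrix.one_apply, mul_zero, pow_zero]
            split_ifs <;> simp
          · exact (hc V hV hqV _ (hSB a b j)).trans
              (pow_le_pow_right₀ hq1.le (Nat.le_mul_of_pos_right _ hj))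
        have hU1 := coeffBound_zero hqV hp hB hU0 hU hpc hBc
        have hdet := valuation_hankel_det_mul_pow_le hq1 (hU1 a b)
          (coeffBound_descProd hq1 hdp hpc T) (coeffBound_descProd_mul hq1 hdB hBc hU hU1 T a b)
          (constantCoeff_descProd q p hp T) I
        have he1 : V.valuation (algebraMap k[X] K e) ≤
            V.valuation q ^ (s.natDegree * (10 * d * T) + Ψ.natDegree * w) := by
          refine valuation_algebraMap_le hV hqV _ _ (natDegree_mul_le.trans ?_)
          refine add_le_add (natDegree_pow_le.trans ?_) (natDegree_pow_le.trans ?_) <;>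
          rw [mul_comm]
        have hnum := hT₀ T hT w (sumOrdProj_le _ _)
        rw [← V.valuation_le_one_iff]
        have hA : 0 < V.valuation q ^ (∑ j : Fin (2 * d * T), T * (j : ℕ)) :=
          pow_pos (zero_lt_one.trans hq1) _
        rw [← mul_le_mul_iff_left₀ hA, one_mul, map_mul, map_mul, map_pow]
        calc _ = V.valuation q * V.valuation (algebraMap k[X] K e) ^ (2 * d * T) *
              (V.valuation H.det * V.valuation q ^ (∑ j : Fin (2 * d * T), T * (j : ℕ))) := by
              ac_rfl
          _ ≤ V.valuation q ^ 1 * (V.valuation q ^ (s.natDegree * (10 * d * T) +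
                Ψ.natDegree * w)) ^ (2 * d * T) * V.valuation q ^ (2 * d * T *
                (c * (4 * (2 * d * T) + 2 * d * T) + ∑ t ∈ Finset.range T, d * t)) := by
              rw [pow_one]
              exact mul_le_mul' (mul_le_mul' le_rfl (pow_le_pow_left₀ zero_le he1 _)) hdet
          _ ≤ _ := by
              rw [← pow_mul, ← pow_add, ← pow_add]
              refine pow_le_pow_right₀ hq1.le (le_trans (le_of_eq ?_) hnum)
              ring
    have he2 : algebraMap k[X] K e ^ (2 * d * T) ≠ 0 := by
      refine pow_ne_zero _ fun h => he0 ?_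
      exact FunctionField.algebraMap_injective k K (by rw [h, map_zero])
    exact (mul_eq_zero.1 hz).resolve_left he2
  choose Q P hQ hQP using hentry
  classical
  refine ⟨∏ a, ∏ b, Q a b, fun a b => (∏ x ∈ (Finset.univ ×ˢ Finset.univ).erase (a, b),
    Q x.1 x.2) * P a b, ?_, fun a b => ?_⟩
  · exact Finset.prod_ne_zero_iff.2 fun a _ => Finset.prod_ne_zero_iff.2 fun b _ => hQ a b
  · rw [← Finset.prod_product' (f := Q), ← Finset.mul_prod_erase _ _ (a := (a, b))
      (Finset.mem_product.2 ⟨Finset.mem_univ a, Finset.mem_univ b⟩)]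
    push_cast
    rw [← hQP a b]
    ring

end FunctionField

/-! ### Rational functions regular at the origin and their Taylor expansions. -/

section RegularRing

variable {K : Type*} [Field K]

/-- Polynomials with coefficients in a subring. -/
def coeffSubring (V : Subring K) : Subring K[X] where
  carrier := {a | ∀ i, a.coeff i ∈ V}
  mul_mem' := fun ha hb i => by
    rw [coeff_mul]; exact sum_mem fun _ _ => mul_mem (ha _) (hb _)
  one_mem' := fun i => by
    rw [coeff_one]; split_ifs
    exacts [one_mem _, zero_mem _]
  add_mem' := fun ha hb i => by rw [coeff_add]; exact add_mem (ha i) (hb i)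
  zero_mem' := fun i => by rw [coeff_zero]; exact zero_mem _
  neg_mem' := fun ha i => by rw [coeff_neg]; exact neg_mem (ha i)

theorem algebraMap_ne_zero_of_coeff_zero {b : K[X]} (hb : b.coeff 0 = 1) :
    algebraMap K[X] (RatFunc K) b ≠ 0 := by
  rw [Ne, map_eq_zero_iff _ (IsFractionRing.injective K[X] (RatFunc K))]
  rintro rfl
  simp at hb

/-- Rational functions `a / b` with `a`, `b` polynomials over `V` and `b(0) = 1`. -/
def regularRing (V : Subring K) : Subring (RatFunc K) where
  carrier := {f | ∃ a ∈ coeffSubring V, ∃ b ∈ coeffSubring V, b.coeff 0 = 1 ∧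
    f = algebraMap K[X] (RatFunc K) a / algebraMap K[X] (RatFunc K) b}
  mul_mem' := by
    rintro _ _ ⟨a, ha, b, hb, hb0, rfl⟩ ⟨a', ha', b', hb', hb0', rfl⟩
    exact ⟨a * a', mul_mem ha ha', b * b', mul_mem hb hb', by rw [mul_coeff_zero, hb0, hb0', one_mul],
      by rw [map_mul, map_mul, div_mul_div_comm]⟩
  one_mem' := ⟨1, one_mem _, 1, one_mem _, by simp, by simp⟩
  add_mem' := by
    rintro _ _ ⟨a, ha, b, hb, hb0, rfl⟩ ⟨a', ha', b', hb', hb0', rfl⟩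
    exact ⟨a * b' + b * a', add_mem (mul_mem ha hb') (mul_mem hb ha'), b * b', mul_mem hb hb',
      by rw [mul_coeff_zero, hb0, hb0', one_mul],
      by rw [div_add_div _ _ (algebraMap_ne_zero_of_coeff_zero hb0)
        (algebraMap_ne_zero_of_coeff_zero hb0')]; simp⟩
  zero_mem' := ⟨0, zero_mem _, 1, one_mem _, by simp, by simp⟩
  neg_mem' := by
    rintro _ ⟨a, ha, b, hb, hb0, rfl⟩
    exact ⟨-a, neg_mem ha, b, hb, hb0, by rw [map_neg, neg_div]⟩

theorem algebraMap_mem_regularRing {V : Subring K} {a : K[X]} (ha : a ∈ coeffSubring V) :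
    algebraMap K[X] (RatFunc K) a ∈ regularRing V :=
  ⟨a, ha, 1, one_mem _, by simp, by simp⟩

theorem C_mem_regularRing {V : Subring K} {c : K} (hc : c ∈ V) : RatFunc.C c ∈ regularRing V := by
  rw [← RatFunc.algebraMap_C]
  refine algebraMap_mem_regularRing fun i => ?_
  rw [coeff_C]; split_ifs
  exacts [hc, zero_mem _]

variable (K) in
/-- Rational functions regular at the origin. -/
abbrev regularAtZero : Subring (RatFunc K) := regularRing ⊤

theorem mem_regularAtZero {f : RatFunc K} : f ∈ regularAtZero K ↔ ∃ a b : K[X], b.coeff 0 = 1 ∧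
    f = algebraMap K[X] (RatFunc K) a / algebraMap K[X] (RatFunc K) b :=
  ⟨fun ⟨a, _, b, _, h⟩ => ⟨a, b, h⟩, fun ⟨a, b, h⟩ => ⟨a, fun _ => trivial, b, fun _ => trivial, h⟩⟩

theorem mem_regularAtZero_of_coeff_ne_zero {a b : K[X]} (hb : b.coeff 0 ≠ 0) :
    algebraMap K[X] (RatFunc K) a / algebraMap K[X] (RatFunc K) b ∈ regularAtZero K := by
  refine mem_regularAtZero.2 ⟨C (b.coeff 0)⁻¹ * a, C (b.coeff 0)⁻¹ * b, ?_, ?_⟩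
  · rw [coeff_C_mul, inv_mul_cancel₀ hb]
  · rw [map_mul, map_mul, mul_div_mul_left]
    rw [Ne, map_eq_zero_iff _ (IsFractionRing.injective K[X] (RatFunc K)), C_eq_zero]
    exact inv_ne_zero hb

/-- The Taylor expansion at the origin of a rational function. -/
def expandFun (f : RatFunc K) : PowerSeries K := (f.num : PowerSeries K) * (f.denom : PowerSeries K)⁻¹

theorem mul_expandFun {f : RatFunc K} {a b : K[X]} (hb : b.coeff 0 = 1)
    (hf : f = algebraMap K[X] (RatFunc K) a / algebraMap K[X] (RatFunc K) b) :
    (b : PowerSeries K) * expandFun f = a := by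
  have hb0 : b ≠ 0 := by rintro rfl; simp at hb
  have h1 : f.num * b = a * f.denom := by
    have h := RatFunc.num_div_denom f
    have h' := h.trans hf
    rw [div_eq_div_iff (by simpa using f.denom_ne_zero) (algebraMap_ne_zero_of_coeff_zero hb),
      ← map_mul, ← map_mul] at h'
    exact IsFractionRing.injective K[X] (RatFunc K) h'
  have h2 : f.denom ∣ b :=
    f.isCoprime_num_denom.symm.dvd_of_dvd_mul_left ⟨a, by rw [h1, mul_comm]⟩
  -- The inverse of a power series is genuine only when its constant term is nonzero. This holds
  -- here because the reduced denominator divides b and b(0) = 1.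
  have h3 : PowerSeries.constantCoeff (f.denom : PowerSeries K) ≠ 0 := by
    rw [← PowerSeries.coeff_zero_eq_constantCoeff_apply, coeff_coe]
    intro h0
    obtain ⟨c, hc⟩ := h2
    rw [hc, mul_coeff_zero, h0, zero_mul] at hb
    exact zero_ne_one hb
  rw [expandFun]
  have h4 : (f.num : PowerSeries K) * b = a * f.denom := by rw [← coe_mul, h1, coe_mul]
  calc (b : PowerSeries K) * (f.num * (f.denom : PowerSeries K)⁻¹)
      = (f.num * b) * (f.denom : PowerSeries K)⁻¹ := by ring
    _ = a * (f.denom * (f.denom : PowerSeries K)⁻¹) := by rw [h4]; ring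
    _ = a := by rw [PowerSeries.mul_inv_cancel _ h3, mul_one]

theorem coe_ne_zero_of_coeff_zero {b : K[X]} (hb : b.coeff 0 = 1) : (b : PowerSeries K) ≠ 0 := by
  rw [Ne, coe_eq_zero_iff]
  rintro rfl
  simp at hb

theorem expandFun_eq {f : RatFunc K} {a b : K[X]} {F : PowerSeries K} (hb : b.coeff 0 = 1)
    (hf : f = algebraMap K[X] (RatFunc K) a / algebraMap K[X] (RatFunc K) b)
    (hF : (b : PowerSeries K) * F = a) : expandFun f = F :=
  mul_left_cancel₀ (coe_ne_zero_of_coeff_zero hb) ((mul_expandFun hb hf).trans hF.symm)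

variable (K) in
/-- The Taylor expansion at the origin, as a ring homomorphism. -/
def expand : regularAtZero K →+* PowerSeries K where
  toFun f := expandFun (f : RatFunc K)
  map_one' := expandFun_eq (a := 1) (b := 1) (by simp) (by simp) (by simp)
  map_zero' := expandFun_eq (a := 0) (b := 1) (by simp) (by simp) (by simp)
  map_mul' := by
    rintro ⟨f, hf⟩ ⟨g, hg⟩
    obtain ⟨a, b, hb, rfl⟩ := mem_regularAtZero.1 hf
    obtain ⟨a', b', hb', rfl⟩ := mem_regularAtZero.1 hg
    refine expandFun_eq (a := a * a') (b := b * b') (by rw [mul_coeff_zero, hb, hb', one_mul])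
      (by simp [div_mul_div_comm]) ?_
    rw [coe_mul, coe_mul]
    linear_combination (b' * expandFun (algebraMap K[X] (RatFunc K) a' /
      algebraMap K[X] (RatFunc K) b') : PowerSeries K) * mul_expandFun (a := a) hb rfl +
      (a : PowerSeries K) * mul_expandFun (a := a') hb' rfl
  map_add' := by
    rintro ⟨f, hf⟩ ⟨g, hg⟩
    obtain ⟨a, b, hb, rfl⟩ := mem_regularAtZero.1 hf
    obtain ⟨a', b', hb', rfl⟩ := mem_regularAtZero.1 hg
    refine expandFun_eq (a := a * b' + b * a') (b := b * b')
      (by rw [mul_coeff_zero, hb, hb', one_mul]) ?_ ?_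
    · change _ / _ + _ / _ = _
      rw [div_add_div _ _ (algebraMap_ne_zero_of_coeff_zero hb)
        (algebraMap_ne_zero_of_coeff_zero hb')]
      simp
    · rw [coe_mul, coe_add, coe_mul, coe_mul]
      linear_combination (b' : PowerSeries K) * mul_expandFun (a := a) hb rfl +
        (b : PowerSeries K) * mul_expandFun (a := a') hb' rfl

/-- Multiplication by the denominator of the Taylor expansion. -/
theorem mul_expand (f : regularAtZero K) {a b : K[X]} (hb : b.coeff 0 = 1)
    (hf : (f : RatFunc K) = algebraMap K[X] (RatFunc K) a / algebraMap K[X] (RatFunc K) b) :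
    (b : PowerSeries K) * expand K f = a := mul_expandFun hb hf

variable (K) in
/-- The value at the origin. -/
def evalZero : regularAtZero K →+* K := PowerSeries.constantCoeff.comp (expand K)

theorem evalZero_eq (f : regularAtZero K) {a b : K[X]} (hb : b.coeff 0 = 1)
    (hf : (f : RatFunc K) = algebraMap K[X] (RatFunc K) a / algebraMap K[X] (RatFunc K) b) :
    evalZero K f = a.coeff 0 := by
  have h := congrArg (PowerSeries.coeff 0) (mul_expand f hb hf)
  rw [PowerSeries.coeff_mul, Finset.Nat.antidiagonal_zero, Finset.sum_singleton, coeff_coe,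
    coeff_coe, hb, one_mul, PowerSeries.coeff_zero_eq_constantCoeff_apply] at h
  exact h

section Sigma

variable (q : Kˣ)

theorem polySigma_coeff (a : K[X]) (i : ℕ) :
    (polySigma q a).coeff i = a.coeff i * (q : K) ^ i := by
  rw [polySigma, coe_compRingHom_apply, comp_C_mul_X_coeff]

theorem polySigma_coe (a : K[X]) :
    ((polySigma q a : K[X]) : PowerSeries K) = PowerSeries.rescale (q : K) (a : PowerSeries K) := by
  ext i
  rw [coeff_coe, polySigma_coeff, PowerSeries.coeff_rescale, coeff_coe, mul_comm]

theorem polySigma_mem {V : Subring K} (hq : (q : K) ∈ V) {a : K[X]} (ha : a ∈ coeffSubring V) :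
    polySigma q a ∈ coeffSubring V := fun i => by
  rw [polySigma_coeff]; exact mul_mem (ha i) (pow_mem hq i)

theorem sigma_mem_regularRing {V : Subring K} (hq : (q : K) ∈ V) {f : RatFunc K}
    (hf : f ∈ regularRing V) : sigma q f ∈ regularRing V := by
  obtain ⟨a, ha, b, hb, hb0, rfl⟩ := hf
  exact ⟨_, polySigma_mem q hq ha, _, polySigma_mem q hq hb,
    by rw [polySigma_coeff, hb0, pow_zero, mul_one],
    by rw [map_div₀, sigma_algebraMap, sigma_algebraMap]⟩

/-- The `q`-difference operator on rational functions regular at the origin. -/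
def sigmaRegular : regularAtZero K →+* regularAtZero K :=
  (sigma q).restrict _ _ fun _ hf => sigma_mem_regularRing q (Subring.mem_top _) hf

theorem coe_sigmaRegular (f : regularAtZero K) :
    (sigmaRegular q f : RatFunc K) = sigma q (f : RatFunc K) := rfl

theorem expand_sigmaRegular (f : regularAtZero K) :
    expand K (sigmaRegular q f) = PowerSeries.rescale (q : K) (expand K f) := by
  obtain ⟨a, b, hb, hf⟩ := mem_regularAtZero.1 f.2
  refine expandFun_eq (a := polySigma q a) (b := polySigma q b)
    (by rw [polySigma_coeff, hb, pow_zero, mul_one]) ?_ ?_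
  · rw [coe_sigmaRegular, hf, map_div₀, sigma_algebraMap, sigma_algebraMap]
  · rw [polySigma_coe, polySigma_coe, ← map_mul, mul_expand f hb hf]

theorem evalZero_sigmaRegular (f : regularAtZero K) :
    evalZero K (sigmaRegular q f) = evalZero K f := by
  rw [evalZero, RingHom.comp_apply, RingHom.comp_apply, expand_sigmaRegular,
    ← PowerSeries.coeff_zero_eq_constantCoeff_apply, PowerSeries.coeff_rescale, pow_zero, one_mul,
    PowerSeries.coeff_zero_eq_constantCoeff_apply]

@[simp]
theorem sigma_X : sigma q RatFunc.X = RatFunc.C (q : K) * RatFunc.X := by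
  rw [← RatFunc.algebraMap_X, sigma_algebraMap, ← RatFunc.algebraMap_C, ← map_mul]
  simp [polySigma]

@[simp]
theorem sigma_C (c : K) : sigma q (RatFunc.C c) = RatFunc.C c := by
  rw [← RatFunc.algebraMap_C, sigma_algebraMap]
  simp [polySigma]

end Sigma

/-- A regular function vanishing at the origin is divisible by `x`. -/
theorem X_inv_mul_mem_regularRing {V : Subring K} {f : regularAtZero K}
    (hf : (f : RatFunc K) ∈ regularRing V) (h0 : evalZero K f = 0) :
    RatFunc.X⁻¹ * (f : RatFunc K) ∈ regularRing V := by
  obtain ⟨a, ha, b, hb, hb0, hf⟩ := hf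
  rw [evalZero_eq f hb0 hf] at h0
  refine ⟨a.divX, fun i => by rw [coeff_divX]; exact ha _, b, hb, hb0, ?_⟩
  have h1 : algebraMap K[X] (RatFunc K) a = RatFunc.X * algebraMap K[X] (RatFunc K) a.divX := by
    conv_lhs => rw [← X_mul_divX_add a, h0, C_0, add_zero, map_mul, RatFunc.algebraMap_X]
  rw [hf, h1, mul_div_assoc, inv_mul_cancel_left₀ RatFunc.X_ne_zero]

end RegularRing

/-! ### Gauss norms of regular functions. -/

section Gauss

variable {K : Type*} [Field K] (V : ValuationSubring K)

theorem regularRing_le_gaussRing : regularRing V.toSubring ≤ gaussRing V := by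
  rintro _ ⟨a, ha, b, hb, hb0, rfl⟩
  have hlift : ∀ a ∈ coeffSubring V.toSubring, ∃ a' : V[X], a'.map V.subtype = a := by
    intro a ha
    rw [← mem_lifts, lifts_iff_coeff_lifts]
    exact fun i => ⟨⟨_, ha i⟩, rfl⟩
  obtain ⟨a, rfl⟩ := hlift a ha
  obtain ⟨b, rfl⟩ := hlift b hb
  refine ⟨a, b, ?_, rfl⟩
  intro h
  have h1 : b.map (IsLocalRing.residue V) = 0 :=
    IsFractionRing.injective _ (RatFunc (IsLocalRing.ResidueField V)) (by rw [map_zero]; exact h)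
  have h2 := congrArg (fun p => coeff p 0) h1
  simp only [coeff_map, coeff_zero] at h2 hb0
  have h3 : b.coeff 0 = 1 := Subtype.ext hb0
  rw [h3, map_one] at h2
  exact one_ne_zero h2

/-- A polynomial of Gauss norm at most `1` has integral coefficients. -/
theorem mem_coeffSubring_of_mem_gaussRing {f : K[X]}
    (hf : algebraMap K[X] (RatFunc K) f ∈ gaussRing V) : f ∈ coeffSubring V.toSubring := by
  obtain ⟨a, b, hb, hab⟩ := hf
  by_contra hcon
  have hcon' : ∃ i, f.coeff i ∉ V := by
    by_contra h
    push Not at h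
    exact hcon h
  obtain ⟨i, hi⟩ := hcon'
  have hi' : i ∈ f.support := by
    rw [mem_support_iff]
    intro h
    rw [h] at hi
    exact hi (zero_mem _)
  -- Dividing f by its largest coefficient c gives a polynomial g with a coefficient equal to 1. If
  -- c were not integral, g b = c⁻¹ a would reduce to 0 although neither g nor b does.
  obtain ⟨j, hj, hmax⟩ := Finset.exists_max_image f.support (fun i => V.valuation (f.coeff i))
    ⟨i, hi'⟩
  set c := f.coeff j with hc
  have hc0 : c ≠ 0 := mem_support_iff.1 hj
  have hcV : 1 < V.valuation c := by
    refine lt_of_lt_of_le ?_ (hmax i hi')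
    rwa [← not_le, V.valuation_le_one_iff]
  have hcinv : c⁻¹ ∈ V := by
    rw [← V.valuation_le_one_iff, map_inv₀]
    exact inv_le_one_of_one_le₀ hcV.le
  obtain ⟨g, hg⟩ : ∃ g : V[X], g.map V.subtype = C c⁻¹ * f := by
    rw [← mem_lifts, lifts_iff_coeff_lifts]
    intro l
    refine ⟨⟨c⁻¹ * f.coeff l, ?_⟩, by rw [coeff_C_mul]; rfl⟩
    rw [← V.valuation_le_one_iff, map_mul, map_inv₀]
    by_cases hl : l ∈ f.support
    · rw [inv_mul_le_iff₀ (zero_lt_one.trans hcV), mul_one]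
      exact hmax l hl
    · rw [notMem_support_iff.1 hl, map_zero, mul_zero]
      exact zero_le
  have h1 : g * b = C ⟨c⁻¹, hcinv⟩ * a := by
    apply polyToRatFunc_injective V
    have hb' := polyToRatFunc_ne_zero hb
    rw [eq_div_iff hb'] at hab
    have h2 : polyToRatFunc V g = algebraMap K[X] (RatFunc K) (C c⁻¹ * f) := by
      rw [← hg]; rfl
    have h3 : polyToRatFunc V (C ⟨c⁻¹, hcinv⟩) = algebraMap K[X] (RatFunc K) (C c⁻¹) := by
      change algebraMap K[X] (RatFunc K) ((C _).map V.subtype) = _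
      rw [map_C]; rfl
    rw [map_mul, map_mul, ← hab, h2, h3, map_mul, mul_assoc]
  have h2 := congrArg (polyRed V) h1
  rw [map_mul, map_mul] at h2
  have h3 : polyRed V (C ⟨c⁻¹, hcinv⟩) = 0 := by
    change algebraMap _ _ ((C _).map (IsLocalRing.residue V)) = _
    rw [map_C]
    have : IsLocalRing.residue V ⟨c⁻¹, hcinv⟩ = 0 := by
      rw [IsLocalRing.residue_eq_zero_iff, V.valuation_lt_one_iff]
      change V.valuation c⁻¹ < 1
      rw [map_inv₀]
      exact inv_lt_one_of_one_lt₀ hcV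
    rw [this, C_0, map_zero]
  rw [h3, zero_mul] at h2
  have h4 := (mul_eq_zero.1 h2).resolve_right hb
  have h5 : g.map (IsLocalRing.residue V) = 0 :=
    IsFractionRing.injective _ (RatFunc (IsLocalRing.ResidueField V)) (by rw [map_zero]; exact h4)
  have h6 := congrArg (fun p => coeff p j) h5
  have h7 : g.coeff j = 1 := by
    apply Subtype.ext
    have := congrArg (fun p => coeff p j) hg
    simp only [coeff_map, coeff_C_mul] at this
    rw [← hc, inv_mul_cancel₀ hc0] at this
    exact this
  simp only [coeff_map, coeff_zero, h7, map_one] at h6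
  exact one_ne_zero h6

/-- Bounds in Gauss norm pass to values at the origin: multiplying by a denominator b with b(0) = 1
leaves a polynomial of Gauss norm at most 1, whose constant coefficient is c f(0). This turns
integrality of operators into integrality of Taylor coefficients. -/
theorem evalZero_mul_mem {f : regularAtZero K} (hf : (f : RatFunc K) ∈ regularRing V.toSubring)
    {c : K} (h : RatFunc.C c * (f : RatFunc K) ∈ gaussRing V) : c * evalZero K f ∈ V := by
  obtain ⟨a, ha, b, hb, hb0, hf⟩ := hf
  rw [evalZero_eq f hb0 hf]
  have h1 := mul_mem h (regularRing_le_gaussRing V (algebraMap_mem_regularRing hb))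
  rw [hf, mul_assoc, div_mul_cancel₀ _ (algebraMap_ne_zero_of_coeff_zero hb0),
    ← RatFunc.algebraMap_C, ← map_mul] at h1
  have h2 := mem_coeffSubring_of_mem_gaussRing V h1 0
  rwa [coeff_C_mul] at h2

end Gauss

/-! ### Properties holding at almost all cyclotomic places. -/

section AlmostAll

open Filter

variable {k K : Type*} [Field k] [Field K] [Algebra k[X] K] [Algebra (RatFunc k) K]
  [IsScalarTower k[X] (RatFunc k) K]

/-- There are infinitely many cyclotomic places, so a property of almost all of them holds at some
place. -/
instance : (cofinite : Filter (CyclotomicPlace k K)).NeBot := by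
  suffices Infinite (CyclotomicPlace k K) from inferInstance
  by_contra h
  rw [not_infinite_iff_finite] at h
  obtain ⟨v, hv⟩ := CyclotomicPlace.exists_orderOf_notMem (k := k) (K := K)
    (Set.finite_univ.image fun v : CyclotomicPlace k K => orderOf (v.qv : v.resField)).toFinset
  exact hv (by simp)

theorem eventually_mem [FiniteDimensional (RatFunc k) K] (c : K) :
    ∀ᶠ v : CyclotomicPlace k K in cofinite, c ∈ v.ring :=
  eventually_cofinite.2 (CyclotomicPlace.finite_notMem c)

theorem eventually_mem_coeffSubring [FiniteDimensional (RatFunc k) K] (a : K[X]) :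
    ∀ᶠ v : CyclotomicPlace k K in cofinite, a ∈ coeffSubring v.ring.toSubring := by
  have h : ∀ᶠ v : CyclotomicPlace k K in cofinite, ∀ i ∈ a.support, a.coeff i ∈ v.ring :=
    (eventually_all_finset a.support).2 fun i _ => eventually_mem _
  filter_upwards [h] with v hv i
  by_cases hi : i ∈ a.support
  · exact hv i hi
  · rw [notMem_support_iff.1 hi]
    exact zero_mem _

theorem eventually_mem_regularRing [FiniteDimensional (RatFunc k) K] {f : RatFunc K}
    (hf : f ∈ regularAtZero K) :
    ∀ᶠ v : CyclotomicPlace k K in cofinite, f ∈ regularRing v.ring.toSubring := by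
  obtain ⟨a, b, hb, rfl⟩ := mem_regularAtZero.1 hf
  filter_upwards [eventually_mem_coeffSubring a, eventually_mem_coeffSubring b] with v ha hb'
  exact ⟨a, ha, b, hb', hb, rfl⟩

theorem polyRed_ne_zero (V : ValuationSubring K) {b : V[X]} {i : ℕ} (h : IsUnit (b.coeff i)) :
    polyRed V b ≠ 0 := by
  intro h0
  have h1 : b.map (IsLocalRing.residue V) = 0 :=
    IsFractionRing.injective _ (RatFunc (IsLocalRing.ResidueField V)) (by rw [map_zero]; exact h0)
  have h2 := congrArg (fun p => coeff p i) h1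
  simp only [coeff_map, coeff_zero] at h2
  exact (h.map (IsLocalRing.residue V)).ne_zero h2

theorem div_mem_gaussRing (V : ValuationSubring K) {a b : K[X]}
    (ha : a ∈ coeffSubring V.toSubring) (hb : b ∈ coeffSubring V.toSubring) {i : ℕ}
    (hi : (b.coeff i)⁻¹ ∈ V) (hi0 : b.coeff i ≠ 0) :
    algebraMap K[X] (RatFunc K) a / algebraMap K[X] (RatFunc K) b ∈ gaussRing V := by
  have hlift : ∀ a ∈ coeffSubring V.toSubring, ∃ a' : V[X], a'.map V.subtype = a := by
    intro a ha
    rw [← mem_lifts, lifts_iff_coeff_lifts]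
    exact fun i => ⟨⟨_, ha i⟩, rfl⟩
  obtain ⟨a, rfl⟩ := hlift a ha
  obtain ⟨b, rfl⟩ := hlift b hb
  rw [coeff_map] at hi hi0
  refine ⟨a, b, polyRed_ne_zero V (i := i) ?_, rfl⟩
  exact IsUnit.of_mul_eq_one ⟨_, hi⟩ (Subtype.ext (mul_inv_cancel₀ hi0))

theorem eventually_mem_gaussRing [FiniteDimensional (RatFunc k) K] (f : RatFunc K) :
    ∀ᶠ v : CyclotomicPlace k K in cofinite, f ∈ gaussRing v.ring := by
  filter_upwards [eventually_mem_coeffSubring f.num, eventually_mem_coeffSubring f.denom] with v h1 h2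
  rw [← RatFunc.num_div_denom f]
  have h3 : f.denom.coeff f.denom.natDegree = 1 := f.monic_denom
  exact div_mem_gaussRing v.ring h1 h2 (i := f.denom.natDegree) (by rw [h3, inv_one]; exact one_mem _)
    (by rw [h3]; exact one_ne_zero)

theorem C_mem_gaussRing {V : ValuationSubring K} {c : K} (hc : c ∈ V) :
    RatFunc.C c ∈ gaussRing V :=
  regularRing_le_gaussRing V (C_mem_regularRing hc)

theorem X_mem_gaussRing (V : ValuationSubring K) : RatFunc.X ∈ gaussRing V := by
  rw [← RatFunc.algebraMap_X]
  refine regularRing_le_gaussRing V (algebraMap_mem_regularRing fun i => ?_)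
  rw [coeff_X]; split_ifs
  exacts [one_mem _, zero_mem _]

theorem CyclotomicPlace.qUnit_mem (v : CyclotomicPlace k K) : (qUnit k K : K) ∈ v.ring := v.q_mem

theorem inv_mem_of_isUnit {V : ValuationSubring K} {x : V} (h : IsUnit x) : (x : K)⁻¹ ∈ V := by
  obtain ⟨y, hy⟩ := h.exists_right_inv
  have := congrArg Subtype.val hy
  rw [inv_eq_of_mul_eq_one_right (a := (x : K)) (b := y) this]
  exact y.2

theorem CyclotomicPlace.qUnit_sub_one_inv_mem (v : CyclotomicPlace k K) :
    ((qUnit k K : K) - 1)⁻¹ ∈ v.ring := by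
  have h := isUnit_pow_sub_one_of_not_orderOf_dvd (⟨_, v.q_mem⟩ : v.ring) 1 (by
    have := v.one_lt_orderOf
    rw [Nat.dvd_one]
    omega)
  rw [pow_one] at h
  exact inv_mem_of_isUnit h

theorem qUnit_pow_ne_one (n : ℕ) (hn : n ≠ 0) : (qUnit k K : K) ^ n ≠ 1 :=
  algebraMap_X_pow_ne_one n hn

theorem qUnit_sub_one_ne_zero : (qUnit k K : K) - 1 ≠ 0 := by
  have := qUnit_pow_ne_one (k := k) (K := K) 1 one_ne_zero
  rwa [pow_one, ← sub_ne_zero] at this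

end AlmostAll

/-! ### The operator of a q-difference system, gauge transformations and divided powers. -/

section MatrixOperator

variable {K : Type*} [Field K] {ι : Type*} [Fintype ι] [DecidableEq ι] (q : Kˣ)

/-- The operator `Y(x) ↦ A(x) Y(qx)`. -/
def matOp (A : Matrix ι ι (RatFunc K)) (Y : Matrix ι ι (RatFunc K)) : Matrix ι ι (RatFunc K) :=
  A * (sigma q).mapMatrix Y

/-- The divided powers of the operator `Δ` attached to `A` preserve the matrices of Gauss norm at
most `1`. -/
def IntegralAt (V : ValuationSubring K) (A : Matrix ι ι (RatFunc K)) : Prop :=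
  ∀ (n : ℕ) (Y : Matrix ι ι (RatFunc K)), (∀ i j, Y i j ∈ gaussRing V) →
    ∀ i j, divDelta q (matOp q A) n Y i j ∈ gaussRing V

variable {q}

theorem matOp_smul (A Y : Matrix ι ι (RatFunc K)) (f : RatFunc K) :
    matOp q A (f • Y) = sigma q f • matOp q A Y := by
  ext i j
  simp only [matOp, Matrix.mul_apply, RingHom.mapMatrix_apply, Matrix.map_apply, Matrix.smul_apply,
    smul_eq_mul, map_mul, Finset.mul_sum]
  exact Finset.sum_congr rfl fun _ _ => by ring

theorem matOp_gauge {A A' G : Matrix ι ι (RatFunc K)}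
    (h : G * A' = A * (sigma q).mapMatrix G) (Y : Matrix ι ι (RatFunc K)) :
    G * matOp q A' Y = matOp q A (G * Y) := by
  rw [matOp, matOp, map_mul, ← mul_assoc, h, mul_assoc]

theorem divDelta_gauge {A A' G : Matrix ι ι (RatFunc K)}
    (h : G * A' = A * (sigma q).mapMatrix G) (n : ℕ) (Y : Matrix ι ι (RatFunc K)) :
    G * divDelta q (matOp q A') n Y = divDelta q (matOp q A) n (G * Y) := by
  have h1 : ∀ Y, G * Delta q (matOp q A') Y = Delta q (matOp q A) (G * Y) := fun Y => by
    rw [Delta, Delta, Matrix.mul_smul, mul_sub, matOp_gauge h]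
  have h2 : ∀ n Y, G * (Delta q (matOp q A'))^[n] Y = (Delta q (matOp q A))^[n] (G * Y) := by
    intro n
    induction n with
    | zero => intro Y; rfl
    | succ n ih => intro Y; rw [Function.iterate_succ_apply, ih, h1, ← Function.iterate_succ_apply]
  rw [divDelta, divDelta, Matrix.mul_smul, h2]

theorem IntegralAt.gauge {V : ValuationSubring K} {A A' G H : Matrix ι ι (RatFunc K)}
    (hA : IntegralAt q V A) (h : G * A' = A * (sigma q).mapMatrix G) (hHG : H * G = 1)
    (hG : ∀ i j, G i j ∈ gaussRing V) (hH : ∀ i j, H i j ∈ gaussRing V) : IntegralAt q V A' := by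
  intro n Y hY i j
  have h1 : divDelta q (matOp q A') n Y = H * divDelta q (matOp q A) n (G * Y) := by
    rw [← divDelta_gauge h, ← mul_assoc, hHG, one_mul]
  rw [h1, Matrix.mul_apply]
  refine sum_mem fun l _ => mul_mem (hH _ _) (hA n _ (fun a b => ?_) _ _)
  rw [Matrix.mul_apply]
  exact sum_mem fun l _ => mul_mem (hG _ _) (hY _ _)

/-- The operator `(S - 1)(S - q) ⋯ (S - q^(n-1))`. -/
def shiftProd (q : Kˣ) (S : Matrix ι ι (RatFunc K) → Matrix ι ι (RatFunc K)) :
    ℕ → Matrix ι ι (RatFunc K) → Matrix ι ι (RatFunc K)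
  | 0, Y => Y
  | n + 1, Y => S (shiftProd q S n Y) - RatFunc.C ((q : K) ^ n) • shiftProd q S n Y

theorem smul_Delta {q : Kˣ} (hq : (q : K) - 1 ≠ 0) (S : Matrix ι ι (RatFunc K) →
    Matrix ι ι (RatFunc K)) (Y : Matrix ι ι (RatFunc K)) :
    (RatFunc.C ((q : K) - 1) * RatFunc.X) • Delta q S Y = S Y - Y := by
  rw [Delta, smul_smul, mul_inv_cancel₀, one_smul]
  refine mul_ne_zero ?_ RatFunc.X_ne_zero
  rwa [Ne, map_eq_zero]

/-- Since (q-1)xΔ = S - 1 and S x = q x S, collecting the powers of x on the left turns Δ^n into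
(S-1)(S-q)⋯(S-q^(n-1)). This product involves no division by x, so it can be evaluated at the origin
and reduced at a place. -/
theorem Delta_iterate_eq (hq : (q : K) - 1 ≠ 0) (A Y : Matrix ι ι (RatFunc K)) (n : ℕ) :
    (RatFunc.C (∏ i ∈ Finset.range n, ((q : K) - 1) * (q : K) ^ i) * RatFunc.X ^ n) •
      (Delta q (matOp q A))^[n] Y = shiftProd q (matOp q A) n Y := by
  induction n with
  | zero => simp [shiftProd]
  | succ n ih =>
    rw [shiftProd, ← ih, matOp_smul, Function.iterate_succ_apply', Finset.prod_range_succ]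
    set Z := (Delta q (matOp q A))^[n] Y
    have h := smul_Delta hq (matOp q A) Z
    have h1 : sigma q (RatFunc.C (∏ i ∈ Finset.range n, ((q : K) - 1) * (q : K) ^ i) *
        RatFunc.X ^ n) = RatFunc.C ((q : K) ^ n) *
        (RatFunc.C (∏ i ∈ Finset.range n, ((q : K) - 1) * (q : K) ^ i) * RatFunc.X ^ n) := by
      rw [map_mul, map_pow, sigma_X, sigma_C, mul_pow, ← map_pow]
      ring
    have h4 : matOp q A Z = Z + (RatFunc.C ((q : K) - 1) * RatFunc.X) • Delta q (matOp q A) Z := by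
      rw [h]; abel
    rw [h1, h4, smul_smul, smul_add, add_sub_cancel_left, smul_smul]
    congr 1
    simp only [map_mul]
    ring

theorem qFactorial_eq (n : ℕ) : qFactorial (q : K) n =
    (∏ i ∈ Finset.range n, ((q : K) ^ (i + 1) - 1)) * ((((q : K) - 1)⁻¹) ^ n) := by
  rw [qFactorial]
  simp only [qInt, div_eq_mul_inv]
  rw [Finset.prod_mul_distrib, Finset.prod_const, Finset.card_range]

/-- The operators `(S - 1) ⋯ (S - q^(n-1)) / ((q - 1) ⋯ (q^n - 1))` preserve the Gauss ring. -/
theorem IntegralAt.shiftProd_mem {V : ValuationSubring K} {A : Matrix ι ι (RatFunc K)}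
    (hA : IntegralAt q V A) (hq : (q : K) - 1 ≠ 0) (hqV : (q : K) ∈ V) (n : ℕ)
    {Y : Matrix ι ι (RatFunc K)} (hY : ∀ i j, Y i j ∈ gaussRing V) (i j : ι) :
    RatFunc.C (∏ i ∈ Finset.range n, ((q : K) ^ (i + 1) - 1))⁻¹ *
      shiftProd q (matOp q A) n Y i j ∈ gaussRing V := by
  have h := hA n Y hY i j
  rw [← Delta_iterate_eq hq]
  rw [divDelta, qFactorial_eq, Matrix.smul_apply, smul_eq_mul] at h
  rw [Matrix.smul_apply, smul_eq_mul]
  have h2 := mul_mem (mul_mem (C_mem_gaussRing (V := V) (c := ∏ i ∈ Finset.range n, (q : K) ^ i)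
    (prod_mem fun i _ => pow_mem hqV i)) (pow_mem (X_mem_gaussRing V) n)) h
  convert h2 using 1
  have h3 : RatFunc.C ((q : K) - 1) ≠ 0 := by rwa [Ne, map_eq_zero]
  simp only [Finset.prod_mul_distrib, Finset.prod_const, Finset.card_range, map_mul, map_pow,
    map_inv₀, mul_inv, inv_pow, inv_inv]
  ring

end MatrixOperator

/-! ### From rational solutions to annihilating polynomials of A(0). -/

section Exponents

open Filter

variable {k K : Type*} [Field k] [Field K] [Algebra k[X] K] [Algebra (RatFunc k) K]
  [IsScalarTower k[X] (RatFunc k) K] [FiniteDimensional (RatFunc k) K]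
  {ι : Type*} [Fintype ι] [DecidableEq ι]

/-- As f(qx) and f(x) have the same value at 0, the operator S acts at the origin as multiplication
by A(0), and the shifted product becomes a polynomial in A(0). The last clause provides the
integrality needed by `evalZero_mul_mem`. -/
theorem exists_shiftProd_one (q : Kˣ) (A : Matrix ι ι (regularAtZero K)) (n : ℕ) :
    ∃ T : Matrix ι ι (regularAtZero K),
      (regularAtZero K).subtype.mapMatrix T =
        shiftProd q (matOp q ((regularAtZero K).subtype.mapMatrix A)) n 1 ∧
      (evalZero K).mapMatrix T = aeval ((evalZero K).mapMatrix A)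
        (∏ i ∈ Finset.range n, (X - C ((q : K) ^ i))) ∧
      ∀ V : ValuationSubring K, (q : K) ∈ V → (∀ i j, (A i j : RatFunc K) ∈ regularRing V.toSubring) →
        ∀ i j, (T i j : RatFunc K) ∈ regularRing V.toSubring := by
  induction n with
  | zero =>
    refine ⟨1, ?_, ?_, ?_⟩
    · rw [map_one]; rfl
    · rw [map_one, Finset.prod_range_zero, map_one]
    · intro V _ _ i j
      rw [Matrix.one_apply]; split_ifs
      exacts [one_mem _, zero_mem _]
  | succ n ih =>
    obtain ⟨T, hT1, hT2, hT3⟩ := ih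
    let c : regularAtZero K := ⟨RatFunc.C ((q : K) ^ n), C_mem_regularRing (Subring.mem_top _)⟩
    have hc : evalZero K c = (q : K) ^ n := by
      rw [evalZero_eq c (a := C ((q : K) ^ n)) (b := 1) (by simp) (by simp [c, RatFunc.algebraMap_C]),
        coeff_C_zero]
    refine ⟨A * (sigmaRegular q).mapMatrix T - c • T, ?_, ?_, ?_⟩
    · rw [shiftProd, ← hT1, map_sub, map_mul, matOp]
      congr 1
    · have h1 : (evalZero K).mapMatrix ((sigmaRegular q).mapMatrix T) = (evalZero K).mapMatrix T := by
        ext i j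
        simp only [RingHom.mapMatrix_apply, Matrix.map_apply, evalZero_sigmaRegular]
      have h2 : (evalZero K).mapMatrix (c • T) = (q : K) ^ n • (evalZero K).mapMatrix T := by
        ext i j
        simp only [RingHom.mapMatrix_apply, Matrix.map_apply, Matrix.smul_apply, smul_eq_mul, map_mul,
          hc]
      rw [map_sub, map_mul, h1, h2, hT2, Finset.prod_range_succ, mul_comm, map_mul, map_sub, aeval_X,
        aeval_C, sub_mul, ← Algebra.smul_def]
    · intro V hq hA i j
      have h3 := hT3 V hq hA
      rw [Matrix.sub_apply, Matrix.mul_apply, AddSubgroupClass.coe_sub, AddSubmonoidClass.coe_finsetSum]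
      refine sub_mem (sum_mem fun l _ => mul_mem (hA _ _) (sigma_mem_regularRing q hq (h3 _ _))) ?_
      exact mul_mem (C_mem_regularRing (pow_mem hq n)) (h3 _ _)

/-- Polynomial form of the rationality criterion. -/
theorem exists_rational_polynomial {p : K[X]} {B : Matrix ι ι K[X]} {U : Matrix ι ι (PowerSeries K)}
    (hp : p.coeff 0 = 1)
    (hB : ∀ a b, (B a b).coeff 0 = (1 : Matrix ι ι K) a b)
    (hU0 : ∀ a b, PowerSeries.coeff 0 (U a b) = (1 : Matrix ι ι K) a b)
    (hU : ∀ a b, (p : PowerSeries K) * PowerSeries.rescale (qUnit k K : K) (U a b) =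
      ∑ c, U a c * (B c b : PowerSeries K))
    (hint : ∀ᶠ v : CyclotomicPlace k K in cofinite, ∀ a b n,
      PowerSeries.coeff n (U a b) ∈ v.ring) :
    ∃ (Q : K[X]) (P : Matrix ι ι K[X]), Q ≠ 0 ∧ P.det ≠ 0 ∧
      ∀ a b, (Q : PowerSeries K) * U a b = (P a b : PowerSeries K) := by
  classical
  have hfin := eventually_cofinite.1 hint
  -- Finitely many bad places have finitely many orders; all places of those orders are discarded.
  obtain ⟨Q, P, hQ, hQP⟩ := exists_rational (k := k) hp hB hU0 hU
    (hfin.image fun v : CyclotomicPlace k K => orderOf (v.qv : v.resField)).toFinset (by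
      intro v hv
      by_contra h
      exact hv ((Set.Finite.mem_toFinset _).2 ⟨v, h, rfl⟩))
  refine ⟨Q, P, hQ, fun hdet => ?_, hQP⟩
  have h1 : (coeToPowerSeries.ringHom (R := K)).mapMatrix P = (Q : PowerSeries K) • U := by
    exact Matrix.ext fun a b => (hQP a b).symm
  have h2 := congrArg Matrix.det h1
  rw [← RingHom.map_det, hdet, map_zero, Matrix.det_smul] at h2
  have h3 : U.det ≠ 0 := by
    intro h0
    have h4 : PowerSeries.constantCoeff U.det = 1 := by
      rw [RingHom.map_det]
      have : (PowerSeries.constantCoeff (R := K)).mapMatrix U = 1 := by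
        ext a b
        have := hU0 a b
        rwa [PowerSeries.coeff_zero_eq_constantCoeff_apply] at this
      rw [this, Matrix.det_one]
    rw [h0, map_zero] at h4
    exact zero_ne_one h4
  have h5 : (Q : PowerSeries K) ≠ 0 := by rwa [Ne, coe_eq_zero_iff]
  exact mul_ne_zero (pow_ne_zero _ h5) h3 h2.symm

theorem polySigma_polySigma {K : Type*} [Field K] (q r : Kˣ) (p : K[X]) :
    polySigma q (polySigma r p) = polySigma (r * q) p := by
  ext n
  rw [polySigma_coeff, polySigma_coeff, polySigma_coeff, Units.val_mul, mul_pow, mul_assoc]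

theorem polySigma_eval {K : Type*} [Field K] (q : Kˣ) (p : K[X]) (t : K) :
    (polySigma q p).eval t = p.eval (q * t) := by
  simp [polySigma]

theorem polySigma_ne_zero {K : Type*} [Field K] (q : Kˣ) {p : K[X]} (hp : p ≠ 0) :
    polySigma q p ≠ 0 :=
  nonZeroDivisors.ne_zero (polySigma_nonZeroDivisors q (mem_nonZeroDivisors_of_ne_zero hp))

theorem exists_eval_ne_zero {K : Type*} [Field K] {p : K[X]} (hp : p ≠ 0) {f : ℕ → K}
    (hf : Function.Injective f) : ∃ n, p.eval (f n) ≠ 0 := by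
  by_contra! h
  refine hp (eq_zero_of_infinite_isRoot p ((Set.infinite_range_of_injective hf).mono ?_))
  rintro _ ⟨n, rfl⟩
  exact h n

/-- Iterating the equation n times gives D(x) = ∏_{i<n} (1 + q^i x A₀). Only its values matter: at
each t they are polynomials in A₀, while the scalar product on the left acquires zeros at the points
-q^(-i). -/
theorem exists_iterate_functional_equation {K : Type*} [Field K] {q : Kˣ} {A₀ : Matrix ι ι K}
    {Q : K[X]} {P : Matrix ι ι K[X]} (hQ : Q ≠ 0)
    (h : ((1 + X : K[X]) * Q) • (polySigma q).mapMatrix P =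
      polySigma q Q • (P * (1 + (X : K[X]) • C.mapMatrix A₀))) (n : ℕ) :
    ∃ D : Matrix ι ι K[X],
      ((∏ i ∈ Finset.range n, (1 + C ((q : K) ^ i) * X : K[X])) * Q) •
        (polySigma (q ^ n)).mapMatrix P = polySigma (q ^ n) Q • (P * D) ∧
      ∀ t : K, (evalRingHom t).mapMatrix D =
        aeval A₀ (∏ i ∈ Finset.range n, (1 + C ((q : K) ^ i * t) * X : K[X])) := by
  have h1 : ∀ p : K[X], polySigma 1 p = p := fun p => by
    ext n; rw [polySigma_coeff, Units.val_one, one_pow]; simp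
  induction n with
  | zero =>
    refine ⟨1, ?_, fun t => by simp⟩
    rw [pow_zero, Finset.prod_range_zero, one_mul, mul_one, h1]
    congr 1
    exact Matrix.ext fun a b => h1 _
  | succ n ih =>
    obtain ⟨D, hD, hD'⟩ := ih
    refine ⟨D * (1 + (C ((q : K) ^ n) * X : K[X]) • C.mapMatrix A₀), ?_, fun t => ?_⟩
    · have h2 := congrArg (polySigma (q ^ n)).mapMatrix h
      have hs : ∀ (c : K[X]) (M : Matrix ι ι K[X]), (polySigma (q ^ n)).mapMatrix (c • M) =
          polySigma (q ^ n) c • (polySigma (q ^ n)).mapMatrix M := fun c M => by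
        refine Matrix.ext fun a b => ?_
        simp only [RingHom.mapMatrix_apply, Matrix.map_apply, Matrix.smul_apply, smul_eq_mul, map_mul]
      have hss : (polySigma (q ^ n)).mapMatrix ((polySigma q).mapMatrix P) =
          (polySigma (q ^ (n + 1))).mapMatrix P := by
        refine Matrix.ext fun a b => ?_
        simp only [RingHom.mapMatrix_apply, Matrix.map_apply, polySigma_polySigma]
        rw [pow_succ']
      have hX : polySigma (q ^ n) X = C ((q : K) ^ n) * X := by simp [polySigma]
      have hA : (polySigma (q ^ n)).mapMatrix (C.mapMatrix A₀) = C.mapMatrix A₀ := by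
        refine Matrix.ext fun a b => ?_
        simp [polySigma]
      rw [hs, hss, hs, map_mul, map_add, map_one, hX, polySigma_polySigma, ← pow_succ', map_mul,
        map_add, map_one, hs, hA, hX] at h2
      have hQ' := polySigma_ne_zero (q ^ n) hQ
      refine smul_right_injective _ hQ' ?_
      simp only
      rw [smul_comm (polySigma (q ^ n) Q) (polySigma (q ^ (n + 1)) Q), ← mul_assoc P D,
        ← smul_mul_assoc (polySigma (q ^ n) Q), ← hD, smul_mul_assoc,
        smul_comm (polySigma (q ^ (n + 1)) Q), ← h2, smul_smul, smul_smul, Finset.prod_range_succ]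
      congr 1
      ring
    · rw [map_mul, hD', Finset.prod_range_succ, map_mul]
      congr 1
      rw [map_add, map_one, map_add, map_one, map_mul, aeval_C, aeval_X, ← Algebra.smul_def]
      congr 1
      refine Matrix.ext fun a b => ?_
      simp

/-- Clearing the denominators of a rational solution `U = P / Q` of `p(x) U(qx) = U(x) B(x)`. -/
theorem smul_mapMatrix_polySigma {K : Type*} [Field K] {q : Kˣ} {p Q : K[X]}
    {B P : Matrix ι ι K[X]} {U : Matrix ι ι (PowerSeries K)}
    (hQP : ∀ a b, (Q : PowerSeries K) * U a b = (P a b : PowerSeries K))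
    (hU : (p : PowerSeries K) • (PowerSeries.rescale (q : K)).mapMatrix U =
      U * (coeToPowerSeries.ringHom (R := K)).mapMatrix B) :
    (p * Q) • (polySigma q).mapMatrix P = polySigma q Q • (P * B) := by
  have hinj : ∀ M N : Matrix ι ι K[X], (coeToPowerSeries.ringHom (R := K)).mapMatrix M =
      (coeToPowerSeries.ringHom (R := K)).mapMatrix N → M = N :=
    fun M N hMN => Matrix.ext fun a b => coe_injective K (congrFun (congrFun hMN a) b)
  have hs : ∀ (c : K[X]) (M : Matrix ι ι K[X]), (coeToPowerSeries.ringHom (R := K)).mapMatrix (c • M) =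
      (c : PowerSeries K) • (coeToPowerSeries.ringHom (R := K)).mapMatrix M := fun c M => by
    refine Matrix.ext fun a b => ?_
    simp
  have hPQ : (coeToPowerSeries.ringHom (R := K)).mapMatrix P = (Q : PowerSeries K) • U :=
    Matrix.ext fun a b => (hQP a b).symm
  have hPQ' : (coeToPowerSeries.ringHom (R := K)).mapMatrix ((polySigma q).mapMatrix P) =
      ((polySigma q Q : K[X]) : PowerSeries K) • (PowerSeries.rescale (q : K)).mapMatrix U := by
    refine Matrix.ext fun a b => ?_
    have := congrArg (PowerSeries.rescale (q : K)) (hQP a b)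
    rw [map_mul] at this
    simp only [RingHom.mapMatrix_apply, Matrix.map_apply, Matrix.smul_apply, smul_eq_mul,
      polySigma_coe]
    rw [this, coeToPowerSeries.ringHom_apply, polySigma_coe]
  apply hinj
  rw [hs, hs, hPQ', map_mul, hPQ, coe_mul, smul_mul_assoc, ← hU, smul_smul, smul_smul, smul_smul]
  congr 1
  ring

/-- A rational solution of `(1 + x) U(qx) = U(x) (1 + x A₀)` forces `A₀` to be annihilated by a
product of factors `X - q ^ i` with consecutive exponents. -/
theorem exists_aeval_eq_zero_of_rational {K : Type*} [Field K] {q : Kˣ}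
    (hq : ∀ n, n ≠ 0 → (q : K) ^ n ≠ 1)
    {A₀ : Matrix ι ι K} {U : Matrix ι ι (PowerSeries K)} {Q : K[X]} {P : Matrix ι ι K[X]}
    (hQ : Q ≠ 0) (hP : P.det ≠ 0)
    (hQP : ∀ a b, (Q : PowerSeries K) * U a b = (P a b : PowerSeries K))
    (hU : ((1 + X : K[X]) : PowerSeries K) • (PowerSeries.rescale (q : K)).mapMatrix U =
      U * (coeToPowerSeries.ringHom (R := K)).mapMatrix (1 + (X : K[X]) • C.mapMatrix A₀)) :
    ∃ (lo : ℤ) (n : ℕ), aeval A₀ (∏ i ∈ Finset.range n, (X - C ((q ^ (lo + i) : Kˣ) : K))) = 0 := by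
  have hE : ((1 + X : K[X]) * Q) • (polySigma q).mapMatrix P =
      polySigma q Q • (P * (1 + (X : K[X]) • C.mapMatrix A₀)) := smul_mapMatrix_polySigma hQP hU
  have hinj : ∀ {a b : ℤ}, q ^ a = q ^ b → a = b := by
    have h1 : Function.Injective fun n : ℤ => q ^ n := by
      rw [injective_zpow_iff_not_isOfFinOrder, isOfFinOrder_iff_pow_eq_one]
      rintro ⟨n, hn, h⟩
      exact hq n hn.ne' (by rw [← Units.val_pow_eq_pow_val, h, Units.val_one])
    exact fun {a b} h => h1 h
  -- Two points are chosen off the zeros of det P and Q: t = -q^(-j), where P is invertible, and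
  -- -q^(m+1), where Q does not vanish. After n = j + m + 1 iterations q^n t is the second point,
  -- while the factor 1 + q^j x on the left vanishes at t; hence D(t) = 0.
  obtain ⟨j, hj⟩ := exists_eval_ne_zero hP (f := fun n : ℕ => -((q ^ (-(n : ℤ)) : Kˣ) : K))
    (fun a b hab => by
      have := hinj (Units.ext (neg_injective hab))
      omega)
  obtain ⟨m, hm⟩ := exists_eval_ne_zero hQ (f := fun n : ℕ => -((q ^ ((n : ℤ) + 1) : Kˣ) : K))
    (fun a b hab => by
      have := hinj (Units.ext (neg_injective hab))
      omega)
  obtain ⟨D, hD, hD'⟩ := exists_iterate_functional_equation hQ hE (j + (m + 1))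
  set t : K := -((q ^ (-(j : ℤ)) : Kˣ) : K)
  have hqt : ∀ i : ℕ, (q : K) ^ i * t = -((q ^ ((i : ℤ) - j) : Kˣ) : K) := fun i => by
    rw [mul_neg, sub_eq_add_neg, zpow_add, Units.val_mul, zpow_natCast, Units.val_pow_eq_pow_val]
  have h0 := congrArg (evalRingHom t).mapMatrix hD
  have hs : ∀ (c : K[X]) (M : Matrix ι ι K[X]), (evalRingHom t).mapMatrix (c • M) =
      c.eval t • (evalRingHom t).mapMatrix M := fun c M => by
    refine Matrix.ext fun a b => ?_
    simp
  have hz : (∏ i ∈ Finset.range (j + (m + 1)), (1 + C ((q : K) ^ i) * X : K[X])).eval t = 0 := by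
    rw [eval_prod]
    refine Finset.prod_eq_zero (i := j) (Finset.mem_range.2 (by omega)) ?_
    have := hqt j
    rw [sub_self, zpow_zero, Units.val_one] at this
    simp [this]
  rw [hs, eval_mul, hz, zero_mul, zero_smul, hs, polySigma_eval, Units.val_pow_eq_pow_val, hqt,
    map_mul, hD'] at h0
  have h1 : Q.eval (-((q ^ (((j + (m + 1) : ℕ) : ℤ) - j) : Kˣ) : K)) ≠ 0 := by
    convert hm using 5
    push_cast; ring
  have h2 := (smul_eq_zero.1 h0.symm).resolve_left h1
  have hu : IsUnit ((evalRingHom t).mapMatrix P) := by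
    rw [Matrix.isUnit_iff_isUnit_det, ← RingHom.map_det]
    exact isUnit_iff_ne_zero.2 hj
  rw [hu.mul_right_eq_zero] at h2
  -- Up to a unit the factors of D(t) are A₀ - q^(j-i) for i < n, so the exponents run from j - n +
  -- 1 to j; the product is reversed to make them increase.
  refine ⟨(j : ℤ) - ((j + (m + 1) : ℕ) : ℤ) + 1, j + (m + 1), ?_⟩
  rw [← Finset.prod_range_reflect]
  have h3 : (∏ i ∈ Finset.range (j + (m + 1)), (1 + C ((q : K) ^ i * t) * X : K[X])) =
      (∏ i ∈ Finset.range (j + (m + 1)), C ((q : K) ^ i * t)) *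
      ∏ i ∈ Finset.range (j + (m + 1)), (X - C ((q ^ ((j : ℤ) - i) : Kˣ) : K)) := by
    rw [← Finset.prod_mul_distrib]
    refine Finset.prod_congr rfl fun i _ => ?_
    rw [mul_sub, ← C_mul, hqt, neg_mul, ← Units.val_mul, ← zpow_add]
    simp [add_comm]
  rw [h3, map_mul, ← map_prod, aeval_C, ← Algebra.smul_def] at h2
  have h4 := (smul_eq_zero.1 h2).resolve_left (Finset.prod_ne_zero_iff.2 fun i _ => by
    rw [hqt]; exact neg_ne_zero.2 (Units.ne_zero _))
  rw [← h4]
  congr 1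
  refine Finset.prod_congr rfl fun i hi => ?_
  rw [Finset.mem_range] at hi
  congr 4
  omega

end Exponents

/-! ### Annihilating polynomials with roots in powers of q. -/

section AnnihilatingPolynomials

variable {K E : Type*} [Field K] [Ring E] [Algebra K E]

theorem mul_aeval_of_semiconj {a b x : E} (h : x * a = b * x) (p : K[X]) :
    x * aeval a p = aeval b p * x := by
  induction p using Polynomial.induction_on' with
  | add p r hp hr => rw [map_add, map_add, mul_add, add_mul, hp, hr]
  | monomial n c =>
    have h1 : SemiconjBy x a b := h
    rw [aeval_monomial, aeval_monomial, ← mul_assoc, ← Algebra.commutes, mul_assoc,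
      (h1.pow_right n).eq, mul_assoc]

theorem aeval_mul_of_sub_mul_eq_zero {a x : E} {c : K} (h : a * x = c • x) (p : K[X]) :
    aeval a p * x = p.eval c • x := by
  obtain ⟨r, hr⟩ := X_sub_C_dvd_sub_C_eval (a := c) (p := p)
  have h1 := congrArg (fun s => aeval a s * x) hr
  simp only [map_sub, map_mul, aeval_C, aeval_X, sub_mul] at h1
  rw [(Commute.all (X - C c) r).eq] at hr
  have h2 := congrArg (fun s => aeval a s * x) hr
  simp only [map_sub, map_mul, aeval_C, aeval_X, sub_mul, mul_assoc, h, ← Algebra.smul_def,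
    sub_self, mul_zero] at h2
  exact sub_eq_zero.1 h2

/-- A simple root of an annihilating polynomial does not need to be repeated. -/
theorem aeval_eq_zero_of_sub_mul_aeval_eq_zero {a : E} {c : K} {g h h₁ : K[X]}
    (hg : g.eval c = 0) (h1 : (a - algebraMap K E c) * aeval a g = 0) (h2 : aeval a h = 0)
    (h3 : h ∣ h₁ * (X - C c)) (h4 : h₁.eval c ≠ 0) : aeval a g = 0 := by
  obtain ⟨g₁, rfl⟩ := dvd_iff_isRoot.2 hg
  rw [sub_mul, sub_eq_zero, ← Algebra.smul_def] at h1
  -- The element x = g(a) satisfies a x = c x, so h₁(a) x = h₁(c) x. It is also a multiple of a - c,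
  -- so h₁(a) x is a multiple of h(a) = 0.
  have h5 := aeval_mul_of_sub_mul_eq_zero h1 h₁
  obtain ⟨r, hr⟩ := h3
  rw [← map_mul, ← mul_assoc, hr, map_mul, map_mul, h2, zero_mul, zero_mul] at h5
  exact (smul_eq_zero_iff_right h4).1 h5.symm

variable {q : Kˣ}

/-- `(X - q^lo) (X - q^(lo+1)) ⋯ (X - q^(lo+n-1))`. -/
def zpowProd (q : Kˣ) (lo : ℤ) (n : ℕ) : K[X] :=
  ∏ i ∈ Finset.range n, (X - C ((q ^ (lo + i) : Kˣ) : K))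

theorem zpow_injective_of_pow_ne_one (hq : ∀ n, n ≠ 0 → (q : K) ^ n ≠ 1) {a b : ℤ}
    (h : q ^ a = q ^ b) : a = b := by
  have h1 : Function.Injective fun n : ℤ => q ^ n := by
    rw [injective_zpow_iff_not_isOfFinOrder, isOfFinOrder_iff_pow_eq_one]
    rintro ⟨n, hn, h⟩
    exact hq n hn.ne' (by rw [← Units.val_pow_eq_pow_val, h, Units.val_one])
  exact h1 h

/-- The witness omits the factor with root q^m, if there is one. The remaining roots differ from q^m
because q is not a root of unity. -/
theorem exists_zpowProd_dvd (hq : ∀ n, n ≠ 0 → (q : K) ^ n ≠ 1) (lo : ℤ) (n : ℕ) (m : ℤ) :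
    ∃ h₁ : K[X], zpowProd q lo n ∣ h₁ * (X - C ((q ^ m : Kˣ) : K)) ∧
      h₁.eval ((q ^ m : Kˣ) : K) ≠ 0 := by
  classical
  refine ⟨∏ i ∈ (Finset.range n).filter fun i : ℕ => lo + i ≠ m, (X - C ((q ^ (lo + i) : Kˣ) : K)),
    ?_, ?_⟩
  · rw [zpowProd, ← Finset.prod_filter_mul_prod_filter_not (Finset.range n) fun i : ℕ => lo + i ≠ m]
    refine mul_dvd_mul_left _ ?_
    rcases ((Finset.range n).filter fun i : ℕ => ¬ lo + i ≠ m).eq_empty_or_nonempty with h | ⟨i, hi⟩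
    · rw [h, Finset.prod_empty]
      exact one_dvd _
    · have h1 : ((Finset.range n).filter fun i : ℕ => ¬ lo + i ≠ m) ⊆ {i} := fun j hj => by
        simp only [Finset.mem_filter, not_not] at hi hj
        simp only [Finset.mem_singleton]
        omega
      refine (Finset.prod_dvd_prod_of_subset _ _ _ h1).trans ?_
      rw [Finset.prod_singleton, not_not.1 (Finset.mem_filter.1 hi).2]
  · rw [eval_prod, Finset.prod_ne_zero_iff]
    intro i hi
    simp only [eval_sub, eval_X, eval_C]
    rw [sub_ne_zero]
    intro h
    exact (Finset.mem_filter.1 hi).2 (zpow_injective_of_pow_ne_one hq (Units.ext h.symm))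

theorem zpowProd_succ (lo : ℤ) (n : ℕ) :
    zpowProd q lo (n + 1) = zpowProd q (lo + 1) n * (X - C ((q ^ lo : Kˣ) : K)) := by
  rw [zpowProd, Finset.prod_range_succ', zpowProd]
  congr 1
  · refine Finset.prod_congr rfl fun i _ => ?_
    congr 4
    push_cast; ring
  · simp

theorem zpowProd_eval_ne_zero (hq : ∀ n, n ≠ 0 → (q : K) ^ n ≠ 1) (lo : ℤ) (n : ℕ) :
    (zpowProd q (lo + 1) n).eval ((q ^ lo : Kˣ) : K) ≠ 0 := by
  rw [zpowProd, eval_prod, Finset.prod_ne_zero_iff]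
  intro i _
  simp only [eval_sub, eval_X, eval_C]
  rw [sub_ne_zero]
  intro h
  have := zpow_injective_of_pow_ne_one hq (Units.ext h)
  omega

theorem zpowProd_eval_eq_zero (lo : ℤ) (n : ℕ) :
    (zpowProd q lo (n + 1)).eval ((q ^ lo : Kˣ) : K) = 0 := by
  rw [zpowProd_succ, eval_mul]; simp

/-- The effect of a shearing transformation on the annihilating polynomial. -/
theorem sub_mul_aeval_shear {a₀ p c a' : E} {l : K} {g : K[X]} (hp : p * p = p)
    (hap : Commute p a₀) (hc : p * c = c) (hc' : c * p = 0)
    (ha' : a' = l • p + c + a₀ * (1 - p)) (hg : aeval a₀ g * (1 - p) = 0) :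
    (a' - algebraMap K E l) * aeval a' g = 0 := by
  -- Modulo the image of p the element a' acts as a₀, hence (1 - p) g(a') = 0 and g(a') lies in the
  -- image of p, where a' acts as the scalar l.
  have h1 : (1 - p) * a' = a₀ * (1 - p) := by
    have h2 : (1 - p) * a₀ * (1 - p) = a₀ * (1 - p) := by
      rw [sub_mul 1 p a₀, one_mul, hap.eq]
      simp only [mul_sub, sub_mul, mul_one, mul_assoc, hp]
      abel
    rw [ha', mul_add, mul_add, ← mul_assoc, h2]
    simp only [sub_mul, one_mul, mul_smul_comm, hp, hc, sub_self, smul_zero, zero_add]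
  have h2 : (1 - p) * aeval a' g = 0 := by
    rw [mul_aeval_of_semiconj h1, hg]
  have h3 : aeval a' g = p * aeval a' g := by
    rwa [sub_mul, one_mul, sub_eq_zero] at h2
  have h4 : a' * p = l • p := by
    rw [ha', add_mul, add_mul, hc', mul_assoc, sub_mul, one_mul, hp, sub_self, smul_mul_assoc, hp]
    simp
  rw [h3, ← mul_assoc, sub_mul, h4, ← Algebra.smul_def, sub_self, zero_mul]

end AnnihilatingPolynomials

/-! ### Exponents at the origin of a nearly integral system. -/

section Exponents

open Filter

variable {k K : Type*} [Field k] [Field K] [Algebra k[X] K] [Algebra (RatFunc k) K]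
  [IsScalarTower k[X] (RatFunc k) K]
  {ι : Type*} [Fintype ι] [DecidableEq ι]

variable (k) in
/-- The divided powers of `Δ` are integral at almost all cyclotomic places. -/
def NearlyIntegral (A : Matrix ι ι (RatFunc K)) : Prop :=
  ∀ᶠ v : CyclotomicPlace k K in cofinite, IntegralAt (qUnit k K) v.ring A

variable [FiniteDimensional (RatFunc k) K]

theorem eventually_matrix_mem_gaussRing (G : Matrix ι ι (RatFunc K)) :
    ∀ᶠ v : CyclotomicPlace k K in cofinite, ∀ i j, G i j ∈ gaussRing v.ring :=
  eventually_all.2 fun _ => eventually_all.2 fun _ => eventually_mem_gaussRing _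

theorem eventually_matrix_mem_regularRing (A : Matrix ι ι (regularAtZero K)) :
    ∀ᶠ v : CyclotomicPlace k K in cofinite, ∀ i j,
      (A i j : RatFunc K) ∈ regularRing v.ring.toSubring :=
  eventually_all.2 fun _ => eventually_all.2 fun _ => eventually_mem_regularRing (Subtype.prop _)

theorem NearlyIntegral.gauge {A A' G H : Matrix ι ι (RatFunc K)} (hA : NearlyIntegral k A)
    (h : G * A' = A * (sigma (qUnit k K)).mapMatrix G) (hHG : H * G = 1) : NearlyIntegral k A' := by
  filter_upwards [hA, eventually_matrix_mem_gaussRing G, eventually_matrix_mem_gaussRing H]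
    with v h1 h2 h3
  exact h1.gauge h hHG h2 h3

/-- The inclusion of matrices of regular functions into all matrices of rational functions. -/
abbrev coeMatrix (A : Matrix ι ι (regularAtZero K)) : Matrix ι ι (RatFunc K) :=
  (regularAtZero K).subtype.mapMatrix A

/-- The exponents at the origin are integral powers of `q`, without logarithms. -/
theorem exists_aeval_zpowProd_eq_zero {A : Matrix ι ι (regularAtZero K)}
    (hA : NearlyIntegral k (coeMatrix A)) :
    ∃ (lo : ℤ) (n : ℕ), aeval ((evalZero K).mapMatrix A) (zpowProd (qUnit k K) lo n) = 0 := by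
  set q := qUnit k K with hq_def
  set A₀ := (evalZero K).mapMatrix A
  have hq : ∀ n, n ≠ 0 → (q : K) ^ n ≠ 1 := qUnit_pow_ne_one
  -- These are q-binomial coefficients in A₀: the values at the origin of the normalised shifted
  -- products applied to the identity, so they are integral at almost all places.
  let b : ℕ → Matrix ι ι K := fun n => (∏ i ∈ Finset.range n, ((q : K) ^ (i + 1) - 1))⁻¹ •
    aeval A₀ (∏ i ∈ Finset.range n, (X - C ((q : K) ^ i)))
  -- This recursion is the equation (1 + x) U(qx) = U(x)(1 + x A₀) for the generating series U,
  -- which brings the rationality criterion to bear on the constant matrix A₀.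
  have hb : ∀ n, ((q : K) ^ (n + 1) - 1) • b (n + 1) = b n * A₀ - (q : K) ^ n • b n := fun n => by
    have h1 : (q : K) ^ (n + 1) - 1 ≠ 0 := sub_ne_zero.2 (hq _ n.succ_ne_zero)
    simp only [b]
    rw [Finset.prod_range_succ, Finset.prod_range_succ, mul_inv, mul_comm _ (((q : K) ^ (n + 1) - 1)⁻¹),
      smul_smul, ← mul_assoc, mul_inv_cancel₀ h1, one_mul, map_mul, map_sub, aeval_X, aeval_C, mul_sub,
      smul_sub, smul_mul_assoc, ← Algebra.commutes, ← Algebra.smul_def, smul_comm]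
  let U : Matrix ι ι (PowerSeries K) := fun i j => PowerSeries.mk fun n => b n i j
  have hU0 : ∀ i j, PowerSeries.coeff 0 (U i j) = (1 : Matrix ι ι K) i j := fun i j => by
    simp [U, b]
  have hU : ∀ i j, ((1 + X : K[X]) : PowerSeries K) * PowerSeries.rescale (q : K) (U i j) =
      ∑ l, U i l * (((1 + (X : K[X]) • C.mapMatrix A₀ : Matrix ι ι K[X]) l j : K[X]) :
        PowerSeries K) := fun i j => by
    have h1 : ∀ l, (((1 + (X : K[X]) • C.mapMatrix A₀ : Matrix ι ι K[X]) l j : K[X]) :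
        PowerSeries K) = (1 : Matrix ι ι (PowerSeries K)) l j + PowerSeries.X * PowerSeries.C (A₀ l j) :=
      fun l => by
        rw [Matrix.add_apply, coe_add, Matrix.smul_apply, smul_eq_mul, coe_mul, coe_X,
          RingHom.mapMatrix_apply, Matrix.map_apply, coe_C, Matrix.one_apply, Matrix.one_apply]
        split_ifs <;> simp
    simp only [h1, mul_add, Finset.sum_add_distrib]
    rw [← Matrix.mul_apply, mul_one]
    ext n
    have h2 : ∀ l, U i l * (PowerSeries.X * PowerSeries.C (A₀ l j)) =
        PowerSeries.X * (U i l * PowerSeries.C (A₀ l j)) := fun l => by ring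
    simp only [h2, ← Finset.mul_sum]
    rw [coe_add, coe_one, coe_X, add_mul, one_mul, map_add, map_add]
    cases n with
    | zero => simp
    | succ n =>
      rw [PowerSeries.coeff_succ_X_mul, PowerSeries.coeff_succ_X_mul, map_sum]
      simp only [PowerSeries.coeff_rescale, PowerSeries.coeff_mul_C, U, PowerSeries.coeff_mk]
      have := congrFun (congrFun (hb n) i) j
      simp only [Matrix.smul_apply, Matrix.sub_apply, Matrix.mul_apply, smul_eq_mul] at this
      linear_combination this
  have hint : ∀ᶠ v : CyclotomicPlace k K in cofinite, ∀ i j n,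
      PowerSeries.coeff n (U i j) ∈ v.ring := by
    filter_upwards [hA, eventually_matrix_mem_regularRing A] with v h1 h2 i j n
    obtain ⟨T, hT1, hT2, hT3⟩ := exists_shiftProd_one q A n
    have h3 := h1.shiftProd_mem qUnit_sub_one_ne_zero v.qUnit_mem n (Y := 1) (fun i j => by
      rw [Matrix.one_apply]; split_ifs
      exacts [one_mem _, zero_mem _]) i j
    rw [coeMatrix, ← hT1] at h3
    have h4 := evalZero_mul_mem v.ring (hT3 v.ring v.qUnit_mem h2 i j) h3
    have h5 : evalZero K (T i j) = aeval A₀ (∏ i ∈ Finset.range n, (X - C ((q : K) ^ i))) i j :=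
      congrFun (congrFun hT2 i) j
    rw [h5] at h4
    simpa [U, b] using h4
  have hB0 : ∀ i j, ((1 + (X : K[X]) • C.mapMatrix A₀ : Matrix ι ι K[X]) i j).coeff 0 =
      (1 : Matrix ι ι K) i j := fun i j => by
    rw [Matrix.add_apply, Matrix.one_apply, Matrix.one_apply]
    split_ifs <;> simp
  obtain ⟨Q, P, hQ, hP, hQP⟩ := exists_rational_polynomial (k := k) (p := 1 + X) (by simp) hB0 hU0 hU hint
  exact exists_aeval_eq_zero_of_rational hq hQ hP hQP (Matrix.ext fun i j => by
    rw [Matrix.mul_apply]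
    exact hU i j)

end Exponents

/-! ### Shearing transformations. -/

section Shear

/-- In blocks along p and 1 - p the gauge matrix is diag(x, 1), with y x playing the role of σ(x).
The transformed matrix has its diagonal p-block multiplied by y and its block p a (1 - p) divided by
x; the quotient is n. -/
theorem shear_gauge {R E : Type*} [CommRing R] [Ring E] [Algebra R E] {p a n : E} {x y : R}
    (hp : p * p = p) (hn : x • n = p * a * (1 - p)) (hpn : p * n = n) :
    (x • p + (1 - p)) * (y • (p * a * p) + n + (y * x) • ((1 - p) * a * p) + (1 - p) * a * (1 - p)) =
      a * ((y * x) • p + (1 - p)) := by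
  have h0 : p * (1 - p) = 0 := by rw [mul_sub, mul_one, hp, sub_self]
  have h0' : (1 - p) * p = 0 := by rw [sub_mul, one_mul, hp, sub_self]
  have h0'' : (1 - p) * (1 - p) = 1 - p := by rw [mul_sub, h0', mul_one, sub_zero]
  have hn' : (1 - p) * n = 0 := by rw [sub_mul, one_mul, hpn, sub_self]
  simp only [add_mul, mul_add, smul_mul_assoc, mul_smul_comm, ← mul_assoc, hp, h0, h0', h0'', hn',
    hpn, smul_zero, add_zero, zero_add, hn, smul_smul]
  simp only [mul_sub, sub_mul, one_mul, mul_one, smul_sub]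
  abel

variable {K : Type*} [Field K] {ι : Type*} [Fintype ι] [DecidableEq ι]

variable (K) in
/-- Constants as regular functions. -/
def constRegular : K →+* regularAtZero K where
  toFun c := ⟨RatFunc.C c, C_mem_regularRing (Subring.mem_top _)⟩
  map_one' := Subtype.ext (map_one _)
  map_zero' := Subtype.ext (map_zero _)
  map_mul' _ _ := Subtype.ext (map_mul _ _ _)
  map_add' _ _ := Subtype.ext (map_add _ _ _)

theorem evalZero_constRegular (c : K) : evalZero K (constRegular K c) = c := by
  rw [evalZero_eq _ (a := C c) (b := 1) (by simp) (by simp [constRegular, RatFunc.algebraMap_C]),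
    coeff_C_zero]

variable (K) in
/-- The coordinate as a regular function. -/
def xRegular : regularAtZero K :=
  ⟨RatFunc.X, by
    rw [← RatFunc.algebraMap_X]; exact algebraMap_mem_regularRing fun _ => Subring.mem_top _⟩

theorem evalZero_xRegular : evalZero K (xRegular K) = 0 := by
  rw [evalZero_eq _ (a := X) (b := 1) (by simp) (by simp [xRegular]), coeff_X_zero]

theorem exists_xRegular_smul_eq {N : Matrix ι ι (regularAtZero K)}
    (h : (evalZero K).mapMatrix N = 0) : ∃ N', xRegular K • N' = N := by
  refine ⟨fun i j => ⟨RatFunc.X⁻¹ * (N i j : RatFunc K),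
    X_inv_mul_mem_regularRing (N i j).2 (congrFun (congrFun h i) j)⟩, Matrix.ext fun i j => ?_⟩
  apply Subtype.ext
  change (RatFunc.X : RatFunc K) * (RatFunc.X⁻¹ * (N i j : RatFunc K)) = (N i j : RatFunc K)
  exact mul_inv_cancel_left₀ (RatFunc.X_ne_zero (K := K)) _

theorem mapMatrix_smul' {R S : Type*} [CommRing R] [CommRing S] (f : R →+* S) (c : R)
    (M : Matrix ι ι R) : f.mapMatrix (c • M) = f c • f.mapMatrix M :=
  Matrix.ext fun _ _ => map_mul f _ _

/-- A shearing transformation multiplies one eigenvalue at the origin by `q`. -/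
theorem exists_shear (q : Kˣ) (A : Matrix ι ι (regularAtZero K)) {p : Matrix ι ι K} (hp : p * p = p)
    (hpA : Commute p ((evalZero K).mapMatrix A)) :
    ∃ (A' : Matrix ι ι (regularAtZero K)) (G H : Matrix ι ι (RatFunc K)) (c : Matrix ι ι K),
      G * coeMatrix A' = coeMatrix A * (sigma q).mapMatrix G ∧ H * G = 1 ∧ p * c = c ∧ c * p = 0 ∧
      (evalZero K).mapMatrix A' = (q : K) • ((evalZero K).mapMatrix A * p) + c +
        (evalZero K).mapMatrix A * (1 - p) := by
  set A₀ := (evalZero K).mapMatrix A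
  let r := (constRegular K).mapMatrix p
  have hr : r * r = r := by rw [← map_mul, hp]
  have hr0 : (evalZero K).mapMatrix r = p := Matrix.ext fun i j => evalZero_constRegular _
  have h0 : p * (1 - p) = 0 := by rw [mul_sub, mul_one, hp, sub_self]
  have h0' : (1 - p) * p = 0 := by rw [sub_mul, one_mul, hp, sub_self]
  have h0'' : (1 - p) * (1 - p) = 1 - p := by rw [mul_sub, h0', mul_one, sub_zero]
  -- As p commutes with A(0), this off-diagonal block vanishes at the origin, so the division by x
  -- keeps the system regular. The value of the quotient at 0 produces the term c, which is not
  -- controlled.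
  obtain ⟨N, hN⟩ := exists_xRegular_smul_eq (N := r * A * (1 - r)) (by
    rw [map_mul, map_mul, map_sub, map_one, hr0, hpA.eq, mul_assoc, h0, mul_zero])
  let n := r * N * (1 - r)
  have hrn : r * n = n := by simp only [n, ← mul_assoc, hr]
  have hr1 : (1 - r) * (1 - r) = 1 - r := by
    rw [mul_sub, sub_mul, sub_mul, mul_one, one_mul, mul_one, hr, sub_self, sub_zero]
  have hn : xRegular K • n = r * A * (1 - r) := by
    simp only [n]
    rw [← smul_mul_assoc, ← mul_smul_comm, hN]
    simp only [← mul_assoc, hr]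
    rw [mul_assoc (r * A), hr1]
  have key := shear_gauge (y := constRegular K (q : K)) hr hn hrn
  let g : Matrix ι ι (regularAtZero K) := xRegular K • r + (1 - r)
  let A' := constRegular K (q : K) • (r * A * r) + n +
    (constRegular K (q : K) * xRegular K) • ((1 - r) * A * r) + (1 - r) * A * (1 - r)
  refine ⟨A', coeMatrix g, (RatFunc.X⁻¹ : RatFunc K) • coeMatrix r + (1 - coeMatrix r),
    p * (evalZero K).mapMatrix N * (1 - p), ?_, ?_, ?_, ?_, ?_⟩
  · rw [← map_mul, key, map_mul]
    congr 1
    simp only [g, map_add, map_sub, map_one, mapMatrix_smul']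
    have h1 : (sigma q).mapMatrix (coeMatrix r) = coeMatrix r := Matrix.ext fun i j => sigma_C q _
    rw [h1]
    congr 2
    exact (sigma_X q).symm
  · simp only [g, map_add, map_sub, map_one, mapMatrix_smul']
    have h1 : coeMatrix r * coeMatrix r = coeMatrix r := by rw [← map_mul, hr]
    have h2 : (regularAtZero K).subtype (xRegular K) = RatFunc.X := rfl
    simp only [add_mul, mul_add, sub_mul, mul_sub, one_mul, mul_one, smul_mul_assoc, mul_smul_comm,
      h1, h2, sub_self]
    rw [add_zero, smul_smul, mul_inv_cancel₀ (RatFunc.X_ne_zero (K := K)), one_smul]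
    abel
  · simp only [← mul_assoc, hp]
  · rw [mul_assoc, h0', mul_zero]
  · have h1 : (1 - p) * A₀ * (1 - p) = A₀ * (1 - p) := by
      rw [sub_mul 1 p A₀, one_mul, hpA.eq, sub_mul, mul_assoc, h0, mul_zero, sub_zero]
    simp only [A', n, map_add, map_mul, map_sub, map_one, mapMatrix_smul', hr0, evalZero_constRegular,
      evalZero_xRegular, mul_zero, zero_smul, add_zero]
    rw [h1, hpA.eq, mul_assoc A₀ p p, hp]

end Shear

/-! ### Reduction to A(0) = 1. -/

section Normalisation

variable {k K : Type*} [Field k] [Field K] [Algebra k[X] K] [Algebra (RatFunc k) K]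
  [IsScalarTower k[X] (RatFunc k) K] [FiniteDimensional (RatFunc k) K]
  {ι : Type*} [Fintype ι] [DecidableEq ι]

/-- A shear along the eigenspace of the lowest eigenvalue q^lo moves it to q^(lo+1), so the range of
exponents shrinks. The uncontrolled off-diagonal term could destroy diagonalisability; near
integrality of the new system excludes this. -/
theorem exists_gauge_lower {A : Matrix ι ι (regularAtZero K)} (hA : NearlyIntegral k (coeMatrix A))
    {lo : ℤ} {n : ℕ}
    (h : aeval ((evalZero K).mapMatrix A) (zpowProd (qUnit k K) lo (n + 2)) = 0) :
    ∃ (A' : Matrix ι ι (regularAtZero K)) (G H : Matrix ι ι (RatFunc K)),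
      G * coeMatrix A' = coeMatrix A * (sigma (qUnit k K)).mapMatrix G ∧ H * G = 1 ∧
      aeval ((evalZero K).mapMatrix A') (zpowProd (qUnit k K) (lo + 1) (n + 1)) = 0 := by
  set q := qUnit k K
  have hq : ∀ n, n ≠ 0 → (q : K) ^ n ≠ 1 := qUnit_pow_ne_one
  set A₀ := (evalZero K).mapMatrix A
  set g := zpowProd q (lo + 1) (n + 1)
  set l : K := ((q ^ lo : Kˣ) : K)
  have hgl : g.eval l ≠ 0 := zpowProd_eval_ne_zero hq lo (n + 1)
  rw [zpowProd_succ, mul_comm, map_mul, map_sub, aeval_X, aeval_C, sub_mul, sub_eq_zero,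
    ← Algebra.smul_def] at h
  -- The Lagrange interpolation projector onto the eigenspace of A₀ for q^lo.
  let p := (g.eval l)⁻¹ • aeval A₀ g
  have hAp : A₀ * p = l • p := by
    simp only [p]
    rw [mul_smul_comm, h, smul_comm]
  have hgp : aeval A₀ g * p = aeval A₀ g := by
    rw [aeval_mul_of_sub_mul_eq_zero hAp, smul_smul, mul_inv_cancel₀ hgl, one_smul]
  have hp : p * p = p := by
    nth_rewrite 1 [show p = (g.eval l)⁻¹ • aeval A₀ g from rfl]
    rw [smul_mul_assoc, hgp]
  have hpA : Commute p A₀ := by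
    refine Commute.smul_left ?_ _
    have := (Commute.all g X).map (aeval A₀)
    rwa [aeval_X] at this
  obtain ⟨A', G, H, c, hG, hH, hc, hc', hA'⟩ := exists_shear q A hp hpA
  refine ⟨A', G, H, hG, hH, ?_⟩
  -- The shear alone only gives an annihilating polynomial with a double root at q^(lo+1). The new
  -- system is again nearly integral, so it also has one with simple roots, and the repeated factor
  -- can be dropped.
  obtain ⟨lo', m, hm⟩ := exists_aeval_zpowProd_eq_zero (hA.gauge hG hH)
  obtain ⟨h₁, hh1, hh2⟩ := exists_zpowProd_dvd hq lo' m (lo + 1)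
  have hl : (q : K) * l = ((q ^ (lo + 1) : Kˣ) : K) := by
    simp only [l]
    rw [← Units.val_mul, zpow_add_one, mul_comm]
  refine aeval_eq_zero_of_sub_mul_aeval_eq_zero (zpowProd_eval_eq_zero (lo + 1) n) ?_ hm hh1 hh2
  refine sub_mul_aeval_shear hp hpA hc hc' (a' := (evalZero K).mapMatrix A') ?_ ?_
  · change _ = _ + c + A₀ * (1 - p)
    rw [hA', ← hl, mul_smul, ← hAp]
  · change aeval A₀ g * (1 - p) = 0
    rw [mul_sub, mul_one, hgp, sub_self]

/-- Shears reduce the number of possible exponents to one. Then A(0) is the scalar q^lo, and the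
gauge x^(-lo) normalises it to 1. -/
theorem exists_gauge_evalZero_eq_one (n : ℕ) {A : Matrix ι ι (regularAtZero K)}
    (hA : NearlyIntegral k (coeMatrix A)) {lo : ℤ}
    (h : aeval ((evalZero K).mapMatrix A) (zpowProd (qUnit k K) lo n) = 0) :
    ∃ (A' : Matrix ι ι (regularAtZero K)) (G H : Matrix ι ι (RatFunc K)),
      G * coeMatrix A' = coeMatrix A * (sigma (qUnit k K)).mapMatrix G ∧ H * G = 1 ∧
      (evalZero K).mapMatrix A' = 1 := by
  set q := qUnit k K
  induction n generalizing A lo with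
  | zero =>
    have h1 : (1 : Matrix ι ι K) = 0 := by simpa [zpowProd] using h
    have : Subsingleton (Matrix ι ι K) := subsingleton_of_zero_eq_one h1.symm
    exact ⟨A, 1, 1, by simp, by simp, Subsingleton.elim _ _⟩
  | succ n ih =>
    cases n with
    | zero =>
      have h1 : (evalZero K).mapMatrix A = ((q ^ lo : Kˣ) : K) • 1 := by
        rw [zpowProd, Finset.prod_range_one, map_sub, aeval_X, aeval_C, sub_eq_zero,
          Algebra.algebraMap_eq_smul_one] at h
        simpa using h
      have hX : ∀ m : ℤ, sigma q (RatFunc.X ^ m) = RatFunc.C ((q ^ m : Kˣ) : K) * RatFunc.X ^ m :=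
        fun m => by rw [map_zpow₀, sigma_X, mul_zpow, ← map_zpow₀, Units.val_zpow_eq_zpow_val]
      refine ⟨constRegular K ((q ^ (-lo) : Kˣ) : K) • A, (RatFunc.X ^ (-lo) : RatFunc K) • 1,
        (RatFunc.X ^ lo : RatFunc K) • 1, ?_, ?_, ?_⟩
      · rw [coeMatrix, mapMatrix_smul', mapMatrix_smul', map_one, hX, smul_mul_assoc, one_mul,
          mul_smul_comm (_ * _ : RatFunc K) (coeMatrix A), mul_one, smul_smul, mul_comm]
        rfl
      · rw [smul_mul_smul_comm, one_mul, ← zpow_add₀ RatFunc.X_ne_zero, add_neg_cancel, zpow_zero,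
          one_smul]
      · rw [mapMatrix_smul', h1, evalZero_constRegular, smul_smul, ← Units.val_mul, ← zpow_add,
          neg_add_cancel, zpow_zero, Units.val_one, one_smul]
    | succ n =>
      obtain ⟨A₁, G₁, H₁, hG₁, hH₁, hA₁⟩ := exists_gauge_lower hA h
      obtain ⟨A₂, G₂, H₂, hG₂, hH₂, hA₂⟩ := ih (hA.gauge hG₁ hH₁) hA₁
      refine ⟨A₂, G₁ * G₂, H₂ * H₁, ?_, ?_, hA₂⟩
      · rw [mul_assoc, hG₂, ← mul_assoc, hG₁, map_mul, mul_assoc]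
      · rw [mul_assoc, ← mul_assoc H₁, hH₁, one_mul, hH₂]

end Normalisation

/-! ### Power series solutions at the origin. -/

section Solutions

open Filter

variable {K : Type*} [Field K] {ι : Type*} [Fintype ι] [DecidableEq ι]

/-- Coefficients of the solution of `U(qx) = U(x) A(x)`, `U(0) = 1`, where `A = ∑ a n x ^ n` and
`a 0 = 1`. -/
def solutionCoeff (q : K) (a : ℕ → Matrix ι ι K) : ℕ → Matrix ι ι K
  | 0 => 1
  | n + 1 => (q ^ (n + 1) - 1)⁻¹ • ∑ i : Fin (n + 1), solutionCoeff q a i * a (n + 1 - i)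

theorem exists_powerSeries_solution {q : K} (hq : ∀ n, n ≠ 0 → q ^ n ≠ 1)
    (A : Matrix ι ι (PowerSeries K)) (hA : PowerSeries.constantCoeff.mapMatrix A = 1) :
    ∃ U : Matrix ι ι (PowerSeries K), PowerSeries.constantCoeff.mapMatrix U = 1 ∧
      (PowerSeries.rescale q).mapMatrix U = U * A := by
  let a : ℕ → Matrix ι ι K := fun n => Matrix.of fun i j => PowerSeries.coeff n (A i j)
  have ha : a 0 = 1 := by
    rw [← hA]
    ext i j
    simp [a, PowerSeries.coeff_zero_eq_constantCoeff_apply]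
  refine ⟨Matrix.of fun i j => PowerSeries.mk fun n => solutionCoeff q a n i j, ?_, ?_⟩
  · ext i j
    rw [RingHom.mapMatrix_apply, Matrix.map_apply, ← PowerSeries.coeff_zero_eq_constantCoeff_apply,
      Matrix.of_apply, PowerSeries.coeff_mk, solutionCoeff]
  · ext i j n
    rw [RingHom.mapMatrix_apply, Matrix.map_apply, PowerSeries.coeff_rescale, Matrix.mul_apply, map_sum]
    simp only [Matrix.of_apply, PowerSeries.coeff_mul, PowerSeries.coeff_mk]
    rw [Finset.sum_comm]
    have h1 : ∀ p : ℕ × ℕ, ∑ l, solutionCoeff q a p.1 i l * PowerSeries.coeff p.2 (A l j) =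
        (solutionCoeff q a p.1 * a p.2) i j := fun p => by rw [Matrix.mul_apply]; rfl
    simp only [h1]
    rw [Finset.Nat.sum_antidiagonal_eq_sum_range_succ_mk, Finset.sum_range_succ, Nat.sub_self, ha,
      mul_one]
    cases n with
    | zero => simp
    | succ n =>
      have h2 : q ^ (n + 1) - 1 ≠ 0 := sub_ne_zero.2 (hq _ n.succ_ne_zero)
      have h3 : (q ^ (n + 1) - 1) • solutionCoeff q a (n + 1) =
          ∑ i : Fin (n + 1), solutionCoeff q a i * a (n + 1 - i) := by
        rw [solutionCoeff, smul_smul, mul_inv_cancel₀ h2, one_smul]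
      have h4 := congrFun (congrFun h3 i) j
      rw [Fin.sum_univ_eq_sum_range fun i => solutionCoeff q a i * a (n + 1 - i), Matrix.smul_apply,
        Matrix.sum_apply, smul_eq_mul] at h4
      linear_combination h4

/-- The iterates of `Δ` applied to the identity, when `A(0) = 1`, are regular at the origin. -/
theorem exists_Delta_iterate_one {q : Kˣ} (hq1 : (q : K) - 1 ≠ 0) (A : Matrix ι ι (regularAtZero K))
    (hA : (evalZero K).mapMatrix A = 1) (n : ℕ) :
    ∃ T : Matrix ι ι (regularAtZero K),
      coeMatrix T = (Delta q (matOp q (coeMatrix A)))^[n] 1 ∧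
      (∀ U : Matrix ι ι (PowerSeries K), (PowerSeries.rescale (q : K)).mapMatrix U =
          U * (expand K).mapMatrix A → ∀ i j m,
        (∏ l ∈ Finset.range n, ((q : K) ^ (m + l + 1) - 1)) * PowerSeries.coeff (m + n) (U i j) =
          ((q : K) - 1) ^ n * PowerSeries.coeff m ((U * (expand K).mapMatrix T) i j)) ∧
      ∀ V : ValuationSubring K, (q : K) ∈ V → ((q : K) - 1)⁻¹ ∈ V →
        (∀ i j, (A i j : RatFunc K) ∈ regularRing V.toSubring) →
        ∀ i j, (T i j : RatFunc K) ∈ regularRing V.toSubring := by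
  induction n with
  | zero =>
    refine ⟨1, by rw [coeMatrix, map_one]; rfl, fun U _ i j m => ?_, fun V _ _ _ i j => ?_⟩
    · rw [map_one, mul_one]; simp
    · rw [Matrix.one_apply]; split_ifs
      exacts [one_mem _, zero_mem _]
  | succ n ih =>
    obtain ⟨T, hT1, hT2, hT3⟩ := ih
    obtain ⟨N, hN⟩ : ∃ N, N = A * (sigmaRegular q).mapMatrix T - T := ⟨_, rfl⟩
    -- This is where A(0) = 1 enters: A(x) T(qx) - T(x) vanishes at 0, so the division by x in Δ
    -- preserves regularity.
    have hN0 : (evalZero K).mapMatrix N = 0 := by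
      have h1 : (evalZero K).mapMatrix ((sigmaRegular q).mapMatrix T) = (evalZero K).mapMatrix T :=
        Matrix.ext fun i j => evalZero_sigmaRegular _ _
      rw [hN, map_sub, map_mul, hA, h1, one_mul, sub_self]
    obtain ⟨N', hN'⟩ := exists_xRegular_smul_eq hN0
    have hN'' : ∀ i j, (N' i j : RatFunc K) = RatFunc.X⁻¹ * (N i j : RatFunc K) := fun i j => by
      have h1 : (RatFunc.X : RatFunc K) * (N' i j : RatFunc K) = (N i j : RatFunc K) :=
        congrArg Subtype.val (congrFun (congrFun hN' i) j)
      rw [← h1, inv_mul_cancel_left₀ RatFunc.X_ne_zero]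
    refine ⟨constRegular K ((q : K) - 1)⁻¹ • N', ?_, fun U hU i j m => ?_, fun V hq hq' hAV i j => ?_⟩
    · rw [Function.iterate_succ_apply', ← hT1, Delta, coeMatrix, mapMatrix_smul', mul_inv, mul_smul]
      congr 1
      · exact map_inv₀ (RatFunc.C (K := K)) _
      · refine Matrix.ext fun i j => (hN'' i j).trans ?_
        have : coeMatrix N = matOp q (coeMatrix A) (coeMatrix T) - coeMatrix T := by
          rw [coeMatrix, hN, map_sub, map_mul, matOp]; rfl
        rw [← this]; rfl
    · have h1 := hT2 U hU i j (m + 1)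
      have h2 : expand K (xRegular K) = PowerSeries.X := by
        refine expandFun_eq (a := X) (b := 1) (by simp) (by simp [xRegular]) (by simp)
      have h3 : (expand K).mapMatrix (constRegular K ((q : K) - 1)⁻¹ • N') =
          PowerSeries.C ((q : K) - 1)⁻¹ • (expand K).mapMatrix N' := by
        rw [mapMatrix_smul']
        congr 1
        exact expandFun_eq (a := C ((q : K) - 1)⁻¹) (b := 1) (by simp)
          (by simp [constRegular, RatFunc.algebraMap_C]) (by simp)
      -- Since U(qx) = U(x) A(x), multiplication by U turns Δ into the plain q-derivation. The
      -- coefficients of U Δ^n(1) are therefore those of the n-th q-derivative of U.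
      have h4 : (PowerSeries.X : PowerSeries K) • (U * (expand K).mapMatrix N') =
          (PowerSeries.rescale (q : K)).mapMatrix (U * (expand K).mapMatrix T) -
            U * (expand K).mapMatrix T := by
        have h5 : (expand K).mapMatrix ((sigmaRegular q).mapMatrix T) =
            (PowerSeries.rescale (q : K)).mapMatrix ((expand K).mapMatrix T) :=
          Matrix.ext fun i j => expand_sigmaRegular _ _
        rw [map_mul, hU, mul_assoc, ← h5, ← map_mul, ← mul_sub, ← map_sub, ← hN, ← hN', mapMatrix_smul', h2,
          mul_smul_comm]
      have h6 := congrArg (PowerSeries.coeff (m + 1)) (congrFun (congrFun h4 i) j)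
      rw [Matrix.smul_apply, smul_eq_mul, PowerSeries.coeff_succ_X_mul, Matrix.sub_apply, map_sub,
        RingHom.mapMatrix_apply (PowerSeries.rescale (q : K)), Matrix.map_apply, PowerSeries.coeff_rescale] at h6
      rw [h3, mul_smul_comm, Matrix.smul_apply, smul_eq_mul, PowerSeries.coeff_C_mul, h6,
        Finset.prod_range_succ']
      have h7 : ∀ l, m + (l + 1) + 1 = m + 1 + l + 1 := fun l => by ring
      simp only [h7, add_zero]
      rw [show m + (n + 1) = m + 1 + n by ring, pow_succ ((q : K) - 1),
        mul_assoc (((q : K) - 1) ^ n), mul_inv_cancel_left₀ hq1]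
      linear_combination ((q : K) ^ (m + 1) - 1) * h1
    · refine mul_mem (C_mem_regularRing hq') ?_
      rw [hN'']
      refine X_inv_mul_mem_regularRing ?_ (congrFun (congrFun hN0 i) j)
      have h3 := hT3 V hq hq' hAV
      rw [hN, Matrix.sub_apply, Matrix.mul_apply, AddSubgroupClass.coe_sub, AddSubmonoidClass.coe_finsetSum]
      exact sub_mem (sum_mem fun l _ => mul_mem (hAV _ _) (sigma_mem_regularRing q hq (h3 _ _))) (h3 _ _)

theorem exists_common_denom (A : Matrix ι ι (regularAtZero K)) :
    ∃ (p : K[X]) (B : Matrix ι ι K[X]), p.coeff 0 = 1 ∧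
      (p : PowerSeries K) • (expand K).mapMatrix A = (coeToPowerSeries.ringHom (R := K)).mapMatrix B ∧
      algebraMap K[X] (RatFunc K) p • coeMatrix A = (algebraMap K[X] (RatFunc K)).mapMatrix B := by
  choose a b hb hab using fun ij : ι × ι => mem_regularAtZero.1 (A ij.1 ij.2).2
  refine ⟨∏ ij, b ij, Matrix.of fun i j => (∏ ij ∈ Finset.univ.erase (i, j), b ij) * a (i, j), ?_, ?_, ?_⟩
  · rw [coeff_zero_eq_eval_zero, eval_prod]
    exact Finset.prod_eq_one fun ij _ => by rw [← coeff_zero_eq_eval_zero, hb]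
  · refine Matrix.ext fun i j => ?_
    have h1 := mul_expand (A i j) (hb (i, j)) (hab (i, j))
    rw [Matrix.smul_apply, smul_eq_mul, RingHom.mapMatrix_apply, RingHom.mapMatrix_apply,
      Matrix.map_apply, Matrix.map_apply, Matrix.of_apply, coeToPowerSeries.ringHom_apply, coe_mul,
      ← h1, ← Finset.prod_erase_mul _ _ (Finset.mem_univ (i, j)), coe_mul, mul_assoc]
  · refine Matrix.ext fun i j => ?_
    have h1 : algebraMap K[X] (RatFunc K) (b (i, j)) * (A i j : RatFunc K) =
        algebraMap K[X] (RatFunc K) (a (i, j)) := by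
      have h2 := hab (i, j)
      rw [h2, mul_div_cancel₀ _ (algebraMap_ne_zero_of_coeff_zero (hb _))]
    rw [Matrix.smul_apply, smul_eq_mul, RingHom.mapMatrix_apply (algebraMap K[X] (RatFunc K)),
      Matrix.map_apply, Matrix.of_apply, map_mul,
      ← h1, ← Finset.prod_erase_mul _ _ (Finset.mem_univ (i, j)), map_mul, mul_assoc]
    rfl

end Solutions

/-! ### Rational solutions of systems regular at the origin. -/

section RationalSolutions

open Filter

variable {k K : Type*} [Field k] [Field K] [Algebra k[X] K] [Algebra (RatFunc k) K]
  [IsScalarTower k[X] (RatFunc k) K] [FiniteDimensional (RatFunc k) K]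
  {ι : Type*} [Fintype ι] [DecidableEq ι]

/-- The n-th coefficient of the normalised solution U of U(qx) = U(x) A(x) is the value at 0 of
Δ^n(1)/[n]_q^!, hence integral at almost all places. So U is rational, and F = U⁻¹ satisfies A(x)
F(qx) = F(x). -/
theorem exists_fixed_of_evalZero_eq_one {A : Matrix ι ι (regularAtZero K)}
    (hA : NearlyIntegral k (coeMatrix A)) (hA0 : (evalZero K).mapMatrix A = 1) :
    ∃ F H : Matrix ι ι (RatFunc K), H * F = 1 ∧
      coeMatrix A * (sigma (qUnit k K)).mapMatrix F = F := by
  set q := qUnit k K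
  have hq : ∀ n, n ≠ 0 → (q : K) ^ n ≠ 1 := qUnit_pow_ne_one
  obtain ⟨U, hU0, hU⟩ := exists_powerSeries_solution hq ((expand K).mapMatrix A)
    (Matrix.ext fun i j => congrFun (congrFun hA0 i) j)
  have hint : ∀ᶠ v : CyclotomicPlace k K in cofinite, ∀ i j n,
      PowerSeries.coeff n (U i j) ∈ v.ring := by
    filter_upwards [hA, eventually_matrix_mem_regularRing A] with v h1 h2 i j n
    obtain ⟨T, hT1, hT2, hT3⟩ := exists_Delta_iterate_one (q := q) (qUnit_sub_one_ne_zero (k := k)) A hA0 n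
    have h3 := h1 n 1 (fun i j => by
      rw [Matrix.one_apply]; split_ifs
      exacts [one_mem _, zero_mem _]) i j
    rw [divDelta, ← hT1, Matrix.smul_apply, smul_eq_mul, ← map_inv₀] at h3
    have h4 := evalZero_mul_mem v.ring
      (hT3 v.ring v.qUnit_mem v.qUnit_sub_one_inv_mem h2 i j) h3
    have h5 := hT2 U hU i j 0
    have h6 : PowerSeries.coeff 0 ((U * (expand K).mapMatrix T) i j) = evalZero K (T i j) := by
      have h7 : PowerSeries.constantCoeff.mapMatrix (U * (expand K).mapMatrix T) =
          (evalZero K).mapMatrix T := by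
        rw [map_mul, hU0, one_mul]; rfl
      rw [PowerSeries.coeff_zero_eq_constantCoeff_apply]
      exact congrFun (congrFun h7 i) j
    rw [h6, zero_add] at h5
    have h8 : ∏ l ∈ Finset.range n, ((q : K) ^ (l + 1) - 1) ≠ 0 :=
      Finset.prod_ne_zero_iff.2 fun l _ => sub_ne_zero.2 (hq _ l.succ_ne_zero)
    have h9 : PowerSeries.coeff n (U i j) = (qFactorial (q : K) n)⁻¹ * evalZero K (T i j) := by
      have h10 : (q : K) - 1 ≠ 0 := qUnit_sub_one_ne_zero (k := k)
      simp only [zero_add] at h5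
      rw [qFactorial_eq, mul_inv, inv_pow, inv_inv, mul_assoc, ← h5, inv_mul_cancel_left₀ h8]
    rw [h9]
    exact h4
  obtain ⟨p, B, hp, hpA, hpA'⟩ := exists_common_denom A
  have hpU : (p : PowerSeries K) • (PowerSeries.rescale (q : K)).mapMatrix U =
      U * (coeToPowerSeries.ringHom (R := K)).mapMatrix B := by
    rw [hU, ← mul_smul_comm, hpA]
  have hB0 : ∀ i j, (B i j).coeff 0 = (1 : Matrix ι ι K) i j := fun i j => by
    have h1 := congrArg PowerSeries.constantCoeff.mapMatrix hpA
    rw [mapMatrix_smul'] at h1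
    have h2 : PowerSeries.constantCoeff.mapMatrix ((expand K).mapMatrix A) = 1 := hA0
    rw [h2] at h1
    have h3 := congrFun (congrFun h1 i) j
    simpa [hp] using h3.symm
  obtain ⟨Q, P, hQ, hP, hQP⟩ := exists_rational_polynomial (k := k) hp hB0
    (fun i j => by
      rw [PowerSeries.coeff_zero_eq_constantCoeff_apply]
      exact congrFun (congrFun hU0 i) j) (fun i j => by
      have := congrFun (congrFun hpU i) j
      rw [Matrix.mul_apply] at this
      exact this) hint
  have hE : (p * Q) • (polySigma q).mapMatrix P = polySigma q Q • (P * B) :=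
    smul_mapMatrix_polySigma hQP hpU
  have hinj : Function.Injective (algebraMap K[X] (RatFunc K)) := IsFractionRing.injective _ _
  let W := (algebraMap K[X] (RatFunc K) Q)⁻¹ • (algebraMap K[X] (RatFunc K)).mapMatrix P
  have hQ' : algebraMap K[X] (RatFunc K) Q ≠ 0 := by rwa [Ne, map_eq_zero_iff _ hinj]
  have hp' : algebraMap K[X] (RatFunc K) p ≠ 0 := algebraMap_ne_zero_of_coeff_zero hp
  have hW : IsUnit W := by
    rw [Matrix.isUnit_iff_isUnit_det, Matrix.det_smul, ← RingHom.map_det, isUnit_iff_ne_zero]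
    refine mul_ne_zero (pow_ne_zero _ (inv_ne_zero hQ')) ?_
    rwa [Ne, map_eq_zero_iff _ hinj]
  have hWA : (sigma q).mapMatrix W = W * coeMatrix A := by
    have hσP : (sigma q).mapMatrix ((algebraMap K[X] (RatFunc K)).mapMatrix P) =
        (algebraMap K[X] (RatFunc K)).mapMatrix ((polySigma q).mapMatrix P) :=
      Matrix.ext fun i j => sigma_algebraMap _ _
    have hσQ : sigma q (algebraMap K[X] (RatFunc K) Q) ≠ 0 := by
      rwa [Ne, map_eq_zero_iff _ (sigma q).injective]
    have h1 := congrArg (algebraMap K[X] (RatFunc K)).mapMatrix hE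
    rw [mapMatrix_smul', mapMatrix_smul', map_mul, map_mul, ← hpA', ← hσP, ← sigma_algebraMap,
      mul_smul_comm] at h1
    rw [mapMatrix_smul', map_inv₀, smul_mul_assoc, inv_smul_eq_iff₀ hσQ, smul_comm,
      eq_inv_smul_iff₀ hQ']
    refine smul_right_injective _ hp' ?_
    simp only
    rw [smul_smul, h1, smul_comm]
  obtain ⟨u, hu⟩ := hW
  refine ⟨(u⁻¹ : (Matrix ι ι (RatFunc K))ˣ), u, by simp, ?_⟩
  have h1 : (sigma q).mapMatrix W * (sigma q).mapMatrix ((u⁻¹ : (Matrix ι ι (RatFunc K))ˣ) :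
      Matrix ι ι (RatFunc K)) = 1 := by
    rw [← map_mul, ← hu, Units.mul_inv, map_one]
  rw [hWA, mul_assoc, ← hu, ← Units.eq_inv_mul_iff_mul_eq, mul_one] at h1
  exact h1

/-- A `q`-difference system without poles at the origin which is nearly integral has a basis of
rational solutions. -/
theorem exists_fixed_of_regular {A : Matrix ι ι (regularAtZero K)}
    (hA : NearlyIntegral k (coeMatrix A)) :
    ∃ F H : Matrix ι ι (RatFunc K), H * F = 1 ∧
      coeMatrix A * (sigma (qUnit k K)).mapMatrix F = F := by
  obtain ⟨lo, n, h⟩ := exists_aeval_zpowProd_eq_zero hA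
  obtain ⟨A', G, H, hG, hH, hA'⟩ := exists_gauge_evalZero_eq_one n hA h
  obtain ⟨F', H', hF', hAF⟩ := exists_fixed_of_evalZero_eq_one (hA.gauge hG hH) hA'
  refine ⟨G * F', H' * H, ?_, ?_⟩
  · rw [mul_assoc, ← mul_assoc H, hH, one_mul, hF']
  · rw [map_mul, ← mul_assoc, ← hG, mul_assoc, hAF]

end RationalSolutions

/-! ### Stable lattices at the origin and Nakayama's lemma. -/

section RegularRelation

variable {F : Type*} [Field F]

theorem isUnit_of_evalZero_ne_zero {f : regularAtZero F} (hf : evalZero F f ≠ 0) : IsUnit f := by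
  obtain ⟨a, b, hb, hab⟩ := mem_regularAtZero.1 f.2
  rw [evalZero_eq f hb hab] at hf
  refine IsUnit.of_mul_eq_one ⟨_, mem_regularAtZero_of_coeff_ne_zero (a := b) hf⟩ (Subtype.ext ?_)
  change (f : RatFunc F) * (_ / _) = 1
  have ha : algebraMap F[X] (RatFunc F) a ≠ 0 := by
    rw [Ne, map_eq_zero_iff _ (IsFractionRing.injective F[X] (RatFunc F))]
    rintro rfl
    simp at hf
  rw [hab, div_mul_div_comm, mul_comm, div_self (mul_ne_zero (algebraMap_ne_zero_of_coeff_zero hb) ha)]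

theorem exists_xRegular_mul_eq {f : regularAtZero F} (hf : evalZero F f = 0) :
    ∃ g, xRegular F * g = f :=
  ⟨⟨_, X_inv_mul_mem_regularRing f.2 hf⟩,
    Subtype.ext (mul_inv_cancel_left₀ (RatFunc.X_ne_zero (K := F)) _)⟩

theorem span_xRegular_le_jacobson :
    Ideal.span {xRegular F} ≤ Ideal.jacobson (⊥ : Ideal (regularAtZero F)) := by
  rw [Ideal.span_singleton_le_iff_mem, Ideal.mem_jacobson_bot]
  intro y
  apply isUnit_of_evalZero_ne_zero
  simp [evalZero_xRegular]

theorem exists_X_pow_mul_mem (f : RatFunc F) : ∃ t : ℕ, RatFunc.X ^ t * f ∈ regularAtZero F := by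
  obtain ⟨b, hb, hb'⟩ := exists_eq_pow_rootMultiplicity_mul_and_not_dvd f.denom f.denom_ne_zero 0
  rw [map_zero, sub_zero] at hb hb'
  refine ⟨f.denom.rootMultiplicity 0, ?_⟩
  have h1 : f = algebraMap F[X] (RatFunc F) f.num /
      algebraMap F[X] (RatFunc F) (X ^ f.denom.rootMultiplicity 0 * b) := by
    rw [← hb, RatFunc.num_div_denom]
  generalize f.denom.rootMultiplicity 0 = t at h1
  rw [h1, map_mul, map_pow, RatFunc.algebraMap_X, mul_div_assoc', mul_div_mul_left]
  · refine mem_regularAtZero_of_coeff_ne_zero fun h => hb' (X_dvd_iff.2 h)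
  · exact pow_ne_zero _ RatFunc.X_ne_zero

theorem X_pow_mul_mem_of_le {f : RatFunc F} {t u : ℕ} (htu : t ≤ u)
    (h : RatFunc.X ^ t * f ∈ regularAtZero F) : RatFunc.X ^ u * f ∈ regularAtZero F := by
  obtain ⟨c, rfl⟩ := Nat.exists_eq_add_of_le' htu
  rw [pow_add, mul_assoc]
  exact mul_mem (pow_mem (xRegular F).2 c) h

/-- Common denominators at the origin. -/
theorem exists_scaling {s : ℕ} {a : ℕ → RatFunc F} (ha : ∃ i < s, a i ∉ regularAtZero F) :
    ∃ (t : ℕ) (c : ℕ → regularAtZero F) (j : ℕ), t ≠ 0 ∧ j < s ∧ evalZero F (c j) ≠ 0 ∧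
      (∀ i, j < i → i < s → evalZero F (c i) = 0) ∧
      ∀ i < s, (c i : RatFunc F) = RatFunc.X ^ t * a i := by
  classical
  have hex : ∃ t, ∀ i < s, RatFunc.X ^ t * a i ∈ regularAtZero F := by
    choose t ht using fun i => exists_X_pow_mul_mem (a i)
    exact ⟨(Finset.range s).sup t, fun i hi =>
      X_pow_mul_mem_of_le (Finset.le_sup (Finset.mem_range.2 hi)) (ht i)⟩
  -- By minimality of t some scaled coefficient is a unit at the origin, as otherwise one factor x
  -- could be removed from all of them. The index j is the largest with this property.
  obtain ⟨t, ht, hmin⟩ : ∃ t, (∀ i < s, RatFunc.X ^ t * a i ∈ regularAtZero F) ∧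
      ∀ u < t, ¬ ∀ i < s, RatFunc.X ^ u * a i ∈ regularAtZero F :=
    ⟨Nat.find hex, Nat.find_spec hex, fun u hu => Nat.find_min hex hu⟩
  have ht0 : t ≠ 0 := by
    rintro rfl
    obtain ⟨i, hi, hai⟩ := ha
    have := ht i hi
    rw [pow_zero, one_mul] at this
    exact hai this
  let c : ℕ → regularAtZero F := fun i => if h : i < s then ⟨_, ht i h⟩ else 0
  have hc : ∀ i < s, (c i : RatFunc F) = RatFunc.X ^ t * a i := fun i hi => by
    simp only [c, hi, dif_pos]
  have hne : ((Finset.range s).filter fun i => evalZero F (c i) ≠ 0).Nonempty := by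
    by_contra hemp
    rw [Finset.not_nonempty_iff_eq_empty, Finset.filter_eq_empty_iff] at hemp
    obtain ⟨u, rfl⟩ := Nat.exists_eq_succ_of_ne_zero ht0
    refine hmin u (Nat.lt_succ_self u) fun i hi => ?_
    have h1 := X_inv_mul_mem_regularRing (c i).2 (not_not.1 (hemp (Finset.mem_range.2 hi)))
    rwa [hc i hi, pow_succ', mul_assoc, inv_mul_cancel_left₀ RatFunc.X_ne_zero] at h1
  have hj := Finset.max'_mem _ hne
  have hj' := fun i => Finset.le_max' ((Finset.range s).filter fun i => evalZero F (c i) ≠ 0) i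
  set j := Finset.max' _ hne
  rw [Finset.mem_filter, Finset.mem_range] at hj
  refine ⟨t, c, j, ht0, hj.1, hj.2, fun i hji his => ?_, hc⟩
  by_contra h
  exact absurd (hj' i (Finset.mem_filter.2 ⟨Finset.mem_range.2 his, h⟩)) (not_le.2 hji)

variable {N : Type*} [AddCommGroup N] [Module (RatFunc F) N]

/-- If a vector `e` generates a lattice over the regular functions which is stable under the operator
`S`, then the minimal relation between the iterates `S ^ i e` has regular coefficients. -/
theorem regular_of_relation (q : Fˣ) (S : N →+ N) (hS : ∀ f m, S (f • m) = sigma q f • S m) {e : N}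
    {s : ℕ} (hind : LinearIndependent (RatFunc F) fun i : Fin s => S^[(i : ℕ)] e)
    {a : ℕ → RatFunc F} (hrel : S^[s] e = ∑ i ∈ Finset.range s, a i • S^[i] e)
    {T : ℕ → N} (hT0 : T 0 = e) (hT : ∀ n, T (n + 1) = S (T n) - RatFunc.C ((q : F) ^ n) • T n)
    {κ : ℕ} (hκ : T κ = 0) : ∀ i < s, a i ∈ regularAtZero F := by
  by_contra! hcon
  obtain ⟨t, c, j, ht, hjs, hj, hj', hc⟩ := exists_scaling hcon
  have hS' : ∀ (f : regularAtZero F) m, S (f • m) = sigmaRegular q f • S m := fun f m => hS f m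
  have hC : ∀ n (m : N), RatFunc.C ((q : F) ^ n) • m = constRegular F ((q : F) ^ n) • m :=
    fun _ _ => rfl
  -- L is stable under S because T κ = 0. The target is L ≤ Lj, which puts S^j e in the span of the
  -- earlier iterates.
  let L : Submodule (regularAtZero F) N := Submodule.span _ (T '' Set.Iio κ)
  let Lj : Submodule (regularAtZero F) N := Submodule.span _ ((fun i => S^[i] e) '' Set.Iio j)
  let D := Lj ⊔ Ideal.span {xRegular F} • L
  have hL : ∀ m ∈ L, S m ∈ L := fun m hm => by
    induction hm using Submodule.span_induction with
    | mem m hm =>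
      obtain ⟨i, hi, rfl⟩ := hm
      have h1 : S (T i) = T (i + 1) + RatFunc.C ((q : F) ^ i) • T i := by rw [hT]; abel
      rw [h1, hC]
      refine add_mem ?_ (Submodule.smul_mem _ _ (Submodule.subset_span ⟨i, hi, rfl⟩))
      rcases (Nat.succ_le_iff.2 (Set.mem_Iio.1 hi)).eq_or_lt with h | h
      · rw [show i + 1 = κ from h, hκ]; exact zero_mem _
      · exact Submodule.subset_span ⟨_, h, rfl⟩
    | zero => rw [map_zero]; exact zero_mem _
    | add m n _ _ hm hn => rw [map_add]; exact add_mem hm hn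
    | smul f m _ hm => rw [hS']; exact Submodule.smul_mem _ _ hm
  have heL : ∀ n, S^[n] e ∈ L := fun n => by
    induction n with
    | zero =>
      rw [Function.iterate_zero_apply, ← hT0]
      rcases Nat.eq_zero_or_pos κ with h | h
      · rw [← h, hκ]; exact zero_mem _
      · exact Submodule.subset_span ⟨0, h, rfl⟩
    | succ n ih => rw [Function.iterate_succ_apply']; exact hL _ ih
  have hxD : ∀ m ∈ L, xRegular F • m ∈ D := fun m hm =>
    Submodule.mem_sup_right (Submodule.smul_mem_smul (Ideal.mem_span_singleton_self _) hm)
  have hD0 : ∀ (f : regularAtZero F), evalZero F f = 0 → ∀ m ∈ L, f • m ∈ D := fun f hf m hm => by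
    obtain ⟨g, rfl⟩ := exists_xRegular_mul_eq hf
    rw [mul_smul]
    exact hxD _ (Submodule.smul_mem _ _ hm)
  -- Modulo x L the scaled relation loses its left-hand side, as t > 0, and all terms of index above
  -- j. The coefficient of S^j e is a unit.
  have hjD : S^[j] e ∈ D := by
    have h1 : xRegular F ^ t • S^[s] e = ∑ i ∈ Finset.range s, c i • S^[i] e := by
      have h2 : (RatFunc.X ^ t : RatFunc F) • S^[s] e =
          ∑ i ∈ Finset.range s, (c i : RatFunc F) • S^[i] e := by
        rw [hrel, Finset.smul_sum]
        exact Finset.sum_congr rfl fun i hi => by rw [smul_smul, hc i (Finset.mem_range.1 hi)]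
      exact h2
    rw [← Finset.add_sum_erase _ _ (Finset.mem_range.2 hjs), ← sub_eq_iff_eq_add] at h1
    have h3 : c j • S^[j] e ∈ D := by
      rw [← h1]
      refine sub_mem (hD0 _ ?_ _ (heL s)) (sum_mem fun i hi => ?_)
      · rw [map_pow, evalZero_xRegular, zero_pow ht]
      · rw [Finset.mem_erase, Finset.mem_range] at hi
        rcases lt_or_gt_of_ne hi.1 with h | h
        · exact Submodule.smul_mem _ _ (Submodule.mem_sup_left (Submodule.subset_span ⟨i, h, rfl⟩))
        · exact hD0 _ (hj' i h hi.2) _ (heL i)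
    obtain ⟨u, hu⟩ := isUnit_of_evalZero_ne_zero hj
    rw [← hu] at h3
    have h4 := Submodule.smul_mem D (u⁻¹ : (regularAtZero F)ˣ).1 h3
    rwa [smul_smul, Units.inv_mul, one_smul] at h4
  have hD : ∀ m ∈ D, S m ∈ D := fun m hm => by
    obtain ⟨m₁, h1, m₂, h2, rfl⟩ := Submodule.mem_sup.1 hm
    rw [map_add]
    refine add_mem ?_ ?_
    · clear hm
      induction h1 using Submodule.span_induction with
      | mem m hm =>
        obtain ⟨i, hi, rfl⟩ := hm
        simp only
        rw [← Function.iterate_succ_apply' S i e]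
        rcases (Nat.succ_le_iff.2 (Set.mem_Iio.1 hi)).eq_or_lt with h | h
        · rw [h]; exact hjD
        · exact Submodule.mem_sup_left (Submodule.subset_span ⟨_, h, rfl⟩)
      | zero => rw [map_zero]; exact zero_mem _
      | add m n _ _ hm hn => rw [map_add]; exact add_mem hm hn
      | smul f m _ hm => rw [hS']; exact Submodule.smul_mem _ _ hm
    · rw [Submodule.ideal_span_singleton_smul] at h2
      obtain ⟨y, hy, rfl⟩ := h2
      change S (xRegular F • y) ∈ D
      rw [hS']
      exact hD0 _ (by rw [evalZero_sigmaRegular, evalZero_xRegular]) _ (hL y hy)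
  have hTD : ∀ n, T n ∈ D := fun n => by
    induction n with
    | zero =>
      rw [hT0]
      rcases Nat.eq_zero_or_pos j with h | h
      · rw [h] at hjD; exact hjD
      · exact Submodule.mem_sup_left (Submodule.subset_span ⟨0, h, rfl⟩)
    | succ n ih =>
      rw [hT, hC]
      exact sub_mem (hD _ ih) (Submodule.smul_mem _ _ ih)
  -- D is stable under S and contains e, so it contains every T n. Thus L ≤ Lj + x L, and Nakayama's
  -- lemma removes x L because L is finitely generated.
  have hLj : L ≤ Lj := by
    refine Submodule.le_of_le_smul_of_le_jacobson_bot
      (Submodule.fg_span ((Set.finite_Iio κ).image T)) span_xRegular_le_jacobson ?_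
    refine Submodule.span_le.2 ?_
    rintro _ ⟨i, _, rfl⟩
    exact hTD i
  have hmem : S^[j] e ∈ Submodule.span (RatFunc F)
      ((fun i : Fin s => S^[(i : ℕ)] e) '' {i | (i : ℕ) < j}) := by
    have h1 := hLj (heL j)
    generalize S^[j] e = m at h1 ⊢
    induction h1 using Submodule.span_induction with
    | mem m hm =>
      obtain ⟨i, hi, rfl⟩ := hm
      exact Submodule.subset_span ⟨⟨i, (Set.mem_Iio.1 hi).trans hjs⟩, hi, rfl⟩
    | zero => exact zero_mem _
    | add _ _ _ _ hm hn => exact add_mem hm hn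
    | smul f m _ hm => exact Submodule.smul_mem _ (f : RatFunc F) hm
  exact hind.notMem_span_image (s := {i : Fin s | (i : ℕ) < j}) (x := ⟨j, hjs⟩)
    (by simp) hmem

end RegularRelation

/-! ### Reduction of rational functions as a relation. -/

section Reduction

variable {K : Type*} [Field K] {V : ValuationSubring K}

variable (V) in
/-- `f` has Gauss norm at most `1` and its reduction is `g`. -/
def ReducesTo (f : RatFunc K) (g : RatFunc (IsLocalRing.ResidueField V)) : Prop :=
  ∃ h : f ∈ gaussRing V, gaussRed V ⟨f, h⟩ = g

namespace ReducesTo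

variable {f f' : RatFunc K} {g g' : RatFunc (IsLocalRing.ResidueField V)}

theorem of_mem (h : f ∈ gaussRing V) : ReducesTo V f (gaussRed V ⟨f, h⟩) := ⟨h, rfl⟩

/-- Identities over the residue field are obtained by exhibiting both sides as reductions of the
same function. -/
theorem unique (h : ReducesTo V f g) (h' : ReducesTo V f g') : g = g' := by
  obtain ⟨h, rfl⟩ := h
  obtain ⟨h', rfl⟩ := h'
  rfl

theorem zero : ReducesTo V 0 0 := ⟨zero_mem _, map_zero (gaussRed V)⟩

theorem one : ReducesTo V 1 1 := ⟨one_mem _, map_one (gaussRed V)⟩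

theorem add (h : ReducesTo V f g) (h' : ReducesTo V f' g') : ReducesTo V (f + f') (g + g') := by
  obtain ⟨h, rfl⟩ := h
  obtain ⟨h', rfl⟩ := h'
  exact ⟨add_mem h h', map_add (gaussRed V) ⟨f, h⟩ ⟨f', h'⟩⟩

theorem sub (h : ReducesTo V f g) (h' : ReducesTo V f' g') : ReducesTo V (f - f') (g - g') := by
  obtain ⟨h, rfl⟩ := h
  obtain ⟨h', rfl⟩ := h'
  exact ⟨sub_mem h h', map_sub (gaussRed V) ⟨f, h⟩ ⟨f', h'⟩⟩

theorem mul (h : ReducesTo V f g) (h' : ReducesTo V f' g') : ReducesTo V (f * f') (g * g') := by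
  obtain ⟨h, rfl⟩ := h
  obtain ⟨h', rfl⟩ := h'
  exact ⟨mul_mem h h', map_mul (gaussRed V) ⟨f, h⟩ ⟨f', h'⟩⟩

theorem sum {α : Type*} {s : Finset α} {f : α → RatFunc K}
    {g : α → RatFunc (IsLocalRing.ResidueField V)} (h : ∀ i ∈ s, ReducesTo V (f i) (g i)) :
    ReducesTo V (∑ i ∈ s, f i) (∑ i ∈ s, g i) := by
  classical
  induction s using Finset.induction_on with
  | empty => exact zero
  | insert a s ha ih =>
    rw [Finset.sum_insert ha, Finset.sum_insert ha]
    exact (h a (Finset.mem_insert_self _ _)).add (ih fun i hi => h i (Finset.mem_insert_of_mem hi))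

theorem div {a b : V[X]} (hb : polyRed V b ≠ 0) :
    ReducesTo V (polyToRatFunc V a / polyToRatFunc V b) (polyRed V a / polyRed V b) :=
  ⟨⟨a, b, hb, rfl⟩, gaussRedFun_eq _ hb rfl⟩

theorem exists_div (h : ReducesTo V f g) : ∃ a b : V[X], polyRed V b ≠ 0 ∧
    f = polyToRatFunc V a / polyToRatFunc V b ∧ g = polyRed V a / polyRed V b := by
  obtain ⟨⟨a, b, hb, rfl⟩, rfl⟩ := h
  exact ⟨a, b, hb, rfl, gaussRedFun_eq _ hb rfl⟩

theorem poly (a : V[X]) : ReducesTo V (polyToRatFunc V a) (polyRed V a) := by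
  have := div (V := V) (a := a) (b := 1) (by simp)
  rwa [map_one, map_one, div_one, div_one] at this

theorem C (c : V) : ReducesTo V (RatFunc.C (c : K)) (RatFunc.C (IsLocalRing.residue V c)) := by
  have := poly (Polynomial.C c)
  simp only [polyToRatFunc, polyRed, RingHom.comp_apply, coe_mapRingHom, map_C,
    RatFunc.algebraMap_C] at this
  exact this

theorem X : ReducesTo V RatFunc.X RatFunc.X := by
  have := poly (V := V) Polynomial.X
  simp only [polyToRatFunc, polyRed, RingHom.comp_apply, coe_mapRingHom, map_X,
    RatFunc.algebraMap_X] at this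
  exact this

theorem inv (h : ReducesTo V f g) (hg : g ≠ 0) : ReducesTo V f⁻¹ g⁻¹ := by
  obtain ⟨a, b, hb, rfl, rfl⟩ := h.exists_div
  rw [inv_div, inv_div]
  refine div fun ha => hg ?_
  rw [ha, zero_div]

theorem pow (h : ReducesTo V f g) (n : ℕ) : ReducesTo V (f ^ n) (g ^ n) := by
  induction n with
  | zero => rw [pow_zero, pow_zero]; exact one
  | succ n ih => rw [pow_succ, pow_succ]; exact ih.mul h

theorem sigma {q : Kˣ} {q' : (IsLocalRing.ResidueField V)ˣ} {c : V} (hc : (c : K) = q)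
    (hc' : IsLocalRing.residue V c = q') (h : ReducesTo V f g) :
    ReducesTo V (QDiff.sigma q f) (QDiff.sigma q' g) := by
  obtain ⟨a, b, hb, rfl, rfl⟩ := h.exists_div
  let τ : V[X] →+* V[X] := compRingHom (Polynomial.C c * Polynomial.X)
  have h1 : ∀ p : V[X], QDiff.sigma q (polyToRatFunc V p) = polyToRatFunc V (τ p) := fun p => by
    simp only [polyToRatFunc, RingHom.comp_apply, sigma_algebraMap, polySigma, τ, coe_mapRingHom,
      coe_compRingHom_apply, map_comp, Polynomial.map_mul, map_C, map_X]
    rw [← hc]; rfl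
  have h2 : ∀ p : V[X], QDiff.sigma q' (polyRed V p) = polyRed V (τ p) := fun p => by
    simp only [polyRed, RingHom.comp_apply, sigma_algebraMap, polySigma, τ, coe_mapRingHom,
      coe_compRingHom_apply, map_comp, Polynomial.map_mul, map_C, map_X]
    rw [← hc']
  rw [map_div₀, map_div₀, h1, h1, h2, h2]
  refine div ?_
  rw [← h2]
  exact (_root_.map_ne_zero _).2 hb

end ReducesTo

theorem CyclotomicPlace.reducesTo_sigma {k : Type*} [Field k] [Algebra k[X] K]
    [Algebra (RatFunc k) K] [IsScalarTower k[X] (RatFunc k) K] (v : CyclotomicPlace k K)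
    {f : RatFunc K} {g : RatFunc v.resField} (h : ReducesTo v.ring f g) :
    ReducesTo v.ring (sigma (qUnit k K) f) (sigma v.qv g) :=
  h.sigma (c := ⟨_, v.q_mem⟩) rfl rfl

theorem exists_map_eq {a : K[X]} (ha : a ∈ coeffSubring V.toSubring) :
    ∃ a' : V[X], a'.map V.subtype = a := by
  rw [← mem_lifts, lifts_iff_coeff_lifts]
  exact fun i => ⟨⟨_, ha i⟩, rfl⟩

end Reduction

/-! ### Reduction of the operator at a cyclotomic place. -/

section ReducedOperator

variable {k K : Type*} [Field k] [Field K] [Algebra k[X] K] [Algebra (RatFunc k) K]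
  [IsScalarTower k[X] (RatFunc k) K] {ι : Type*} [Fintype ι] [DecidableEq ι]
  (v : CyclotomicPlace k K) {A : Matrix ι ι (RatFunc K)} {A' : Matrix ι ι (RatFunc v.resField)}

theorem reducesTo_one (i j : ι) : ReducesTo v.ring ((1 : Matrix ι ι (RatFunc K)) i j)
    ((1 : Matrix ι ι (RatFunc v.resField)) i j) := by
  rw [Matrix.one_apply, Matrix.one_apply]
  split_ifs
  exacts [ReducesTo.one, ReducesTo.zero]

variable {v}

theorem reducesTo_matOp (hA : ∀ i j, ReducesTo v.ring (A i j) (A' i j))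
    {Y : Matrix ι ι (RatFunc K)} {Y' : Matrix ι ι (RatFunc v.resField)}
    (hY : ∀ i j, ReducesTo v.ring (Y i j) (Y' i j)) (i j : ι) :
    ReducesTo v.ring (matOp (qUnit k K) A Y i j) (matOp v.qv A' Y' i j) := by
  rw [matOp, matOp, Matrix.mul_apply, Matrix.mul_apply]
  exact ReducesTo.sum fun l _ => (hA _ _).mul (v.reducesTo_sigma (hY _ _))

theorem reducesTo_iterate (hA : ∀ i j, ReducesTo v.ring (A i j) (A' i j)) (n : ℕ) (i j : ι) :
    ReducesTo v.ring ((matOp (qUnit k K) A)^[n] 1 i j) ((matOp v.qv A')^[n] 1 i j) := by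
  induction n generalizing i j with
  | zero => exact reducesTo_one v i j
  | succ n ih =>
    rw [Function.iterate_succ_apply', Function.iterate_succ_apply']
    exact reducesTo_matOp hA ih i j

theorem reducesTo_shiftProd (hA : ∀ i j, ReducesTo v.ring (A i j) (A' i j)) (n : ℕ) (i j : ι) :
    ReducesTo v.ring (shiftProd (qUnit k K) (matOp (qUnit k K) A) n 1 i j)
      (shiftProd v.qv (matOp v.qv A') n 1 i j) := by
  induction n generalizing i j with
  | zero => exact reducesTo_one v i j
  | succ n ih =>
    rw [shiftProd, shiftProd, Matrix.sub_apply, Matrix.sub_apply, Matrix.smul_apply,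
      Matrix.smul_apply]
    have h1 : ReducesTo v.ring (RatFunc.C ((qUnit k K : K) ^ n)) (RatFunc.C ((v.qv : v.resField) ^ n)) :=
      by
        rw [map_pow, map_pow]
        exact (ReducesTo.C (V := v.ring) ⟨_, v.q_mem⟩).pow n
    exact (reducesTo_matOp hA ih i j).sub (h1.mul (ih i j))

/-- The product of the q^i - 1 for 1 ≤ i ≤ κ reduces to 0, since q_v has order κ. The quotient of
the shifted product by it is integral, so the shifted product itself reduces to 0. -/
theorem shiftProd_orderOf_eq_zero (hA : ∀ i j, ReducesTo v.ring (A i j) (A' i j))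
    (hint : IntegralAt (qUnit k K) v.ring A) :
    shiftProd v.qv (matOp v.qv A') (orderOf (v.qv : v.resField)) 1 = 0 := by
  set κ := orderOf (v.qv : v.resField)
  refine Matrix.ext fun i j => (reducesTo_shiftProd hA κ i j).unique ?_
  have hq : (qUnit k K : K) - 1 ≠ 0 := qUnit_sub_one_ne_zero (k := k)
  have h1 := hint.shiftProd_mem hq v.qUnit_mem κ (Y := 1) (fun i j => (reducesTo_one v i j).1) i j
  have h2 : ∏ i ∈ Finset.range κ, ((qUnit k K : K) ^ (i + 1) - 1) ≠ 0 :=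
    Finset.prod_ne_zero_iff.2 fun i _ => sub_ne_zero.2 (qUnit_pow_ne_one _ i.succ_ne_zero)
  have h3 := (ReducesTo.C (V := v.ring)
    (∏ i ∈ Finset.range κ, ((⟨_, v.q_mem⟩ : v.ring) ^ (i + 1) - 1))).mul (ReducesTo.of_mem h1)
  have h4 : IsLocalRing.residue v.ring
      (∏ i ∈ Finset.range κ, ((⟨_, v.q_mem⟩ : v.ring) ^ (i + 1) - 1)) = 0 := by
    rw [map_prod]
    have hκ : 1 < κ := v.one_lt_orderOf
    refine Finset.prod_eq_zero (i := κ - 1) (Finset.mem_range.2 (by omega)) ?_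
    rw [Nat.sub_add_cancel hκ.le, map_sub, map_pow, map_one, sub_eq_zero]
    exact pow_orderOf_eq_one (v.qv : v.resField)
  rw [h4, map_zero, zero_mul, ← mul_assoc, ← map_mul] at h3
  have h5 : ((∏ i ∈ Finset.range κ, ((⟨_, v.q_mem⟩ : v.ring) ^ (i + 1) - 1) : v.ring) : K) =
      ∏ i ∈ Finset.range κ, ((qUnit k K : K) ^ (i + 1) - 1) := by
    rw [SubmonoidClass.coe_finsetProd]
    rfl
  rwa [h5, mul_inv_cancel₀ h2, map_one, one_mul] at h3

end ReducedOperator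

/-! ### Poles at the origin under reduction. -/

section Poles

open Filter

variable {k K : Type*} [Field k] [Field K] [Algebra k[X] K] [Algebra (RatFunc k) K]
  [IsScalarTower k[X] (RatFunc k) K]

theorem mem_regularAtZero_or_num_ne_zero {F : Type*} [Field F] (f : RatFunc F) :
    f ∈ regularAtZero F ∨ f.denom.coeff 0 = 0 ∧ f.num.coeff 0 ≠ 0 := by
  by_cases h : f.denom.coeff 0 = 0
  · refine Or.inr ⟨h, fun h' => ?_⟩
    obtain ⟨u, w, huw⟩ := f.isCoprime_num_denom
    have := congrArg (fun p => p.coeff 0) huw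
    simp [mul_coeff_zero, h, h'] at this
  · left
    rw [← RatFunc.num_div_denom f]
    exact mem_regularAtZero_of_coeff_ne_zero h

theorem mem_or_inv_mem_regularAtZero {F : Type*} [Field F] (f : RatFunc F) :
    f ∈ regularAtZero F ∨ f⁻¹ ∈ regularAtZero F := by
  refine (mem_regularAtZero_or_num_ne_zero f).imp_right fun h => ?_
  rw [← RatFunc.num_div_denom f, inv_div]
  exact mem_regularAtZero_of_coeff_ne_zero h.2

/-- At almost all places a pole at the origin is preserved by reduction. -/
theorem eventually_regular_of_reducesTo [FiniteDimensional (RatFunc k) K] (f : RatFunc K) :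
    ∀ᶠ v : CyclotomicPlace k K in cofinite, ∀ g, ReducesTo v.ring f g →
      g ∈ regularAtZero v.resField → f ∈ regularAtZero K := by
  rcases mem_regularAtZero_or_num_ne_zero f with hf | ⟨hd, hn⟩
  · exact Eventually.of_forall fun _ _ _ _ => hf
  filter_upwards [eventually_mem_coeffSubring f.num, eventually_mem_coeffSubring f.denom,
    eventually_mem (f.num.coeff 0)⁻¹] with v h1 h2 h3 g hg hg'
  exfalso
  obtain ⟨n, hn'⟩ := exists_map_eq h1
  obtain ⟨d, hd'⟩ := exists_map_eq h2
  have hfd : f * polyToRatFunc v.ring d = polyToRatFunc v.ring n := by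
    have : f * algebraMap K[X] (RatFunc K) f.denom = algebraMap K[X] (RatFunc K) f.num := by
      nth_rewrite 1 [← RatFunc.num_div_denom f]
      rw [div_mul_cancel₀]
      exact (map_ne_zero_iff _ (IsFractionRing.injective K[X] (RatFunc K))).2 f.denom_ne_zero
    rw [← hn', ← hd'] at this
    exact this
  -- If the reduction were a/b with b(0) = 1, comparing constant terms in a d = n b would give 0 on
  -- the left, since d(0) = 0, and a nonzero element on the right, since n(0) is a unit at v.
  have h4 := (hg.mul (ReducesTo.poly d)).unique (hfd ▸ ReducesTo.poly n)
  obtain ⟨a, b, hb, rfl⟩ := mem_regularAtZero.1 hg'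
  rw [div_mul_eq_mul_div, div_eq_iff (algebraMap_ne_zero_of_coeff_zero hb), polyRed,
    RingHom.comp_apply, RingHom.comp_apply, ← map_mul, ← map_mul] at h4
  have h5 := congrArg (fun p => p.coeff 0) (IsFractionRing.injective _ _ h4)
  simp only [mul_coeff_zero, hb, mul_one, coe_mapRingHom, coeff_map] at h5
  have h6 : d.coeff 0 = 0 := by
    rw [← hd', coeff_map] at hd
    exact Subtype.ext hd
  rw [h6, map_zero, mul_zero] at h5
  have h7 : IsUnit (n.coeff 0) := by
    rw [← hn', coeff_map] at h3 hn
    exact IsUnit.of_mul_eq_one ⟨_, h3⟩ (Subtype.ext (mul_inv_cancel₀ hn))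
  exact (h7.map (IsLocalRing.residue v.ring)).ne_zero h5.symm

end Poles

/-! ### Regularity of the minimal relation between iterates. -/

section MinimalRelation

open Filter

theorem exists_minimal_relation {F N : Type*} [Field F] [AddCommGroup N] [Module F N]
    [FiniteDimensional F N] (u : ℕ → N) : ∃ (s : ℕ) (a : ℕ → F),
      LinearIndependent F (fun i : Fin s => u i) ∧ u s = ∑ i ∈ Finset.range s, a i • u i := by
  classical
  have hex : ∃ s, ¬ LinearIndependent F fun i : Fin s => u i := by
    refine ⟨Module.finrank F N + 1, fun h => ?_⟩
    have := h.fintype_card_le_finrank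
    rw [Fintype.card_fin] at this
    omega
  have h0 : Nat.find hex ≠ 0 := fun h => by
    have := Nat.find_spec hex
    rw [h] at this
    exact this linearIndependent_empty_type
  obtain ⟨s, hs⟩ := Nat.exists_eq_succ_of_ne_zero h0
  have h1 : LinearIndependent F fun i : Fin s => u i := not_not.1 (Nat.find_min hex (by omega))
  have h2 := Nat.find_spec hex
  rw [hs, Nat.succ_eq_add_one, linearIndependent_finSucc'] at h2
  have h3 : u s ∈ Submodule.span F (Set.range fun i : Fin s => u i) := by
    by_contra h
    exact h2 ⟨h1, h⟩
  obtain ⟨c, hc⟩ := (Submodule.mem_span_range_iff_exists_fun F).1 h3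
  refine ⟨s, fun i => if h : i < s then c ⟨i, h⟩ else 0, h1, ?_⟩
  rw [← hc, ← Fin.sum_univ_eq_sum_range fun i => (if h : i < s then c ⟨i, h⟩ else 0) • u i]
  exact Finset.sum_congr rfl fun i _ => by simp

variable {k K : Type*} [Field k] [Field K] [Algebra k[X] K] [Algebra (RatFunc k) K]
  [IsScalarTower k[X] (RatFunc k) K] [FiniteDimensional (RatFunc k) K]
  {ι : Type*} [Fintype ι] [DecidableEq ι]

/-- A dual family certifies independence by finitely many rational functions, so independence
survives reduction at almost all places. -/
theorem exists_dual_matrices {F : Type*} [Field F] {s : ℕ} {Y : Fin s → Matrix ι ι F}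
    (h : LinearIndependent F Y) : ∃ c : Fin s → Matrix ι ι F, ∀ i j,
      ∑ a, ∑ b, c i a b * Y j a b = if i = j then 1 else 0 := by
  obtain ⟨f, hf⟩ := LinearMap.exists_leftInverse_of_injective
    (Fintype.linearCombination F Y) (LinearMap.ker_eq_bot.2 (linearIndependent_iff_injective_fintypeLinearCombination.1 h))
  refine ⟨fun i => Matrix.of fun a b => f (Matrix.single a b 1) i, fun i j => ?_⟩
  have h1 : f (Y j) = Pi.single j 1 := by
    have := LinearMap.congr_fun hf (Pi.single j 1)
    simpa using this
  have h2 : f (Y j) i = if i = j then 1 else 0 := by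
    rw [h1, Pi.single_apply]
  rw [← h2]
  nth_rewrite 2 [Matrix.matrix_eq_sum_single (Y j)]
  rw [map_sum, Finset.sum_apply]
  refine Finset.sum_congr rfl fun a _ => ?_
  rw [map_sum, Finset.sum_apply]
  refine Finset.sum_congr rfl fun b _ => ?_
  have h3 : Matrix.single a b (Y j a b) = Y j a b • Matrix.single a b (1 : F) := by
    rw [Matrix.smul_single, smul_eq_mul, mul_one]
  rw [h3, map_smul, Pi.smul_apply, smul_eq_mul, mul_comm]
  rfl

theorem linearIndependent_of_dual {F : Type*} [Field F] {s : ℕ} {Y c : Fin s → Matrix ι ι F}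
    (h : ∀ i j, ∑ a, ∑ b, c i a b * Y j a b = if i = j then 1 else 0) : LinearIndependent F Y := by
  rw [Fintype.linearIndependent_iff]
  intro g hg i
  have h1 : ∑ a, ∑ b, c i a b * (∑ j, g j • Y j) a b = g i := by
    simp only [Matrix.sum_apply, Matrix.smul_apply, smul_eq_mul, Finset.mul_sum]
    have h2 : ∀ a, ∑ b, ∑ j, c i a b * (g j * Y j a b) = ∑ j, ∑ b, g j * (c i a b * Y j a b) :=
      fun a => by
        rw [Finset.sum_comm]
        exact Finset.sum_congr rfl fun _ _ => Finset.sum_congr rfl fun _ _ => by ring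
    simp only [h2]
    rw [Finset.sum_comm]
    simp only [← Finset.mul_sum, h]
    simp
  rw [← h1, hg]
  simp

/-- The operator `Y ↦ A(x) Y(qx)` as an additive map. -/
def matOpHom {F : Type*} [Field F] (q : Fˣ) (A : Matrix ι ι (RatFunc F)) :
    Matrix ι ι (RatFunc F) →+ Matrix ι ι (RatFunc F) :=
  AddMonoidHom.mk' (matOp q A) fun Y Z => by rw [matOp, map_add, mul_add]; rfl

/-- The minimal relation between the iterates of a nearly integral operator is regular at the
origin. -/
theorem exists_regular_relation {A : Matrix ι ι (RatFunc K)} (hA : NearlyIntegral k A) :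
    ∃ (s : ℕ) (a : ℕ → RatFunc K), (∀ i < s, a i ∈ regularAtZero K) ∧
      (matOp (qUnit k K) A)^[s] 1 =
        ∑ i ∈ Finset.range s, a i • (matOp (qUnit k K) A)^[i] 1 := by
  obtain ⟨s, a, hind, hrel⟩ := exists_minimal_relation (F := RatFunc K)
    fun i => (matOp (qUnit k K) A)^[i] 1
  refine ⟨s, a, fun i hi => ?_, hrel⟩
  obtain ⟨c, hc⟩ := exists_dual_matrices hind
  -- One place suffices, provided all the data of the relation reduce there and a pole of a i at the
  -- origin would still be visible in the reduction.
  obtain ⟨v, hv, hAv, hcv, hav, hav'⟩ := (hA.and ((eventually_matrix_mem_gaussRing A).and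
    ((eventually_all.2 fun i => eventually_matrix_mem_gaussRing (c i)).and
    (((eventually_all_finset (Finset.range s)).2 fun i _ => eventually_mem_gaussRing (a i)).and
    (eventually_regular_of_reducesTo (a i)))))).exists
  let A' : Matrix ι ι (RatFunc v.resField) := fun i j => gaussRed v.ring ⟨_, hAv i j⟩
  have hA' : ∀ i j, ReducesTo v.ring (A i j) (A' i j) := fun i j => ReducesTo.of_mem (hAv i j)
  let c' : Fin s → Matrix ι ι (RatFunc v.resField) := fun l i j => gaussRed v.ring ⟨_, hcv l i j⟩
  have hc' : ∀ l i j, ReducesTo v.ring (c l i j) (c' l i j) := fun l i j =>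
    ReducesTo.of_mem (hcv l i j)
  let a' : ℕ → RatFunc v.resField := fun i =>
    if h : i < s then gaussRed v.ring ⟨_, hav i (Finset.mem_range.2 h)⟩ else 0
  have ha' : ∀ i < s, ReducesTo v.ring (a i) (a' i) := fun i hi => by
    simp only [a', dif_pos hi]
    exact ReducesTo.of_mem _
  refine hav' _ (ha' i hi) ?_
  have hind' : LinearIndependent (RatFunc v.resField)
      fun i : Fin s => (matOp v.qv A')^[(i : ℕ)] 1 := by
    refine linearIndependent_of_dual (c := c') fun i j => ?_
    have h1 : ReducesTo v.ring (∑ a, ∑ b, c i a b * (matOp (qUnit k K) A)^[(j : ℕ)] 1 a b)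
        (∑ a, ∑ b, c' i a b * (matOp v.qv A')^[(j : ℕ)] 1 a b) :=
      ReducesTo.sum fun a _ => ReducesTo.sum fun b _ => (hc' i a b).mul (reducesTo_iterate hA' _ a b)
    rw [hc] at h1
    refine h1.unique ?_
    split_ifs
    exacts [ReducesTo.one, ReducesTo.zero]
  have hrel' : (matOp v.qv A')^[s] 1 = ∑ i ∈ Finset.range s, a' i • (matOp v.qv A')^[i] 1 := by
    refine Matrix.ext fun i j => (reducesTo_iterate hA' s i j).unique ?_
    rw [hrel, Matrix.sum_apply, Matrix.sum_apply]
    exact ReducesTo.sum fun l hl => (ha' l (Finset.mem_range.1 hl)).mul (reducesTo_iterate hA' l i j)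
  exact regular_of_relation v.qv (matOpHom v.qv A') (fun f m => matOp_smul A' m f) (e := 1) hind' hrel'
    (T := fun n => shiftProd v.qv (matOp v.qv A') n 1) rfl (fun n => rfl)
    (shiftProd_orderOf_eq_zero hA' hv) i hi

end MinimalRelation

/-! ### Bases of lattices over the local ring at the origin. -/

section RegularLattice

variable {F : Type*} [Field F] {ι : Type*} [Fintype ι] [DecidableEq ι]

/-- Among finitely many rational functions there is one which divides all the others at the
origin. -/
theorem exists_forall_div_mem {α : Type*} [Fintype α] (d : α → RatFunc F) {g₀ : α} (h₀ : d g₀ ≠ 0) :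
    ∃ g, d g ≠ 0 ∧ ∀ g', d g' / d g ∈ regularAtZero F := by
  classical
  let V : ValuationSubring (RatFunc F) :=
    { regularAtZero F with mem_or_inv_mem' := mem_or_inv_mem_regularAtZero }
  obtain ⟨g, _, hg⟩ := Finset.exists_max_image Finset.univ (fun g => V.valuation (d g))
    ⟨g₀, Finset.mem_univ _⟩
  have hd : d g ≠ 0 := by
    intro h
    have := hg g₀ (Finset.mem_univ _)
    rw [h, map_zero, le_zero_iff, map_eq_zero] at this
    exact h₀ this
  refine ⟨g, hd, fun g' => ?_⟩
  have h1 : V.valuation (d g' / d g) ≤ 1 := by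
    rw [map_div₀]
    exact div_le_one_of_le₀ (hg g' (Finset.mem_univ _)) zero_le
  exact (V.valuation_le_one_iff _).1 h1

/-- A finite spanning family of vectors contains a basis over which all members have regular
coordinates. -/
theorem exists_regular_basis {α : Type*} [Fintype α] (w : α → ι → RatFunc F) {g₀ : ι → α}
    (h₀ : (Matrix.of fun a b => w (g₀ b) a).det ≠ 0) :
    ∃ g : ι → α, (Matrix.of fun a b => w (g b) a).det ≠ 0 ∧
      ∀ p, ∃ c : ι → regularAtZero F,
        (Matrix.of fun a b => w (g b) a).mulVec (fun b => (c b : RatFunc F)) = w p := by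
  classical
  obtain ⟨g, hg, hmax⟩ := exists_forall_div_mem
    (fun g : ι → α => (Matrix.of fun a b => w (g b) a).det) h₀
  refine ⟨g, hg, fun p => ?_⟩
  set G : Matrix ι ι (RatFunc F) := Matrix.of fun a b => w (g b) a
  -- By Cramer's rule each coordinate is a determinant with one column exchanged, divided by det G.
  -- It is regular because g was chosen with the determinant of largest valuation.
  have h1 : ∀ b, G.cramer (w p) b / G.det ∈ regularAtZero F := fun b => by
    have h2 := hmax (Function.update g b p)
    have h3 : (Matrix.of fun a b' => w (Function.update g b p b') a) = G.updateCol b (w p) := by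
      ext a b'
      rw [Matrix.of_apply, Matrix.updateCol_apply, Function.update_apply]
      split_ifs <;> rfl
    rw [h3, ← Matrix.cramer_apply] at h2
    exact h2
  refine ⟨fun b => ⟨_, h1 b⟩, ?_⟩
  have h4 : (fun b => G.cramer (w p) b / G.det) = G.det⁻¹ • G.cramer (w p) := by
    funext b
    rw [Pi.smul_apply, smul_eq_mul, div_eq_inv_mul]
  simp only
  rw [h4, Matrix.mulVec_smul, Matrix.mulVec_cramer, smul_smul, inv_mul_cancel₀ hg, one_smul]

/-- Over the local ring at 0 the columns of the iterates S^i(1), i < s, span a lattice. It is stable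
under the q-difference operator because the relation expressing S^s(1) has regular coefficients, and
in a basis of this lattice the matrix of the operator is regular. -/
theorem exists_regular_gauge (q : Fˣ) {A : Matrix ι ι (RatFunc F)} {s : ℕ} {a : ℕ → RatFunc F}
    (ha : ∀ i < s, a i ∈ regularAtZero F)
    (hrel : (matOp q A)^[s] 1 = ∑ i ∈ Finset.range s, a i • (matOp q A)^[i] 1) :
    ∃ (A' : Matrix ι ι (regularAtZero F)) (G H : Matrix ι ι (RatFunc F)),
      G * coeMatrix A' = A * (sigma q).mapMatrix G ∧ H * G = 1 := by
  rcases Nat.eq_zero_or_pos s with rfl | hs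
  · have h1 : (1 : Matrix ι ι (RatFunc F)) = 0 := by simpa using hrel
    have : Subsingleton (Matrix ι ι (RatFunc F)) := subsingleton_of_zero_eq_one h1.symm
    exact ⟨1, 1, 1, Subsingleton.elim _ _, mul_one _⟩
  let w : Fin s × ι → ι → RatFunc F := fun p b => (matOp q A)^[(p.1 : ℕ)] 1 b p.2
  obtain ⟨g, hg, hw⟩ := exists_regular_basis w (g₀ := fun b => (⟨0, hs⟩, b)) (by
    have : (Matrix.of fun a b => w (⟨0, hs⟩, b) a) = 1 := rfl
    rw [this, Matrix.det_one]
    exact one_ne_zero)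
  set G : Matrix ι ι (RatFunc F) := Matrix.of fun a b => w (g b) a
  have hcol : ∀ p : Fin s × ι, A.mulVec (fun b => sigma q (w p b)) =
      fun b => (matOp q A)^[(p.1 : ℕ) + 1] 1 b p.2 := fun p => by
    funext b
    rw [Function.iterate_succ_apply']
    rfl
  have hw' : ∀ p, ∃ c : ι → regularAtZero F,
      G.mulVec (fun b => (c b : RatFunc F)) = A.mulVec (fun b => sigma q (w p b)) := fun p => by
    rw [hcol]
    rcases (Nat.succ_le_iff.2 p.1.2).eq_or_lt with h | h
    · choose c hc using fun i : Fin s => hw (i, p.2)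
      refine ⟨fun b => ∑ i : Fin s, ⟨a i, ha i i.2⟩ * c i b, ?_⟩
      have h1 : (fun b => ((∑ i : Fin s, (⟨a i, ha i i.2⟩ : regularAtZero F) * c i b :
          regularAtZero F) : RatFunc F)) = ∑ i : Fin s, a i • fun b => (c i b : RatFunc F) := by
        funext b
        rw [AddSubmonoidClass.coe_finsetSum, Finset.sum_apply]
        rfl
      rw [h1, Matrix.mulVec_sum]
      funext b
      rw [show (p.1 : ℕ) + 1 = s from h, hrel, Matrix.sum_apply, Finset.sum_apply,
        ← Fin.sum_univ_eq_sum_range fun i => (a i • (matOp q A)^[i] 1) b p.2]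
      refine Finset.sum_congr rfl fun i _ => ?_
      rw [Matrix.mulVec_smul, hc]
      rfl
    · exact hw (⟨(p.1 : ℕ) + 1, h⟩, p.2)
  choose c hc using fun b => hw' (g b)
  obtain ⟨H, hH⟩ : ∃ H, H * G = 1 := by
    have : IsUnit G := by rw [Matrix.isUnit_iff_isUnit_det]; exact isUnit_iff_ne_zero.2 hg
    exact this.exists_left_inv
  refine ⟨Matrix.of fun a b => c b a, G, H, ?_, hH⟩
  ext i j
  exact congrFun (hc j) i

end RegularLattice

/-! ### Triviality of nearly integral systems. -/

section Triviality

variable {k K : Type*} [Field k] [Field K] [Algebra k[X] K] [Algebra (RatFunc k) K]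
  [IsScalarTower k[X] (RatFunc k) K] [FiniteDimensional (RatFunc k) K]
  {ι : Type*} [Fintype ι] [DecidableEq ι]

/-- A nearly integral `q`-difference system has a basis of rational solutions. -/
theorem NearlyIntegral.exists_fixed {A : Matrix ι ι (RatFunc K)} (hA : NearlyIntegral k A) :
    ∃ F H : Matrix ι ι (RatFunc K), H * F = 1 ∧ A * (sigma (qUnit k K)).mapMatrix F = F := by
  obtain ⟨s, a, ha, hrel⟩ := exists_regular_relation hA
  obtain ⟨A', G, H, hG, hH⟩ := exists_regular_gauge (qUnit k K) ha hrel
  obtain ⟨F', H', hF', hAF⟩ := exists_fixed_of_regular (hA.gauge hG hH)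
  refine ⟨G * F', H' * H, ?_, ?_⟩
  · rw [mul_assoc, ← mul_assoc H, hH, one_mul, hF']
  · rw [map_mul, ← mul_assoc, ← hG, mul_assoc, hAF]

end Triviality

/-! ### q-integers and q-binomial coefficients. -/

section QIntegers

variable {F : Type*} [Field F] {q : F}

theorem qInt_zero : qInt q 0 = 0 := by simp [qInt]

theorem qInt_add (hq : q - 1 ≠ 0) (i j : ℕ) : qInt q (i + j) = qInt q i + q ^ i * qInt q j := by
  simp only [qInt]
  field_simp
  ring

theorem qInt_ne_zero (hq : ∀ n, n ≠ 0 → q ^ n ≠ 1) {n : ℕ} (hn : n ≠ 0) : qInt q n ≠ 0 := by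
  have h1 := hq 1 one_ne_zero
  rw [pow_one] at h1
  exact div_ne_zero (sub_ne_zero.2 (hq n hn)) (sub_ne_zero.2 h1)

theorem qFactorial_succ (n : ℕ) : qFactorial q (n + 1) = qInt q (n + 1) * qFactorial q n := by
  rw [qFactorial, Finset.prod_range_succ, mul_comm]; rfl

theorem qFactorial_ne_zero (hq : ∀ n, n ≠ 0 → q ^ n ≠ 1) (n : ℕ) : qFactorial q n ≠ 0 :=
  Finset.prod_ne_zero_iff.2 fun i _ => qInt_ne_zero hq i.succ_ne_zero

theorem qBinom_eq_zero (r : ℕ) : ∀ n, r < n → qBinom q r n = 0 := by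
  induction r with
  | zero =>
    rintro (_ | n) hn
    · omega
    · rw [qBinom]
  | succ r ih =>
    rintro (_ | n) hn
    · omega
    · rw [qBinom, ih n (by omega), ih (n + 1) (by omega), mul_zero, add_zero]

theorem qBinom_mul (hq : q - 1 ≠ 0) (i j : ℕ) :
    qBinom q (i + j) i * (qFactorial q i * qFactorial q j) = qFactorial q (i + j) := by
  obtain ⟨r, hr⟩ : ∃ r, r = i + j := ⟨_, rfl⟩
  rw [← hr]
  induction r generalizing i j with
  | zero =>
    obtain ⟨rfl, rfl⟩ : i = 0 ∧ j = 0 := by omega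
    simp [qBinom, qFactorial]
  | succ r ih =>
    rcases i with _ | i
    · rw [zero_add] at hr
      rw [qBinom, ← hr, one_mul]
      simp [qFactorial]
    have h1 := ih i j (by omega)
    rw [qBinom, qFactorial_succ, add_mul]
    rcases j with _ | j
    · obtain rfl : r = i := by omega
      rw [qBinom_eq_zero (q := q) r (r + 1) (by omega), qFactorial_succ]
      linear_combination qInt q (r + 1) * h1
    have h2 := ih (i + 1) j (by omega)
    rw [qFactorial_succ] at h1 h2
    have h3 : qInt q (r + 1) = qInt q (i + 1) + q ^ (i + 1) * qInt q (j + 1) := by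
      rw [← qInt_add hq]; congr 1
    rw [qFactorial_succ, qFactorial_succ, h3]
    linear_combination qInt q (i + 1) * h1 + q ^ (i + 1) * qInt q (j + 1) * h2

theorem qBinom_mul_qInt (hq : ∀ n, n ≠ 0 → q ^ n ≠ 1) (r n : ℕ) :
    qBinom q r n * qInt q (r - n) = qInt q (n + 1) * qBinom q r (n + 1) := by
  have hq1 : q - 1 ≠ 0 := by
    have := hq 1 one_ne_zero
    rwa [pow_one, ← sub_ne_zero] at this
  rcases le_or_gt r n with h | h
  · rw [Nat.sub_eq_zero_of_le h, qInt_zero, mul_zero, qBinom_eq_zero r (n + 1) (by omega), mul_zero]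
  · obtain ⟨m, rfl⟩ : ∃ m, r = n + (m + 1) := ⟨r - n - 1, by omega⟩
    have h1 := qBinom_mul hq1 n (m + 1)
    have h2 := qBinom_mul hq1 (n + 1) m
    rw [show n + 1 + m = n + (m + 1) by ring] at h2
    rw [qFactorial_succ] at h1 h2
    rw [Nat.add_sub_cancel_left]
    have h3 := qFactorial_ne_zero hq n
    have h4 := qFactorial_ne_zero hq m
    refine mul_right_cancel₀ (mul_ne_zero h3 h4) ?_
    linear_combination h1 - h2

end QIntegers

/-! ### Divided powers of Δ for q not a root of unity. -/

section DividedPowers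

variable {F N : Type*} [Field F] [AddCommGroup N] [Module (RatFunc F) N] {q : Fˣ}

theorem Delta_add (S : N →+ N) (m n : N) : Delta q S (m + n) = Delta q S m + Delta q S n := by
  rw [Delta, Delta, Delta, map_add, ← smul_add]
  congr 1
  abel

theorem Delta_C_smul {S : N → N} (hS : ∀ (f : RatFunc F) m, S (f • m) = sigma q f • S m) (c : F) (m : N) :
    Delta q S (RatFunc.C c • m) = RatFunc.C c • Delta q S m := by
  rw [Delta, Delta, hS, sigma_C, ← smul_sub, smul_comm]

theorem Delta_iterate_C_smul {S : N → N} (hS : ∀ (f : RatFunc F) m, S (f • m) = sigma q f • S m) (c : F)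
    (n : ℕ) (m : N) : (Delta q S)^[n] (RatFunc.C c • m) = RatFunc.C c • (Delta q S)^[n] m := by
  induction n with
  | zero => rfl
  | succ n ih => rw [Function.iterate_succ_apply', Function.iterate_succ_apply', ih, Delta_C_smul hS]

theorem divDelta_zero (S : N → N) (m : N) : divDelta q S 0 m = m := by
  simp [divDelta, qFactorial]

theorem divDelta_add (S : N →+ N) (n : ℕ) (m m' : N) :
    divDelta q S n (m + m') = divDelta q S n m + divDelta q S n m' := by
  have h : ∀ m m', (Delta q S)^[n] (m + m') = (Delta q S)^[n] m + (Delta q S)^[n] m' := by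
    induction n with
    | zero => exact fun _ _ => rfl
    | succ n ih =>
      intro m m'
      simp only [Function.iterate_succ_apply, Delta_add, ih]
  rw [divDelta, divDelta, divDelta, h, smul_add]

theorem C_smul_divDelta_succ (hq : ∀ n, n ≠ 0 → (q : F) ^ n ≠ 1) {S : N → N}
    (hS : ∀ (f : RatFunc F) m, S (f • m) = sigma q f • S m) (n : ℕ) (m : N) :
    RatFunc.C (qInt (q : F) (n + 1)) • divDelta q S (n + 1) m = Delta q S (divDelta q S n m) := by
  have h1 : RatFunc.C (qInt (q : F) (n + 1)) ≠ 0 :=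
    (_root_.map_ne_zero _).2 (qInt_ne_zero hq n.succ_ne_zero)
  rw [divDelta, divDelta, qFactorial_succ, map_mul, mul_inv, smul_smul, mul_inv_cancel_left₀ h1,
    ← map_inv₀, Delta_C_smul hS, Function.iterate_succ_apply']

theorem divDelta_divDelta (hq : ∀ n, n ≠ 0 → (q : F) ^ n ≠ 1) {S : N → N}
    (hS : ∀ (f : RatFunc F) m, S (f • m) = sigma q f • S m) (i j : ℕ) (m : N) :
    divDelta q S i (divDelta q S j m) =
      RatFunc.C (qBinom (q : F) (i + j) i) • divDelta q S (i + j) m := by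
  have hq1 : (q : F) - 1 ≠ 0 := by
    have := hq 1 one_ne_zero
    rwa [pow_one, ← sub_ne_zero] at this
  have hi := qFactorial_ne_zero hq i
  have hj := qFactorial_ne_zero hq j
  have hij := qFactorial_ne_zero hq (i + j)
  rw [divDelta, divDelta, divDelta, ← map_inv₀, ← map_inv₀, ← map_inv₀, Delta_iterate_C_smul hS,
    ← Function.iterate_add_apply, smul_smul, smul_smul, ← map_mul, ← map_mul]
  congr 2
  have h1 := qBinom_mul hq1 i j
  field_simp
  linear_combination -h1

/-- A fixed vector behaves as a constant for Δ. In a basis of such vectors all divided powers are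
therefore computed coordinatewise. -/
theorem divDelta_smul_of_fixed {S : N → N} (hS : ∀ (f : RatFunc F) m, S (f • m) = sigma q f • S m)
    {m : N} (hm : S m = m) (n : ℕ) (f : RatFunc F) :
    divDelta q S n (f • m) = divDelta q (sigma q) n f • m := by
  have h : ∀ f : RatFunc F, (Delta q S)^[n] (f • m) = (Delta q (sigma q))^[n] f • m := by
    induction n with
    | zero => exact fun _ => rfl
    | succ n ih =>
      intro f
      rw [Function.iterate_succ_apply, Function.iterate_succ_apply, ← ih, Delta, Delta, hS, hm,
        ← sub_smul, smul_smul, smul_eq_mul]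
  rw [divDelta, divDelta, h, smul_smul, smul_eq_mul]

theorem sigma_smul' (f g : RatFunc F) : sigma q (f • g) = sigma q f • sigma q g := map_mul _ _ _

theorem Delta_mul (f g : RatFunc F) :
    Delta q (sigma q) (f * g) = sigma q f * Delta q (sigma q) g + Delta q (sigma q) f * g := by
  simp only [Delta, smul_eq_mul, map_mul]
  ring

theorem Delta_sigma (f : RatFunc F) :
    Delta q (sigma q) (sigma q f) = RatFunc.C (q : F) * sigma q (Delta q (sigma q) f) := by
  have hq : RatFunc.C (q : F) ≠ 0 := (_root_.map_ne_zero _).2 q.ne_zero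
  simp only [Delta, smul_eq_mul, map_mul, map_inv₀, sigma_C, sigma_X, map_sub, mul_inv]
  have h : RatFunc.C (q : F) * (RatFunc.C (q : F))⁻¹ = 1 := mul_inv_cancel₀ hq
  linear_combination ((RatFunc.C (q : F) - RatFunc.C 1)⁻¹ * RatFunc.X⁻¹ *
    ((sigma q) f - (sigma q) ((sigma q) f))) * h

theorem Delta_sigma_iterate (i : ℕ) (f : RatFunc F) : Delta q (sigma q) ((sigma q)^[i] f) =
    RatFunc.C ((q : F) ^ i) * (sigma q)^[i] (Delta q (sigma q) f) := by
  induction i with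
  | zero => simp
  | succ i ih =>
    rw [Function.iterate_succ_apply', Function.iterate_succ_apply', Delta_sigma, ih, map_mul, sigma_C,
      pow_succ, map_mul]
    ring

theorem sigma_iterate_C_mul (i : ℕ) (c : F) (f : RatFunc F) :
    (sigma q)^[i] (RatFunc.C c * f) = RatFunc.C c * (sigma q)^[i] f := by
  induction i with
  | zero => rfl
  | succ i ih => rw [Function.iterate_succ_apply', ih, map_mul, sigma_C, Function.iterate_succ_apply']

theorem Delta_sum {α : Type*} (s : Finset α) (f : α → RatFunc F) :
    Delta q (sigma q) (∑ i ∈ s, f i) = ∑ i ∈ s, Delta q (sigma q) (f i) := by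
  simp only [Delta, map_sum, ← Finset.sum_sub_distrib, Finset.smul_sum]

/-- The `q`-Leibniz rule for the divided powers of the `q`-derivation. -/
theorem divDelta_sigma_mul (hq : ∀ n, n ≠ 0 → (q : F) ^ n ≠ 1) (n : ℕ) (f g : RatFunc F) :
    divDelta q (sigma q) n (f * g) = ∑ ij ∈ Finset.HasAntidiagonal.antidiagonal n,
      (sigma q)^[ij.1] (divDelta q (sigma q) ij.2 f) * divDelta q (sigma q) ij.1 g := by
  have hq1 : (q : F) - 1 ≠ 0 := by
    have := hq 1 one_ne_zero
    rwa [pow_one, ← sub_ne_zero] at this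
  have hrec := C_smul_divDelta_succ hq (S := sigma q) sigma_smul'
  simp only [smul_eq_mul] at hrec
  induction n with
  | zero => simp [divDelta_zero]
  | succ n ih =>
    have h1 : RatFunc.C (qInt (q : F) (n + 1)) ≠ 0 :=
      (_root_.map_ne_zero _).2 (qInt_ne_zero hq n.succ_ne_zero)
    refine mul_left_cancel₀ h1 ?_
    rw [hrec, ih, Delta_sum, Finset.mul_sum]
    set T : ℕ × ℕ → RatFunc F := fun ij =>
      (sigma q)^[ij.1] (divDelta q (sigma q) ij.2 f) * divDelta q (sigma q) ij.1 g
    -- The identity [i+j] = [i] + q^i [j] splits each term in two, matching the two terms of the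
    -- product rule for Δ.
    have h2 : ∀ ij ∈ Finset.HasAntidiagonal.antidiagonal (n + 1),
        RatFunc.C (qInt (q : F) (n + 1)) * T ij = RatFunc.C (qInt (q : F) ij.1) * T ij +
          RatFunc.C ((q : F) ^ ij.1 * qInt (q : F) ij.2) * T ij := fun ij hij => by
      rw [← Finset.HasAntidiagonal.mem_antidiagonal.1 hij, qInt_add hq1, map_add, add_mul]
    have h3 : ∀ ij : ℕ × ℕ, Delta q (sigma q) (T ij) =
        RatFunc.C (qInt (q : F) (ij.1 + 1)) * T (ij.1 + 1, ij.2) +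
          RatFunc.C ((q : F) ^ ij.1 * qInt (q : F) (ij.2 + 1)) * T (ij.1, ij.2 + 1) := fun ij => by
      simp only [T]
      rw [Delta_mul, Delta_sigma_iterate, ← hrec, ← hrec, ← Function.iterate_succ_apply' (sigma q),
        sigma_iterate_C_mul, map_mul]
      ring
    rw [Finset.sum_congr rfl h2, Finset.sum_add_distrib, Finset.sum_congr rfl fun ij _ => h3 ij,
      Finset.sum_add_distrib]
    congr 1
    · rw [Finset.Nat.sum_antidiagonal_succ, qInt_zero, map_zero, zero_mul, zero_add]
    · rw [Finset.Nat.sum_antidiagonal_succ', qInt_zero, mul_zero, map_zero, zero_mul, zero_add]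

theorem polyDivDeriv_add (n : ℕ) (a b : F[X]) :
    polyDivDeriv (q : F) n (a + b) = polyDivDeriv (q : F) n a + polyDivDeriv (q : F) n b := by
  rw [polyDivDeriv, sum_add_index]
  · rfl
  · intro i; simp
  · intro i a b; rw [add_mul, C_add, add_mul]

theorem polyDivDeriv_monomial (n r : ℕ) (c : F) : polyDivDeriv (q : F) n (monomial r c) =
    C (c * qBinom (q : F) r n) * X ^ (r - n) := by
  rw [polyDivDeriv, sum_monomial_index]
  simp

theorem Delta_C_mul_X_pow (hq1 : (q : F) - 1 ≠ 0) (c : F) (m : ℕ) :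
    Delta q (sigma q) (RatFunc.C c * RatFunc.X ^ m) =
      RatFunc.C (c * qInt (q : F) m) * RatFunc.X ^ (m - 1) := by
  rw [Delta, smul_eq_mul, map_mul, map_pow, sigma_C, sigma_X]
  have h1 : RatFunc.C ((q : F) - 1) ≠ 0 := (_root_.map_ne_zero _).2 hq1
  rw [inv_mul_eq_iff_eq_mul₀ (mul_ne_zero h1 RatFunc.X_ne_zero)]
  rcases m with _ | m
  · simp [qInt_zero]
  · have h2 : RatFunc.C ((q : F) - 1) * RatFunc.C (qInt (q : F) (m + 1)) =
        RatFunc.C (q : F) ^ (m + 1) - 1 := by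
      rw [← map_mul, qInt, mul_div_cancel₀ _ hq1, map_sub, map_one, map_pow]
    rw [Nat.add_sub_cancel, map_mul, mul_pow]
    linear_combination -(RatFunc.C c * RatFunc.X ^ (m + 1)) * h2

/-- The divided powers of the `q`-derivation on polynomials. -/
theorem divDelta_sigma_algebraMap (hq : ∀ n, n ≠ 0 → (q : F) ^ n ≠ 1) (n : ℕ) (p : F[X]) :
    divDelta q (sigma q) n (algebraMap F[X] (RatFunc F) p) =
      algebraMap F[X] (RatFunc F) (polyDivDeriv (q : F) n p) := by
  have hq1 : (q : F) - 1 ≠ 0 := by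
    have := hq 1 one_ne_zero
    rwa [pow_one, ← sub_ne_zero] at this
  have hrec := C_smul_divDelta_succ hq (S := sigma q) sigma_smul'
  simp only [smul_eq_mul] at hrec
  induction p using Polynomial.induction_on' with
  | add a b ha hb =>
    rw [map_add, polyDivDeriv_add, map_add, ← ha, ← hb]
    exact divDelta_add (sigma q : RatFunc F →+ RatFunc F) n _ _
  | monomial r c =>
    rw [polyDivDeriv_monomial, ← C_mul_X_pow_eq_monomial, map_mul, map_mul, map_pow, map_pow,
      RatFunc.algebraMap_X, RatFunc.algebraMap_C, RatFunc.algebraMap_C]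
    induction n with
    | zero => rw [divDelta_zero, Nat.sub_zero]; simp [qBinom]
    | succ n ih =>
      have h1 : RatFunc.C (qInt (q : F) (n + 1)) ≠ 0 :=
        (_root_.map_ne_zero _).2 (qInt_ne_zero hq n.succ_ne_zero)
      refine mul_left_cancel₀ h1 ?_
      rw [hrec, ih, Delta_C_mul_X_pow hq1, mul_assoc, qBinom_mul_qInt hq, Nat.sub_sub]
      simp only [map_mul]
      ring

end DividedPowers

/-! ### Reduction of the divided powers of the q-derivation. -/

section ReducedDividedPowers

variable {k K : Type*} [Field k] [Field K] [Algebra k[X] K] [Algebra (RatFunc k) K]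
  [IsScalarTower k[X] (RatFunc k) K] {v : CyclotomicPlace k K}

variable (v) in
theorem CyclotomicPlace.exists_qBinom (r n : ℕ) : ∃ c : v.ring,
    (c : K) = qBinom (qUnit k K : K) r n ∧
    IsLocalRing.residue v.ring c = qBinom (v.qv : v.resField) r n := by
  induction r generalizing n with
  | zero =>
    rcases n with _ | n
    · exact ⟨1, by simp [qBinom], by simp [qBinom]⟩
    · exact ⟨0, by simp [qBinom], by simp [qBinom]⟩
  | succ r ih =>
    rcases n with _ | n
    · exact ⟨1, by simp [qBinom], by simp [qBinom]⟩
    · obtain ⟨c, hc, hc'⟩ := ih n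
      obtain ⟨d, hd, hd'⟩ := ih (n + 1)
      refine ⟨c + (⟨_, v.q_mem⟩ : v.ring) ^ (n + 1) * d, ?_, ?_⟩
      · rw [qBinom, ← hc, ← hd]; rfl
      · rw [qBinom, ← hc', ← hd', map_add, map_mul, map_pow]; rfl

theorem CyclotomicPlace.reducesTo_qBinom (r n : ℕ) :
    ReducesTo v.ring (RatFunc.C (qBinom (qUnit k K : K) r n))
      (RatFunc.C (qBinom (v.qv : v.resField) r n)) := by
  obtain ⟨c, hc, hc'⟩ := v.exists_qBinom r n
  rw [← hc, ← hc']
  exact ReducesTo.C c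

theorem reducesTo_polyDivDeriv (n : ℕ) (a : v.ring[X]) :
    ReducesTo v.ring
      (algebraMap K[X] (RatFunc K) (polyDivDeriv (qUnit k K : K) n (a.map v.ring.subtype)))
      (algebraMap _ (RatFunc v.resField)
        (polyDivDeriv (v.qv : v.resField) n (a.map (IsLocalRing.residue v.ring)))) := by
  induction a using Polynomial.induction_on' with
  | add a b ha hb =>
    rw [Polynomial.map_add, Polynomial.map_add, polyDivDeriv_add, polyDivDeriv_add, map_add, map_add]
    exact ha.add hb
  | monomial r c =>
    rw [map_monomial, map_monomial, polyDivDeriv_monomial, polyDivDeriv_monomial, map_mul, map_mul,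
      map_mul, map_mul, map_pow, map_pow, RatFunc.algebraMap_X, RatFunc.algebraMap_X, map_mul, map_mul,
      RatFunc.algebraMap_C, RatFunc.algebraMap_C, RatFunc.algebraMap_C, RatFunc.algebraMap_C]
    exact ((ReducesTo.C c).mul (v.reducesTo_qBinom r n)).mul (ReducesTo.X.pow _)

theorem reducesTo_sigma_iterate (i : ℕ) {f : RatFunc K} {g : RatFunc v.resField}
    (h : ReducesTo v.ring f g) :
    ReducesTo v.ring ((sigma (qUnit k K))^[i] f) ((sigma v.qv)^[i] g) := by
  induction i with
  | zero => exact h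
  | succ i ih =>
    rw [Function.iterate_succ_apply', Function.iterate_succ_apply']
    exact v.reducesTo_sigma ih

/-- The divided power of order `n` of a quotient, in terms of those of lower order. -/
theorem divDelta_sigma_div {F : Type*} [Field F] {q : Fˣ} (hq : ∀ n, n ≠ 0 → (q : F) ^ n ≠ 1)
    {a b : F[X]} (hb : algebraMap F[X] (RatFunc F) b ≠ 0) (n : ℕ) :
    divDelta q (sigma q) n (algebraMap F[X] (RatFunc F) a / algebraMap F[X] (RatFunc F) b) =
      (algebraMap F[X] (RatFunc F) (polyDivDeriv (q : F) n a) -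
        ∑ i : Fin n, (sigma q)^[(i : ℕ) + 1] (divDelta q (sigma q) (n - ((i : ℕ) + 1))
            (algebraMap F[X] (RatFunc F) a / algebraMap F[X] (RatFunc F) b)) *
          algebraMap F[X] (RatFunc F) (polyDivDeriv (q : F) ((i : ℕ) + 1) b)) /
      algebraMap F[X] (RatFunc F) b := by
  have h1 := divDelta_sigma_mul hq n
    (algebraMap F[X] (RatFunc F) a / algebraMap F[X] (RatFunc F) b) (algebraMap F[X] (RatFunc F) b)
  rw [div_mul_cancel₀ _ hb, divDelta_sigma_algebraMap hq,
    Finset.Nat.sum_antidiagonal_eq_sum_range_succ_mk, Finset.sum_range_succ'] at h1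
  simp only [Function.iterate_zero_apply, Nat.sub_zero, divDelta_zero] at h1
  rw [Fin.sum_univ_eq_sum_range fun i => (sigma q)^[i + 1] (divDelta q (sigma q) (n - (i + 1))
            (algebraMap F[X] (RatFunc F) a / algebraMap F[X] (RatFunc F) b)) *
          algebraMap F[X] (RatFunc F) (polyDivDeriv (q : F) (i + 1) b), eq_div_iff hb, h1]
  simp only [divDelta_sigma_algebraMap hq]
  ring

theorem polyRed_apply {K : Type*} [Field K] (V : ValuationSubring K) (a : V[X]) : polyRed V a =
    algebraMap (IsLocalRing.ResidueField V)[X] (RatFunc (IsLocalRing.ResidueField V))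
      (a.map (IsLocalRing.residue V)) := rfl

theorem ReducesTo.div' {K : Type*} [Field K] {V : ValuationSubring K} {f f' : RatFunc K}
    {g g' : RatFunc (IsLocalRing.ResidueField V)} (h : ReducesTo V f g) (h' : ReducesTo V f' g')
    (hg : g' ≠ 0) : ReducesTo V (f / f') (g / g') := by
  rw [div_eq_mul_inv, div_eq_mul_inv]
  exact h.mul (h'.inv hg)

theorem divDelta_sigma_polyToRatFunc_div {a b : v.ring[X]} (hb : polyRed v.ring b ≠ 0) (n : ℕ) :
    divDelta (qUnit k K) (sigma (qUnit k K)) n (polyToRatFunc v.ring a / polyToRatFunc v.ring b) =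
      (algebraMap K[X] (RatFunc K) (polyDivDeriv (qUnit k K : K) n (a.map v.ring.subtype)) -
        ∑ i : Fin n, (sigma (qUnit k K))^[(i : ℕ) + 1] (divDelta (qUnit k K) (sigma (qUnit k K))
            (n - ((i : ℕ) + 1)) (polyToRatFunc v.ring a / polyToRatFunc v.ring b)) *
          algebraMap K[X] (RatFunc K) (polyDivDeriv (qUnit k K : K) ((i : ℕ) + 1)
            (b.map v.ring.subtype))) / polyToRatFunc v.ring b :=
  divDelta_sigma_div qUnit_pow_ne_one (polyToRatFunc_ne_zero hb) n

/-- `divDeriv` is defined by a recursion on the reduced fraction, and the generic divided powers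
satisfy the same recursion for every fraction. Lifting numerator and denominator separately allows a
comparison term by term. -/
theorem reducesTo_divDelta_of_num_denom {g : RatFunc v.resField} {a b : v.ring[X]}
    (ha : a.map (IsLocalRing.residue v.ring) = g.num)
    (hb : b.map (IsLocalRing.residue v.ring) = g.denom) (n : ℕ) :
    ReducesTo v.ring (divDelta (qUnit k K) (sigma (qUnit k K)) n
      (polyToRatFunc v.ring a / polyToRatFunc v.ring b)) (divDeriv v.qv n g) := by
  have hb0 : polyRed v.ring b ≠ 0 := by
    rw [polyRed_apply, hb]
    exact (map_ne_zero_iff _ (IsFractionRing.injective _ _)).2 g.denom_ne_zero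
  induction n using Nat.strong_induction_on with
  | _ n ih =>
    rw [divDelta_sigma_polyToRatFunc_div hb0, divDeriv, ← ha, ← hb]
    refine ReducesTo.div' (ReducesTo.sub (reducesTo_polyDivDeriv n a) (ReducesTo.sum fun i _ => ?_))
      (ReducesTo.poly b) hb0
    exact (reducesTo_sigma_iterate _ (ih _ (by omega))).mul (reducesTo_polyDivDeriv _ b)

/-- Hence the reduction of a divided power of f depends only on the reduction of f, and f may be
replaced by any convenient lift. -/
theorem reducesTo_divDelta_zero {f : RatFunc K} (h : ReducesTo v.ring f 0) (n : ℕ) :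
    ReducesTo v.ring (divDelta (qUnit k K) (sigma (qUnit k K)) n f) 0 := by
  obtain ⟨a, b, hb0, rfl, h0⟩ := h.exists_div
  have ha : a.map (IsLocalRing.residue v.ring) = 0 := by
    rw [eq_comm, div_eq_zero_iff, or_iff_left hb0] at h0
    exact (map_eq_zero_iff _ (IsFractionRing.injective _ (RatFunc v.resField))).1 h0
  induction n using Nat.strong_induction_on with
  | _ n ih =>
    rw [divDelta_sigma_polyToRatFunc_div hb0]
    have h2 := reducesTo_polyDivDeriv (v := v) n a
    have h3 : polyDivDeriv (v.qv : v.resField) n 0 = 0 := by simp [polyDivDeriv]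
    rw [ha, h3, map_zero] at h2
    have h4 := (h2.sub (ReducesTo.sum (s := Finset.univ) fun (i : Fin n) _ =>
      (reducesTo_sigma_iterate ((i : ℕ) + 1) (ih (n - ((i : ℕ) + 1)) (by omega))).mul
        (reducesTo_polyDivDeriv ((i : ℕ) + 1) b))).div' (ReducesTo.poly b) hb0
    have h5 : ∀ i : ℕ, (sigma v.qv)^[i] 0 = 0 := fun i => by
      induction i with
      | zero => rfl
      | succ i ih => rw [Function.iterate_succ_apply', ih, map_zero]
    simp only [h5, zero_mul, Finset.sum_const_zero, sub_zero, zero_div] at h4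
    exact h4

theorem exists_reducesTo (g : RatFunc v.resField) : ∃ (f : RatFunc K) (a b : v.ring[X]),
    ReducesTo v.ring f g ∧ a.map (IsLocalRing.residue v.ring) = g.num ∧
      b.map (IsLocalRing.residue v.ring) = g.denom ∧
      f = polyToRatFunc v.ring a / polyToRatFunc v.ring b := by
  obtain ⟨a, ha⟩ := map_surjective _ (IsLocalRing.residue_surjective (R := v.ring)) g.num
  obtain ⟨b, hb⟩ := map_surjective _ (IsLocalRing.residue_surjective (R := v.ring)) g.denom
  refine ⟨_, a, b, ?_, ha, hb, rfl⟩
  have hb0 : polyRed v.ring b ≠ 0 := by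
    rw [polyRed_apply, hb]
    exact (map_ne_zero_iff _ (IsFractionRing.injective _ _)).2 g.denom_ne_zero
  have h := ReducesTo.div (a := a) hb0
  rwa [polyRed_apply, polyRed_apply, ha, hb, RatFunc.num_div_denom] at h

/-- The divided powers of the `q`-derivation reduce to those of the `q_v`-derivation. -/
theorem ReducesTo.divDelta {f : RatFunc K} {g : RatFunc v.resField} (h : ReducesTo v.ring f g)
    (n : ℕ) : ReducesTo v.ring (QDiff.divDelta (qUnit k K) (QDiff.sigma (qUnit k K)) n f)
      (divDeriv v.qv n g) := by
  obtain ⟨f₀, a, b, h₀, ha, hb, hf₀⟩ := exists_reducesTo g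
  have h1 : ReducesTo v.ring (f - f₀) 0 := by
    rw [← sub_self g]; exact h.sub h₀
  have h2 := (reducesTo_divDelta_zero h1 n).add (hf₀ ▸ reducesTo_divDelta_of_num_denom ha hb n)
  rw [zero_add] at h2
  have h3 := divDelta_add (QDiff.sigma (qUnit k K) : RatFunc K →+ RatFunc K) (q := qUnit k K) n (f - f₀) f₀
  rw [sub_add_cancel] at h3
  exact h3 ▸ h2

section Rules

variable (v)

theorem divDeriv_zero (g : RatFunc v.resField) : divDeriv v.qv 0 g = g := by
  obtain ⟨f, _, _, h, _⟩ := exists_reducesTo g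
  refine (h.divDelta 0).unique ?_
  rwa [divDelta_zero]

theorem divDeriv_add (n : ℕ) (g g' : RatFunc v.resField) :
    divDeriv v.qv n (g + g') = divDeriv v.qv n g + divDeriv v.qv n g' := by
  obtain ⟨f, _, _, h, _⟩ := exists_reducesTo g
  obtain ⟨f', _, _, h', _⟩ := exists_reducesTo g'
  refine ((h.add h').divDelta n).unique ?_
  have := divDelta_add (sigma (qUnit k K) : RatFunc K →+ RatFunc K) (q := qUnit k K) n f f'
  exact this ▸ (h.divDelta n).add (h'.divDelta n)

/-- The rules for divided powers at a root of unity, where [n]! may vanish, are inherited from those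
at the generic q by lifting functions and reducing the identity. -/
theorem divDeriv_mul (n : ℕ) (g g' : RatFunc v.resField) :
    divDeriv v.qv n (g * g') = ∑ ij ∈ Finset.HasAntidiagonal.antidiagonal n,
      (sigma v.qv)^[ij.1] (divDeriv v.qv ij.2 g) * divDeriv v.qv ij.1 g' := by
  obtain ⟨f, _, _, h, _⟩ := exists_reducesTo g
  obtain ⟨f', _, _, h', _⟩ := exists_reducesTo g'
  refine ((h.mul h').divDelta n).unique ?_
  rw [divDelta_sigma_mul qUnit_pow_ne_one]
  exact ReducesTo.sum fun ij _ => (reducesTo_sigma_iterate _ (h.divDelta _)).mul (h'.divDelta _)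

theorem divDeriv_divDeriv (i j : ℕ) (g : RatFunc v.resField) :
    divDeriv v.qv i (divDeriv v.qv j g) =
      RatFunc.C (qBinom (v.qv : v.resField) (i + j) i) * divDeriv v.qv (i + j) g := by
  obtain ⟨f, _, _, h, _⟩ := exists_reducesTo g
  refine ((h.divDelta j).divDelta i).unique ?_
  rw [divDelta_divDelta qUnit_pow_ne_one sigma_smul']
  exact (v.reducesTo_qBinom _ _).mul (h.divDelta _)

theorem divDeriv_one {n : ℕ} (hn : 1 ≤ n) : divDeriv v.qv n 1 = 0 := by
  refine (ReducesTo.one.divDelta n).unique ?_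
  obtain ⟨n, rfl⟩ := Nat.exists_eq_succ_of_ne_zero (Nat.one_le_iff_ne_zero.1 hn)
  have h1 : Delta (qUnit k K) (sigma (qUnit k K)) 1 = 0 := by simp [Delta]
  have h2 : ∀ n, (Delta (qUnit k K) (sigma (qUnit k K)))^[n] 0 = 0 := fun n => by
    induction n with
    | zero => rfl
    | succ n ih => rw [Function.iterate_succ_apply, show Delta (qUnit k K) (sigma (qUnit k K)) 0 = 0 by
        simp [Delta], ih]
  rw [divDelta, Function.iterate_succ_apply, h1, h2, smul_zero]
  exact ReducesTo.zero

theorem add_mul_divDeriv_one (g : RatFunc v.resField) :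
    g + RatFunc.C ((v.qv : v.resField) - 1) * RatFunc.X * divDeriv v.qv 1 g = sigma v.qv g := by
  obtain ⟨f, _, _, h, _⟩ := exists_reducesTo g
  have h1 : ReducesTo v.ring (RatFunc.C ((qUnit k K : K) - 1)) (RatFunc.C ((v.qv : v.resField) - 1)) :=
    ReducesTo.C (V := v.ring) (⟨_, v.q_mem⟩ - 1)
  refine (h.add ((h1.mul ReducesTo.X).mul (h.divDelta 1))).unique ?_
  convert v.reducesTo_sigma h using 1
  have h2 : RatFunc.C ((qUnit k K : K) - 1) ≠ 0 := (_root_.map_ne_zero _).2 (qUnit_sub_one_ne_zero (k := k))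
  have h3 : qFactorial (qUnit k K : K) 1 = 1 := by
    have : (qUnit k K : K) - 1 ≠ 0 := qUnit_sub_one_ne_zero (k := k)
    simp [qFactorial, qInt, this]
  rw [divDelta, h3, map_one, inv_one, one_smul, Function.iterate_one, Delta, smul_eq_mul,
    mul_inv_cancel_left₀ (mul_ne_zero h2 RatFunc.X_ne_zero)]
  ring

theorem sigma_sigma_inv {F : Type*} [Field F] (q : Fˣ) (f : RatFunc F) : sigma q (sigma q⁻¹ f) = f := by
  have h1 : ∀ p : F[X], polySigma q (polySigma q⁻¹ p) = p := fun p => by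
    rw [polySigma_polySigma, inv_mul_cancel]
    ext n; rw [polySigma_coeff]; simp
  rw [← RatFunc.num_div_denom f]
  simp only [map_div₀, sigma_algebraMap, h1]

end Rules

end ReducedDividedPowers

/-! ### The iterative structure defined by a basis of constants. -/

section TrivialStructure

variable {k K : Type*} [Field k] [Field K] [Algebra k[X] K] [Algebra (RatFunc k) K]
  [IsScalarTower k[X] (RatFunc k) K] (v : CyclotomicPlace k K)
  {N : Type*} [AddCommGroup N] [Module (RatFunc v.resField) N] {ι : Type*} [Fintype ι]

/-- The iterative `q_v`-difference structure for which a given basis is annihilated by all divided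
powers. -/
def trivialStructure (b : Module.Basis ι (RatFunc v.resField) N) : IterativeStructure N v.qv where
  δ n := AddMonoidHom.mk' (fun m => ∑ i, divDeriv v.qv n (b.repr m i) • b i) fun m m' => by
    simp only [map_add, Finsupp.add_apply, divDeriv_add, add_smul, Finset.sum_add_distrib]
  zero' m := by
    simp only [AddMonoidHom.mk'_apply, divDeriv_zero]
    exact b.sum_repr m
  leibniz' n f m := by
    simp only [AddMonoidHom.mk'_apply, map_smul, Finsupp.smul_apply, smul_eq_mul, divDeriv_mul,
      Finset.sum_smul, Finset.smul_sum, smul_smul]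
    rw [Finset.sum_comm]
  comp' i j m := by
    classical
    simp only [AddMonoidHom.mk'_apply, Finset.smul_sum, smul_smul, ← divDeriv_divDeriv]
    refine Finset.sum_congr rfl fun l _ => ?_
    rw [b.repr_sum_self]
  bijective' := by
    classical
    -- On coordinates the operator 1 + (q_v - 1) x δ⁽¹⁾ is the substitution x ↦ q_v x, which is
    -- bijective.
    have h : ∀ m, m + (RatFunc.C ((v.qv : v.resField) - 1) * RatFunc.X) •
        ∑ i, divDeriv v.qv 1 (b.repr m i) • b i = ∑ i, sigma v.qv (b.repr m i) • b i := fun m => by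
      nth_rewrite 1 [← b.sum_repr m]
      simp only [Finset.smul_sum, ← Finset.sum_add_distrib, smul_smul, ← add_smul,
        add_mul_divDeriv_one]
    simp only [AddMonoidHom.mk'_apply, h]
    constructor
    · intro m m' hm
      refine b.repr.injective (Finsupp.ext fun i => (sigma v.qv).injective ?_)
      have := congrArg (fun m => b.repr m i) hm
      simpa only [b.repr_sum_self] using this
    · intro m
      refine ⟨∑ i, sigma v.qv⁻¹ (b.repr m i) • b i, ?_⟩
      simp only [b.repr_sum_self, sigma_sigma_inv, b.sum_repr]

theorem trivialStructure_apply (b : Module.Basis ι (RatFunc v.resField) N) (n : ℕ) (m : N) :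
    (trivialStructure v b).δ n m = ∑ i, divDeriv v.qv n (b.repr m i) • b i := rfl

theorem trivialStructure_isTrivial (b : Module.Basis ι (RatFunc v.resField) N) :
    (trivialStructure v b).IsTrivial := by
  classical
  let e := Fintype.equivFin ι
  refine ⟨_, b.reindex e, fun n hn i => ?_⟩
  rw [trivialStructure_apply, b.reindex_apply]
  refine Finset.sum_eq_zero fun j _ => ?_
  have h0 : divDeriv v.qv n 0 = 0 := by
    have := divDeriv_add v n 0 0
    rw [add_zero] at this
    exact left_eq_add.1 this
  rw [b.repr_self, Finsupp.single_apply]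
  split_ifs
  · rw [divDeriv_one v hn, zero_smul]
  · rw [h0, zero_smul]

end TrivialStructure

/-! ### Bases and extension of scalars. -/

section BaseChangeBasis

variable {A S S' : Type*} [CommRing A] [CommRing S] [CommRing S']
  {M : Type*} [AddCommGroup M] [Module A M] {ι : Type*}

namespace BaseChange

theorem induction_on (f : A →+* S) {p : BaseChange f M → Prop} (x : BaseChange f M) (zero : p 0)
    (tmul : ∀ s m, p (tmul f s m)) (add : ∀ x y, p x → p y → p (x + y)) : p x :=
  letI := f.toAlgebra
  TensorProduct.induction_on (R := A) (M := S) (N := M) (motive := p) x zero tmul add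

theorem smul_tmul (f : A →+* S) (s t : S) (m : M) : s • tmul f t m = tmul f (s * t) m := rfl

theorem tmul_smul (f : A →+* S) (s : S) (a : A) (m : M) : tmul f s (a • m) = tmul f (f a * s) m :=
  letI := f.toAlgebra
  (TensorProduct.tmul_smul a s m).trans (TensorProduct.smul_tmul' a s m)

theorem tmul_add (f : A →+* S) (s : S) (m n : M) : tmul f s (m + n) = tmul f s m + tmul f s n :=
  letI := f.toAlgebra
  TensorProduct.tmul_add s m n

/-- The basis of `S ⊗_A M` given by a basis of `M`. -/
def basis (f : A →+* S) (b : Module.Basis ι A M) : Module.Basis ι S (BaseChange f M) :=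
  letI := f.toAlgebra
  Algebra.TensorProduct.basis S b

theorem basis_apply (f : A →+* S) (b : Module.Basis ι A M) (i : ι) :
    basis f b i = tmul f 1 (b i) :=
  letI := f.toAlgebra
  Algebra.TensorProduct.basis_apply b i

theorem tmul_one_eq_sum [Fintype ι] (f : A →+* S) (b : Module.Basis ι A M) (m : M) :
    tmul f 1 m = ∑ i, f (b.repr m i) • basis f b i := by
  have h : ∀ s : Finset ι, tmul f 1 (∑ i ∈ s, b.repr m i • b i) =
      ∑ i ∈ s, f (b.repr m i) • basis f b i := fun s => by
    classical
    induction s using Finset.induction_on with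
    | empty =>
      let _ := f.toAlgebra
      exact TensorProduct.tmul_zero M (1 : S)
    | insert a s ha ih =>
      rw [Finset.sum_insert ha, Finset.sum_insert ha, tmul_add, ih, tmul_smul, basis_apply, smul_tmul]
  nth_rewrite 1 [← b.sum_repr m]
  exact h _

theorem map_smul (f : A →+* S) (f' : A →+* S') (g : S →+* S') {τ : A →+* A} (φ : M →ₛₗ[τ] M)
    (h : ∀ a, g (f a) = f' (τ a)) (s : S) (x : BaseChange f M) :
    map f f' g φ h (s • x) = g s • map f f' g φ h x := by
  induction x using induction_on with
  | zero => rw [smul_zero, map_zero, smul_zero]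
  | tmul t m => rw [smul_tmul, map_tmul, map_tmul, smul_tmul, _root_.map_mul]
  | add x y hx hy => rw [smul_add, map_add, map_add, smul_add, hx, hy]

end BaseChange

end BaseChangeBasis

section ChangeOfBasis

variable {R N ι : Type*} [CommRing R] [AddCommGroup N] [Module R N] [Fintype ι] [DecidableEq ι]

/-- The basis with given coordinates with respect to another basis. -/
def basisOfMatrix (b : Module.Basis ι R N) (F : Matrix ι ι R) (hF : IsUnit F.det) :
    Module.Basis ι R N :=
  b.map (Matrix.toLinearEquiv b F hF)

theorem basisOfMatrix_apply (b : Module.Basis ι R N) (F : Matrix ι ι R) (hF : IsUnit F.det) (j : ι) :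
    basisOfMatrix b F hF j = ∑ i, F i j • b i := by
  rw [basisOfMatrix, Module.Basis.map_apply]
  exact Matrix.toLin_self b b F j

end ChangeOfBasis

theorem map_divDelta {F N N' : Type*} [Field F] [AddCommGroup N] [Module (RatFunc F) N]
    [AddCommGroup N'] [Module (RatFunc F) N'] {q : Fˣ} {S : N → N} {S' : N' → N'}
    (φ : N →ₗ[RatFunc F] N') (h : ∀ m, φ (S m) = S' (φ m)) (n : ℕ) (m : N) :
    φ (divDelta q S n m) = divDelta q S' n (φ m) := by
  have h1 : ∀ m, φ (Delta q S m) = Delta q S' (φ m) := fun m => by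
    rw [Delta, map_smul, φ.map_sub, h, Delta]
  have h2 : φ ((Delta q S)^[n] m) = (Delta q S')^[n] (φ m) := by
    induction n with
    | zero => rfl
    | succ n ih => rw [Function.iterate_succ_apply', Function.iterate_succ_apply', h1, ih]
  rw [divDelta, map_smul, h2, divDelta]

/-! ### From q-difference modules to matrices and back. -/

namespace QDifferenceModule

open Filter

variable {k K : Type*} [Field k] [Field K] [Algebra k[X] K] [Algebra (RatFunc k) K]
  [IsScalarTower k[X] (RatFunc k) K] {P : (FunctionField.ringOfIntegers k K)[X]}
  {M : Type*} [AddCommGroup M] [Module (qRing P) M] (𝓜 : QDifferenceModule P M)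
  {ι : Type*} [Fintype ι] [DecidableEq ι] (b : Module.Basis ι (qRing P) M)

theorem genericOp_smul (f : RatFunc K) (m : Generic P M) :
    𝓜.genericOp (f • m) = sigma (qUnit k K) f • 𝓜.genericOp m :=
  BaseChange.map_smul _ _ _ _ _ f m

/-- The basis of `M_{K(x)}` given by a basis of `M`. -/
abbrev genericBasis : Module.Basis ι (RatFunc K) (Generic P M) :=
  BaseChange.basis (qRing P).subtype b

/-- The matrix of the operator of a `q`-difference module. -/
def opMatrix : Matrix ι ι (RatFunc K) :=
  Matrix.of fun i j => ((b.repr (𝓜.op (b j)) i : qRing P) : RatFunc K)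

theorem genericOp_basis (j : ι) :
    𝓜.genericOp (genericBasis b j) = ∑ i, 𝓜.opMatrix b i j • genericBasis b i := by
  have h : 𝓜.genericOp (BaseChange.tmul (qRing P).subtype 1 (b j)) =
      BaseChange.tmul (qRing P).subtype (sigma (qUnit k K) 1) (𝓜.op (b j)) := rfl
  rw [genericBasis, BaseChange.basis_apply, h, map_one, BaseChange.tmul_one_eq_sum _ b]
  rfl

/-- The vector of `M_{K(x)}` whose coordinates are a column of a matrix. -/
def column (j : ι) : Matrix ι ι (RatFunc K) →ₗ[RatFunc K] Generic P M where
  toFun Y := ∑ i, Y i j • genericBasis b i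
  map_add' Y Z := by simp only [Matrix.add_apply, add_smul, Finset.sum_add_distrib]
  map_smul' f Y := by
    simp only [Matrix.smul_apply, smul_eq_mul, mul_smul, Finset.smul_sum, RingHom.id_apply]

theorem column_apply (j : ι) (Y : Matrix ι ι (RatFunc K)) :
    column b j Y = ∑ i, Y i j • genericBasis b i := rfl

theorem repr_column (i j : ι) (Y : Matrix ι ι (RatFunc K)) :
    (genericBasis b).repr (column b j Y) i = Y i j := by
  rw [column_apply, Module.Basis.repr_sum_self]

theorem column_matOp (j : ι) (Y : Matrix ι ι (RatFunc K)) :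
    column b j (matOp (qUnit k K) (𝓜.opMatrix b) Y) = 𝓜.genericOp (column b j Y) := by
  simp only [column_apply, map_sum, genericOp_smul, genericOp_basis, matOp, Matrix.mul_apply,
    RingHom.mapMatrix_apply, Matrix.map_apply, Finset.sum_smul, Finset.smul_sum, smul_smul]
  rw [Finset.sum_comm]
  exact Finset.sum_congr rfl fun _ _ => Finset.sum_congr rfl fun _ _ => by rw [mul_comm]

section Place

variable {v : CyclotomicPlace k K} (hv : IsGood P v)

theorem latticeToGeneric_smul (f : gaussRing v.ring) (w : Lattice M hv) :
    latticeToGeneric M hv (f • w) = (f : RatFunc K) • latticeToGeneric M hv w :=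
  BaseChange.map_smul _ _ _ _ _ f w

theorem latticeToReduction_smul (f : gaussRing v.ring) (w : Lattice M hv) :
    latticeToReduction M hv (f • w) = gaussRed v.ring f • latticeToReduction M hv w :=
  BaseChange.map_smul _ _ _ _ _ f w

/-- The basis of the lattice given by a basis of `M`. -/
abbrev latticeBasis : Module.Basis ι (gaussRing v.ring) (Lattice M hv) :=
  BaseChange.basis (toGauss hv) b

/-- The basis of the reduction given by a basis of `M`. -/
abbrev reductionBasis : Module.Basis ι (RatFunc v.resField) (Reduction M hv) :=
  BaseChange.basis (toResidue hv) b

theorem latticeToGeneric_basis (i : ι) :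
    latticeToGeneric M hv (latticeBasis b hv i) = genericBasis b i := by
  rw [latticeBasis, BaseChange.basis_apply, genericBasis, BaseChange.basis_apply]
  rfl

theorem latticeToReduction_basis (i : ι) :
    latticeToReduction M hv (latticeBasis b hv i) = reductionBasis b hv i := by
  have h : latticeToReduction M hv (BaseChange.tmul (toGauss hv) 1 (b i)) =
      BaseChange.tmul (toResidue hv) (gaussRed v.ring 1) (b i) := rfl
  rw [latticeBasis, BaseChange.basis_apply, reductionBasis, BaseChange.basis_apply, h, map_one]

theorem repr_latticeToGeneric (w : Lattice M hv) (i : ι) :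
    (genericBasis b).repr (latticeToGeneric M hv w) i ∈ gaussRing v.ring := by
  rw [← (latticeBasis b hv).sum_repr w]
  simp only [map_sum, latticeToGeneric_smul, latticeToGeneric_basis]
  rw [← map_sum, Module.Basis.repr_sum_self]
  exact Subtype.prop _

/-- A `q`-difference module which induces an iterative structure is integral. -/
theorem InducesIterative.integralAt {𝓜 : QDifferenceModule P M} (h : 𝓜.InducesIterative v) :
    IntegralAt (qUnit k K) v.ring (𝓜.opMatrix b) := by
  obtain ⟨hv, D, hD⟩ := h
  intro n Y hY i j
  obtain ⟨w, hw, -⟩ := hD n (∑ l, (⟨Y l j, hY l j⟩ : gaussRing v.ring) • latticeBasis b hv l)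
  have h1 : latticeToGeneric M hv (∑ l, (⟨Y l j, hY l j⟩ : gaussRing v.ring) • latticeBasis b hv l) =
      column b j Y := by
    simp only [map_sum, latticeToGeneric_smul, latticeToGeneric_basis, column_apply]
  rw [h1, ← map_divDelta (S := matOp (qUnit k K) (𝓜.opMatrix b)) (column b j)
    (𝓜.column_matOp b j)] at hw
  have h2 := repr_latticeToGeneric b hv w i
  rwa [hw, repr_column] at h2

/-- A `q`-difference module with a fixed basis which is good at `v` induces a trivial iterative
structure. -/
theorem inducesTrivialIterative_of_fixed (hv : IsGood P v) {F : Matrix ι ι (gaussRing v.ring)} (hF : IsUnit F.det)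
    (hfix : ∀ j, 𝓜.genericOp (column b j ((gaussRing v.ring).subtype.mapMatrix F)) =
      column b j ((gaussRing v.ring).subtype.mapMatrix F)) :
    𝓜.InducesTrivialIterative v := by
  let q := qUnit k K
  have hF' : IsUnit ((gaussRed v.ring).mapMatrix F).det := by
    rw [← RingHom.map_det]
    exact hF.map _
  let bL := basisOfMatrix (latticeBasis b hv) F hF
  let bR := basisOfMatrix (reductionBasis b hv) _ hF'
  have hL : ∀ j, latticeToGeneric M hv (bL j) =
      column b j ((gaussRing v.ring).subtype.mapMatrix F) := fun j => by
    simp only [bL, basisOfMatrix_apply, map_sum, latticeToGeneric_smul, latticeToGeneric_basis,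
      column_apply]
    rfl
  have hR : ∀ j, latticeToReduction M hv (bL j) = bR j := fun j => by
    simp only [bL, bR, basisOfMatrix_apply, map_sum, latticeToReduction_smul,
      latticeToReduction_basis]
    rfl
  refine ⟨hv, trivialStructure v bR, fun n w => ?_, trivialStructure_isTrivial v bR⟩
  -- Coordinates are taken in the fixed basis, where the n-th divided power is the divided
  -- q-derivation of each coordinate, and this reduces to `divDeriv`.
  have hred : ∀ j, ReducesTo v.ring (divDelta q (sigma q) n (bL.repr w j : RatFunc K))
      (divDeriv v.qv n (gaussRed v.ring (bL.repr w j))) := fun j =>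
    (ReducesTo.of_mem (bL.repr w j).2).divDelta n
  choose hmem hval using hred
  refine ⟨∑ j, (⟨_, hmem j⟩ : gaussRing v.ring) • bL j, ?_, ?_⟩
  · have h1 : latticeToGeneric M hv w = ∑ j, (bL.repr w j : RatFunc K) •
        column b j ((gaussRing v.ring).subtype.mapMatrix F) := by
      nth_rewrite 1 [← bL.sum_repr w]
      simp only [map_sum, latticeToGeneric_smul, hL]
    let δ : Generic P M →+ Generic P M :=
      AddMonoidHom.mk' (divDelta q 𝓜.genericOp n) (divDelta_add 𝓜.genericOp n)
    have h2 : δ (latticeToGeneric M hv w) = ∑ j, divDelta q (sigma q) n (bL.repr w j : RatFunc K) •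
        column b j ((gaussRing v.ring).subtype.mapMatrix F) := by
      rw [h1, map_sum]
      exact Finset.sum_congr rfl fun j _ =>
        divDelta_smul_of_fixed 𝓜.genericOp_smul (hfix j) n _
    rw [map_sum]
    simp only [latticeToGeneric_smul, hL]
    exact h2.symm
  · have h1 : latticeToReduction M hv w = ∑ j, gaussRed v.ring (bL.repr w j) • bR j := by
      nth_rewrite 1 [← bL.sum_repr w]
      simp only [map_sum, latticeToReduction_smul, hR]
    rw [trivialStructure_apply, h1, map_sum]
    simp only [latticeToReduction_smul, hR, hval, Module.Basis.repr_sum_self]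

end Place

variable [FiniteDimensional (RatFunc k) K]

/-- One condition handles the infinitely many generators 1/P(q^i x): where the leading coefficient
of P is a unit P has nonzero reduction, and so has P(q^i x), because the reduced substitution is
injective. -/
theorem eventually_isGood (hP : P ≠ 0) : ∀ᶠ v : CyclotomicPlace k K in cofinite, IsGood P v := by
  let p := P.map (algebraMap (FunctionField.ringOfIntegers k K) K)
  have hp : p ≠ 0 := fun h => hP (Polynomial.map_injective _ Subtype.val_injective
    (h.trans (Polynomial.map_zero _).symm))
  filter_upwards [eventually_mem (p.leadingCoeff)⁻¹] with v hv
  have hO : ∀ c : FunctionField.ringOfIntegers k K, (c : K) ∈ v.ring := fun c =>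
    mem_valuationSubring_of_isIntegral v.ring v.algebraMap_mem c.2
  obtain ⟨p', hp'⟩ := exists_map_eq (V := v.ring) (a := p) fun i => by
    rw [coeff_map]; exact hO _
  have hred : polyRed v.ring p' ≠ 0 := by
    refine polyRed_ne_zero v.ring (i := p.natDegree) ?_
    have h1 : (p'.coeff p.natDegree : K) = p.leadingCoeff := by
      rw [leadingCoeff, ← hp', coeff_map]; rfl
    refine IsUnit.of_mul_eq_one ⟨_, hv⟩ (Subtype.ext ?_)
    change (p'.coeff p.natDegree : K) * (p.leadingCoeff)⁻¹ = 1
    rw [h1, mul_inv_cancel₀ (leadingCoeff_ne_zero.2 hp)]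
  intro f hf
  change f ∈ Algebra.adjoin _ _ at hf
  induction hf using Algebra.adjoin_induction with
  | mem g hg =>
    rcases hg with rfl | ⟨i, rfl⟩
    · exact X_mem_gaussRing v.ring
    · have h1 : ReducesTo v.ring (algebraMap K[X] (RatFunc K) p) (polyRed v.ring p') := by
        rw [← hp']; exact ReducesTo.poly p'
      have h2 : (sigma v.qv)^[i] (polyRed v.ring p') ≠ 0 := by
        clear h1
        induction i with
        | zero => exact hred
        | succ i ih =>
          rw [Function.iterate_succ_apply']
          exact (_root_.map_ne_zero _).2 ih
      exact ((reducesTo_sigma_iterate i h1).inv h2).1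
  | algebraMap c =>
    have : algebraMap (FunctionField.ringOfIntegers k K) (RatFunc K) c = RatFunc.C (c : K) := by
      rw [← RatFunc.algebraMap_C]; rfl
    rw [this]
    exact C_mem_gaussRing (hO c)
  | add f g _ _ hf hg => exact add_mem hf hg
  | mul f g _ _ hf hg => exact mul_mem hf hg

theorem becomesTrivial_of_eventually [Module.Free (qRing P) M] [Module.Finite (qRing P) M]
    (h : ∀ᶠ v : CyclotomicPlace k K in cofinite, 𝓜.InducesIterative v) : 𝓜.BecomesTrivial := by
  let b := Module.finBasis (qRing P) M
  have hA : NearlyIntegral k (𝓜.opMatrix b) := h.mono fun v hv => hv.integralAt b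
  obtain ⟨F, H, hHF, hAF⟩ := hA.exists_fixed
  have hF : IsUnit F.det := (Matrix.isUnit_iff_isUnit_det F).1 (IsUnit.of_mul_eq_one_right H hHF)
  refine ⟨_, basisOfMatrix (genericBasis b) F hF, fun j => ?_⟩
  rw [basisOfMatrix_apply]
  change 𝓜.genericOp (column b j F) = column b j F
  rw [← column_matOp, matOp, hAF]

/-- The matrix from a basis of M to a fixed basis and its inverse have finitely many entries, so at
almost all v the fixed basis is also a basis of the lattice. -/
theorem eventually_inducesTrivialIterative [Module.Free (qRing P) M] [Module.Finite (qRing P) M]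
    (hP : P ≠ 0) (h : 𝓜.BecomesTrivial) :
    ∀ᶠ v : CyclotomicPlace k K in cofinite, 𝓜.InducesTrivialIterative v := by
  let b := Module.finBasis (qRing P) M
  obtain ⟨r, c₀, hc₀⟩ := h
  let e := c₀.indexEquiv (genericBasis b)
  let c := c₀.reindex e
  have hc : ∀ j, 𝓜.genericOp (c j) = c j := fun j => by
    simp only [c, Module.Basis.reindex_apply, hc₀]
  let F := (genericBasis b).toMatrix c
  let H := c.toMatrix (genericBasis b)
  have hFH : F * H = 1 := (genericBasis b).toMatrix_mul_toMatrix_flip c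
  filter_upwards [eventually_isGood hP, eventually_matrix_mem_gaussRing F,
    eventually_matrix_mem_gaussRing H] with v hv h1 h2
  let F' : Matrix _ _ (gaussRing v.ring) := fun i j => ⟨F i j, h1 i j⟩
  let H' : Matrix _ _ (gaussRing v.ring) := fun i j => ⟨H i j, h2 i j⟩
  have hF' : (gaussRing v.ring).subtype.mapMatrix F' = F := rfl
  have hH' : (gaussRing v.ring).subtype.mapMatrix H' = H := rfl
  have hFH' : F' * H' = 1 := Matrix.map_injective (Subtype.val_injective (p := (· ∈ gaussRing v.ring))) <|
    show (gaussRing v.ring).subtype.mapMatrix (F' * H') = (gaussRing v.ring).subtype.mapMatrix 1 by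
      rw [map_mul, map_one, hF', hH', hFH]
  have hu : IsUnit F'.det :=
    (Matrix.isUnit_iff_isUnit_det F').1 (IsUnit.of_mul_eq_one H' hFH')
  refine 𝓜.inducesTrivialIterative_of_fixed b hv hu fun j => ?_
  have hcol : column b j ((gaussRing v.ring).subtype.mapMatrix F') = c j := by
    rw [hF', column_apply]
    exact (genericBasis b).sum_toMatrix_smul_self c j
  rw [hcol, hc]

end QDifferenceModule

end QDiff

end

theorem mainTheorem7 {k K : Type*} [Field k] [PerfectField k] [Field K]
    [Algebra k[X] K] [Algebra (RatFunc k) K] [IsScalarTower k[X] (RatFunc k) K]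
    [FiniteDimensional (RatFunc k) K]
    (P : (FunctionField.ringOfIntegers k K)[X]) (hP : P ≠ 0)
    {M : Type*} [AddCommGroup M] [Module (QDiff.qRing P) M]
    [Module.Free (QDiff.qRing P) M] [Module.Finite (QDiff.qRing P) M]
    (𝓜 : QDiff.QDifferenceModule P M) :
    List.TFAE [
      𝓜.BecomesTrivial,
      {v : QDiff.CyclotomicPlace k K | ¬ 𝓜.InducesIterative v}.Finite,
      {v : QDiff.CyclotomicPlace k K | ¬ 𝓜.InducesTrivialIterative v}.Finite] := by
  tfae_have 1 → 3 := fun h =>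
    Filter.eventually_cofinite.1 (𝓜.eventually_inducesTrivialIterative hP h)
  tfae_have 3 → 2 := fun h => h.subset fun v hv hv' => hv (by
    obtain ⟨hg, D, hD, _⟩ := hv'
    exact ⟨hg, D, hD⟩)
  tfae_have 2 → 1 := fun h => 𝓜.becomesTrivial_of_eventually (Filter.eventually_cofinite.2 h)
  tfae_finish
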